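/- Conventions. A positive Lebesgue measurable function $b$ on $(0,\infty)$ is slowly varying ($b\in SV$) if for every $\varepsilon>0$ the function $t^{\varepsilon}b(t)$ is equivalent to a non-decreasing function and $t^{-\varepsilon}b(t)$ is equivalent to a non-increasing function (equivalence means two-sided estimates with positive constants). $\|\cdot\|_{q,I}$ denotes the (quasi-)norm of $L_q(I)$, $0<q\le\infty$, and $1/\infty=0$. For a couple $\bar A=(A_0,A_1)$ put $K(t,f)=K(t,f;\bar A)=\inf\{\|f_0\|_{A_0}+t\|f_1\|_{A_1}: f=f_0+f_1,\ f_i\in A_i\}$. For $0\le\theta\le1$, $0<q,r,s\le\infty$ and positive weights $a,b,c$, the following spaces consist of all $f\in A_0+A_1$ for which the indicated (quasi-)norm is finite: $$\bar A_{\theta,q;b}:\ \|u^{-\theta-1/q}b(u)K(u,f)\|_{q,(0,\infty)},\qquad \bar A^{\mathcal R}_{\theta,r,b,q,a}:\ \Big\|t^{-1/r}b(t)\big\|u^{-\theta-1/q}a(u)K(u,f)\big\|_{q,(t,\infty)}\Big\|_{r,(0,\infty)},$$ $$\bar A^{\mathcal R,\mathcal L}_{\theta,s,c,r,b,q,a}:\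 \Big\|t^{-1/s}c(t)\Big\|u^{-1/r}b(u)\big\|v^{-\theta-1/q}a(v)K(v,f)\big\|_{q,(u,t)}\Big\|_{r,(0,t)}\Big\|_{s,(0,\infty)},$$ $$\bar A^{\mathcal R,\mathcal R}_{\theta,s,c,r,b,q,a}:\ \Big\|t^{-1/s}c(t)\Big\|u^{-1/r}b(u)\big\|v^{-\theta-1/q}a(v)K(v,f)\big\|_{q,(u,\infty)}\Big\|_{r,(t,\infty)}\Big\|_{s,(0,\infty)}.$$ Equality of spaces means equality as sets with equivalent (quasi-)norms. Theorem. Let $\bar A=(A_0,A_1)$ be a compatible couple of (quasi-)Banach spaces with $A_0\cap A_1\ne\{0\}$. Let $0<\theta_0<1$, $0<r,r_0,q_0,r_1,q_1\le\infty$, $a,a_0,b_0,a_1,b_1\in SV$, and suppose that $$\|s^{-1/r_0}b_0(s)\|_{r_0,(0,1)}<\infty,\qquad \Big\|s^{-1/r_1}b_1(s)\big\|u^{-1/q_1}a_1(u)\big\|_{q_1,(s,1)}\Big\|_{r_1,(0,1)}<\infty .$$ For $t>0$ put $$\chi_0(t)=a_0(t)\|s^{-1/r_0}b_0(s)\|_{r_0,(0,t)},\qquad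 \chi_1(t)=\Big\|s^{-1/r_1}b_1(s)\big\|u^{-1/q_1}a_1(u)\big\|_{q_1,(s,t)}\Big\|_{r_1,(0,t)},\qquad \rho(t)=t^{1-\theta_0}\frac{\chi_0(t)}{\chi_1(t)},$$ and for $0\le\theta\le1$ put $a^\#=\chi_0^{1-\theta}\chi_1^{\theta}\,(a\circ\rho)$ and $\eta=(1-\theta)\theta_0+\theta$. (i) If $0<\theta<1$, then $\big(\bar A^{\mathcal R}_{\theta_0,r_0,b_0,q_0,a_0},\bar A^{\mathcal R}_{1,r_1,b_1,q_1,a_1}\big)_{\theta,r;a}=\bar A_{\eta,r;a^\#}$. (ii) If $\|s^{-1/r}a(s)\|_{r,(1,\infty)}<\infty$, then $\big(\bar A^{\mathcal R}_{\theta_0,r_0,b_0,q_0,a_0},\bar A^{\mathcal R}_{1,r_1,b_1,q_1,a_1}\big)_{0,r;a}=\bar A^{\mathcal R,\mathcal L}_{\theta_0,r,a\circ\rho,r_0,b_0,q_0,a_0}$. (iii) If $\|s^{-1/r}a(s)\|_{r,(0,1)}<\infty$, then $$\big(\bar A^{\mathcal R}_{\theta_0,r_0,b_0,q_0,a_0},\bar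 A^{\mathcal R}_{1,r_1,b_1,q_1,a_1}\big)_{1,r;a}=\bar A_{1,r;a^\#}\cap\bar A^{\mathcal R}_{1,r,B_1,q_1,a_1}\cap\bar A^{\mathcal R,\mathcal R}_{1,r,a\circ\rho,r_1,b_1,q_1,a_1},$$ where $a^\#=\chi_1\,(a\circ\rho)$ (the case $\theta=1$) and $B_1(t)=\|s^{-1/r_1}b_1(s)\|_{r_1,(0,t)}\,a(\rho(t))$. -/

import Mathlib

open scoped ENNReal NNReal Topology

namespace RealInterp

open MeasureTheory Set Filter

/-- Equivalence `f ≈ g` of two functions on `(0, ∞)`. -/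
def EquivOnPos (f g : ℝ → ℝ) : Prop :=
  ∃ C : ℝ, 0 < C ∧ ∀ t : ℝ, 0 < t → f t ≤ C * g t ∧ g t ≤ C * f t

/-- Slowly varying functions on `(0, ∞)`: positive Lebesgue measurable functions `b` such that, for
every `ε > 0`, `t ^ ε * b t` is equivalent to a non-decreasing function and `t ^ (-ε) * b t` is
equivalent to a non-increasing function. (Lebesgue measurability on `(0, ∞)` is almost everywhere
equality with a Borel function there. Values outside `(0, ∞)` play no role.) -/
structure SlowlyVarying (b : ℝ → ℝ) : Prop where
  pos : ∀ t : ℝ, 0 < t → 0 < b t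
  aemeasurable : AEMeasurable b (volume.restrict (Ioi 0))
  equiv_monotone : ∀ ε : ℝ, 0 < ε →
    ∃ g : ℝ → ℝ, MonotoneOn g (Ioi 0) ∧ EquivOnPos (fun t => t ^ ε * b t) g
  equiv_antitone : ∀ ε : ℝ, 0 < ε →
    ∃ g : ℝ → ℝ, AntitoneOn g (Ioi 0) ∧ EquivOnPos (fun t => t ^ (-ε) * b t) g

/-- The weighted Lebesgue (quasi-)norm `‖u ^ (α - 1/q) * w(u) * F(u)‖_{L_q(I)}`, for `0 < q ≤ ∞`
(with `1/∞ = 0`), with values in `[0, ∞]`. -/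
noncomputable def wNorm (α : ℝ) (q : ℝ≥0∞) (w : ℝ → ℝ) (I : Set ℝ) (F : ℝ → ℝ≥0∞) : ℝ≥0∞ :=
  eLpNorm (fun u : ℝ => ENNReal.ofReal (u ^ (α - (1 / q).toReal) * w u) * F u) q
    (volume.restrict I)

section Spaces

variable {E : Type*}

/-- A (quasi-)normed space `A` contained in an ambient vector space `E` is described by its
quasi-norm, extended by the value `∞` to `E \ A`; thus `A = {x | N x < ∞}`. The predicate says that
`A` is a quasi-Banach space which is continuously embedded in the topological vector space `E`. -/
structure IsQuasiBanachIn (𝕜 : Type*) [RCLike 𝕜] [AddCommGroup E] [Module 𝕜 E]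
    [TopologicalSpace E] (N : E → ℝ≥0∞) : Prop where
  eq_zero_of_eq_zero : ∀ x : E, N x = 0 → x = 0
  map_smul : ∀ (c : 𝕜) (x : E), N (c • x) = ‖c‖ₑ * N x
  quasi_triangle : ∃ C : ℝ≥0, ∀ x y : E, N (x + y) ≤ C * (N x + N y)
  continuous_embedding : ∀ V ∈ 𝓝 (0 : E), ∃ δ : ℝ≥0∞, 0 < δ ∧ ∀ x : E, N x < δ → x ∈ V
  complete : ∀ x : ℕ → E, (∀ n, N (x n) < ∞) →
    (∀ ε : ℝ≥0∞, 0 < ε → ∃ n₀ : ℕ, ∀ m n : ℕ, n₀ ≤ m → n₀ ≤ n → N (x m - x n) < ε) →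
    ∃ y : E, N y < ∞ ∧ Tendsto (fun n => N (x n - y)) atTop (𝓝 0)

/-- `X = Y`: the spaces coincide as sets and their quasi-norms are equivalent, that is, each of
`X`, `Y` is continuously embedded in the other. -/
def SpaceEq (X Y : E → ℝ≥0∞) : Prop :=
  (∃ C : ℝ≥0, ∀ f : E, Y f ≤ C * X f) ∧ (∃ C : ℝ≥0, ∀ f : E, X f ≤ C * Y f)

/-- The intersection `X ∩ Y`, with its usual quasi-norm. -/
noncomputable def interSpace (X Y : E → ℝ≥0∞) : E → ℝ≥0∞ := fun f => max (X f) (Y f)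

variable [AddCommGroup E]

/-- Peetre's `K`-functional `K(t, f; A₀, A₁)`; it is `∞` when `f ∉ A₀ + A₁`. -/
noncomputable def peetreK (A₀ A₁ : E → ℝ≥0∞) (t : ℝ) (f : E) : ℝ≥0∞ :=
  ⨅ (f₀ : E) (f₁ : E) (_ : f₀ + f₁ = f), A₀ f₀ + ENNReal.ofReal t * A₁ f₁

/-- The standard space `(A₀, A₁)_{θ,q;b}`. For positive weights, finiteness of this quasi-norm and
of the following ones forces `f ∈ A₀ + A₁`. -/
noncomputable def stdSpace (A₀ A₁ : E → ℝ≥0∞) (θ : ℝ) (q : ℝ≥0∞) (b : ℝ → ℝ) : E → ℝ≥0∞ :=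
  fun f => wNorm (-θ) q b (Ioi 0) (fun u => peetreK A₀ A₁ u f)

/-- The limiting space `(A₀, A₁)^{R}_{θ,r,b,q,a}`. -/
noncomputable def spaceR (A₀ A₁ : E → ℝ≥0∞) (θ : ℝ) (r : ℝ≥0∞) (b : ℝ → ℝ) (q : ℝ≥0∞)
    (a : ℝ → ℝ) : E → ℝ≥0∞ :=
  fun f => wNorm 0 r b (Ioi 0) (fun t =>
    wNorm (-θ) q a (Ioi t) (fun u => peetreK A₀ A₁ u f))

/-- The extremal space `(A₀, A₁)^{R,L}_{θ,s,c,r,b,q,a}`. -/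
noncomputable def spaceRL (A₀ A₁ : E → ℝ≥0∞) (θ : ℝ) (s : ℝ≥0∞) (c : ℝ → ℝ) (r : ℝ≥0∞)
    (b : ℝ → ℝ) (q : ℝ≥0∞) (a : ℝ → ℝ) : E → ℝ≥0∞ :=
  fun f => wNorm 0 s c (Ioi 0) (fun t => wNorm 0 r b (Ioo 0 t) (fun u =>
    wNorm (-θ) q a (Ioo u t) (fun v => peetreK A₀ A₁ v f)))

/-- The extremal space `(A₀, A₁)^{R,R}_{θ,s,c,r,b,q,a}`. -/
noncomputable def spaceRR (A₀ A₁ : E → ℝ≥0∞) (θ : ℝ) (s : ℝ≥0∞) (c : ℝ → ℝ) (r : ℝ≥0∞)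
    (b : ℝ → ℝ) (q : ℝ≥0∞) (a : ℝ → ℝ) : E → ℝ≥0∞ :=
  fun f => wNorm 0 s c (Ioi 0) (fun t => wNorm 0 r b (Ioi t) (fun u =>
    wNorm (-θ) q a (Ioi u) (fun v => peetreK A₀ A₁ v f)))

end Spaces

end RealInterp

open RealInterp

/-! Write K(u) = K(u, f; A₀, A₁), and let N₀, N₁ be the quasi-norms of the two limiting spaces. The
core is a Holmstedt formula: at the point ρ(t), the K-functional of the couple of limiting spaces is
equivalent to L(t) + ρ(t) T(t). Here L(t) is the iterated norm of u^(-θ₀) a₀ K truncated to (0, t),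
and T(t) consists of two norms of u^(-1) a₁ K over (t, ∞) (`LimitingCouple.peetreK_equiv`).

For the upper bound, f is split almost optimally at t. Then K(u, f₀) is controlled by K(min(u, t),
f) and K(u, f₁) by min(1, u/t) K(max(u, t), f). The parts of N₀(f₀) and N₁(f₁) beyond L and T both
reduce to the leading term t^(-θ₀) χ₀(t) K(t), the second one because ρ(t) χ₁(t) / t = t^(-θ₀)
χ₀(t). By quasi-concavity of K this leading term is itself bounded by L(t). For the lower bound,
finiteness of N₀ or N₁ bounds K pointwise by a power times a slowly varying function, and each of L,
ρT is then estimated separately on f₀ and f₁.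

The change of variable u = ρ(t) turns the interpolation quasi-norm into a weighted L_r norm of L
plus one of T (`mNorm_weighted_equiv`). The weighted leading term is exactly t^(-η) a# K
(`LimitingCouple.weight_left`). It is always dominated by the L-norm. Hardy-type inequalities
dominate the L-norm by it when θ > 0, and the T-norm when θ < 1. Hence only the leading term
survives for 0 < θ < 1, only L for θ = 0, and the leading term together with the two pieces of T for
θ = 1.

All exponents may be below 1, and ρ need not be monotone or smooth. Duality, Minkowski's inequality
and Jacobians are therefore avoided: a function that varies at most polynomially is dominated at a
point by its norm on a dyadic block, and what remains is a Schur test with the same exponent on both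
sides (`mNorm_kernel_le`). -/

namespace RealInterp

open MeasureTheory Set Filter

/-! ### Multiplicative distance and slowly varying functions -/

/-- The multiplicative distance of two points of `(0, ∞)`: `max (t / s) (s / t)`. -/
noncomputable def spread (s t : ℝ) : ℝ := Real.exp |Real.log t - Real.log s|

theorem spread_pos (s t : ℝ) : 0 < spread s t := Real.exp_pos _

theorem one_le_spread (s t : ℝ) : 1 ≤ spread s t := Real.one_le_exp (abs_nonneg _)

theorem spread_comm (s t : ℝ) : spread s t = spread t s := by
  rw [spread, spread, abs_sub_comm]

theorem spread_triangle (s t u : ℝ) : spread s u ≤ spread s t * spread t u := by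
  rw [spread, spread, spread, ← Real.exp_add]
  apply Real.exp_le_exp.2
  have := abs_sub_le (Real.log u) (Real.log t) (Real.log s)
  linarith

theorem spread_of_le {s t : ℝ} (hs : 0 < s) (h : s ≤ t) : spread s t = t / s := by
  have ht := hs.trans_le h
  rw [spread, abs_of_nonneg (sub_nonneg.2 (Real.log_le_log hs h)), Real.exp_sub,
    Real.exp_log ht, Real.exp_log hs]

theorem div_le_spread {s : ℝ} (hs : 0 < s) (t : ℝ) : t / s ≤ spread s t := by
  rcases le_total s t with h | h
  · exact (spread_of_le hs h).ge
  · exact ((div_le_one hs).2 h).trans (one_le_spread s t)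

theorem le_spread_mul {s : ℝ} (hs : 0 < s) (t : ℝ) : t ≤ spread s t * s :=
  (div_le_iff₀ hs).1 (div_le_spread hs t)

theorem spread_mul_left {c s t : ℝ} (hc : 0 < c) (hs : 0 < s) (ht : 0 < t) :
    spread (c * s) (c * t) = spread s t := by
  rw [spread, spread, Real.log_mul hc.ne' ht.ne', Real.log_mul hc.ne' hs.ne']
  congr 2; ring

theorem spread_le_of_le {s t K : ℝ} (hs : 0 < s) (ht : 0 < t) (h₁ : s ≤ K * t)
    (h₂ : t ≤ K * s) : spread s t ≤ K := by
  rcases le_total s t with h | h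
  · rw [spread_of_le hs h]; exact (div_le_iff₀ hs).2 h₂
  · rw [spread_comm, spread_of_le ht h]; exact (div_le_iff₀ ht).2 h₁

theorem rpow_eq_div_rpow_mul {s t : ℝ} (hs : 0 < s) (ht : 0 < t) (α : ℝ) :
    t ^ α = (t / s) ^ α * s ^ α := by
  rw [← Real.mul_rpow (div_pos ht hs).le hs.le, div_mul_cancel₀ _ hs.ne']

theorem rpow_le_spread_rpow_mul {s t : ℝ} (hs : 0 < s) (ht : 0 < t) (α : ℝ) :
    t ^ α ≤ spread s t ^ |α| * s ^ α := by
  rw [spread, ← Real.exp_mul, Real.rpow_def_of_pos ht, Real.rpow_def_of_pos hs, ← Real.exp_add]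
  apply Real.exp_le_exp.2
  have := abs_mul (Real.log t - Real.log s) α
  have := le_abs_self ((Real.log t - Real.log s) * α)
  nlinarith

/-- Slowly varying weights, in the form of a pointwise estimate. -/
structure IsSV (b : ℝ → ℝ) : Prop where
  pos : ∀ t : ℝ, 0 < t → 0 < b t
  bound : ∀ ε : ℝ, 0 < ε → ∃ C : ℝ, 0 < C ∧ ∀ s t : ℝ, 0 < s → 0 < t →
    b t ≤ C * spread s t ^ ε * b s

/-- The equivalent non-increasing function handles s ≤ t and the non-decreasing one handles t ≤ s.
Each is compared twice, hence the squared constants. -/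
theorem SlowlyVarying.isSV {b : ℝ → ℝ} (hb : SlowlyVarying b) : IsSV b := by
  refine ⟨hb.pos, fun ε hε => ?_⟩
  obtain ⟨g, hg, C, hC, hgC⟩ := hb.equiv_monotone ε hε
  obtain ⟨g', hg', C', hC', hgC'⟩ := hb.equiv_antitone ε hε
  refine ⟨C * C + C' * C', by positivity, fun s t hs ht => ?_⟩
  have hbs := hb.pos s hs
  have key : ∀ D : ℝ, 0 ≤ D → ∀ x : ℝ, 0 < x → x ^ ε * b t ≤ D * D * (x ^ ε * (spread s t ^ ε) * b s) →
      D * D ≤ C * C + C' * C' → b t ≤ (C * C + C' * C') * spread s t ^ ε * b s := by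
    intro D hD x hx h hDD
    have hxp : 0 < x ^ ε := Real.rpow_pos_of_pos hx _
    have : b t ≤ D * D * (spread s t ^ ε * b s) := by
      refine le_of_mul_le_mul_left (h.trans_eq ?_) hxp
      ring
    refine this.trans ?_
    rw [mul_assoc (C * C + C' * C')]
    have : 0 < spread s t ^ ε := Real.rpow_pos_of_pos (spread_pos _ _) _
    gcongr
  rcases le_total s t with h | h
  · have h1 := (hgC' t ht).1
    have h2 := (hgC' s hs).2
    have h3 := hg' (mem_Ioi.2 hs) (mem_Ioi.2 ht) h
    simp only [] at h1 h2
    have h4 : t ^ (-ε) * b t ≤ C' * C' * (s ^ (-ε) * b s) := by nlinarith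
    refine key C' hC'.le t⁻¹ (by positivity) ?_ (by nlinarith)
    rw [spread_of_le hs h]
    rw [Real.rpow_neg ht.le, Real.rpow_neg hs.le] at h4
    rw [Real.inv_rpow ht.le, Real.div_rpow ht.le hs.le]
    refine h4.trans_eq ?_
    have : t ^ ε ≠ 0 := (Real.rpow_pos_of_pos ht _).ne'
    have : s ^ ε ≠ 0 := (Real.rpow_pos_of_pos hs _).ne'
    field_simp
  · have h1 := (hgC t ht).1
    have h2 := (hgC s hs).2
    have h3 := hg (mem_Ioi.2 ht) (mem_Ioi.2 hs) h
    simp only [] at h1 h2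
    have h4 : t ^ ε * b t ≤ C * C * (s ^ ε * b s) := by nlinarith
    refine key C hC.le t ht ?_ (by nlinarith)
    rw [spread_comm, spread_of_le ht h]
    rw [Real.div_rpow hs.le ht.le]
    refine h4.trans_eq ?_
    have : t ^ ε ≠ 0 := (Real.rpow_pos_of_pos ht _).ne'
    field_simp

theorem IsSV.mul {b c : ℝ → ℝ} (hb : IsSV b) (hc : IsSV c) : IsSV (fun t => b t * c t) := by
  refine ⟨fun t ht => mul_pos (hb.pos t ht) (hc.pos t ht), fun ε hε => ?_⟩
  obtain ⟨C, hC, h⟩ := hb.bound (ε / 2) (by positivity)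
  obtain ⟨D, hD, h'⟩ := hc.bound (ε / 2) (by positivity)
  refine ⟨C * D, by positivity, fun s t hs ht => ?_⟩
  have hp := Real.rpow_pos_of_pos (spread_pos s t) (ε / 2)
  have e : spread s t ^ ε = spread s t ^ (ε / 2) * spread s t ^ (ε / 2) := by
    rw [← Real.rpow_add (spread_pos s t)]; congr 1; ring
  calc b t * c t ≤ (C * spread s t ^ (ε / 2) * b s) * (D * spread s t ^ (ε / 2) * c s) :=
        mul_le_mul (h s t hs ht) (h' s t hs ht) (hc.pos t ht).le
          (mul_nonneg (by positivity) (hb.pos s hs).le)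
    _ = _ := by rw [e]; ring

theorem IsSV.inv {b : ℝ → ℝ} (hb : IsSV b) : IsSV (fun t => (b t)⁻¹) := by
  refine ⟨fun t ht => inv_pos.2 (hb.pos t ht), fun ε hε => ?_⟩
  obtain ⟨C, hC, h⟩ := hb.bound ε hε
  refine ⟨C, hC, fun s t hs ht => ?_⟩
  have h1 := h t s ht hs
  have h2 := hb.pos t ht
  have h3 := hb.pos s hs
  rw [spread_comm]
  rw [← div_eq_mul_inv, le_div_iff₀ h3, inv_mul_le_iff₀ h2]
  linarith

theorem IsSV.rpow_of_nonneg {b : ℝ → ℝ} (hb : IsSV b) {α : ℝ} (hα : 0 ≤ α) :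
    IsSV (fun t => b t ^ α) := by
  refine ⟨fun t ht => Real.rpow_pos_of_pos (hb.pos t ht) _, fun ε hε => ?_⟩
  -- Dividing by α + 1 rather than by α includes α = 0.
  obtain ⟨C, hC, h⟩ := hb.bound (ε / (α + 1)) (by positivity)
  refine ⟨C ^ α, by positivity, fun s t hs ht => ?_⟩
  have hp := spread_pos s t
  have h3 := hb.pos s hs
  calc b t ^ α ≤ (C * spread s t ^ (ε / (α + 1)) * b s) ^ α :=
        Real.rpow_le_rpow (hb.pos t ht).le (h s t hs ht) hα
    _ = C ^ α * spread s t ^ (ε / (α + 1) * α) * b s ^ α := by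
        rw [Real.mul_rpow (by positivity) h3.le, Real.mul_rpow hC.le (by positivity),
          ← Real.rpow_mul hp.le]
    _ ≤ C ^ α * spread s t ^ ε * b s ^ α := by
        gcongr
        · exact one_le_spread s t
        · rw [div_mul_eq_mul_div, div_le_iff₀ (by positivity)]; nlinarith

theorem IsSV.rpow {b : ℝ → ℝ} (hb : IsSV b) (α : ℝ) : IsSV (fun t => b t ^ α) := by
  rcases le_total 0 α with h | h
  · exact hb.rpow_of_nonneg h
  · have := (hb.rpow_of_nonneg (neg_nonneg.2 h)).inv
    refine ⟨fun t ht => Real.rpow_pos_of_pos (hb.pos t ht) _, fun ε hε => ?_⟩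
    obtain ⟨C, hC, h⟩ := this.bound ε hε
    refine ⟨C, hC, fun s t hs ht => ?_⟩
    have := h s t hs ht
    rwa [Real.rpow_neg (hb.pos t ht).le, Real.rpow_neg (hb.pos s hs).le, inv_inv, inv_inv] at this

theorem IsSV.comp {b ρ : ℝ → ℝ} (hb : IsSV b) (hρ : ∀ t, 0 < t → 0 < ρ t) {A C : ℝ} (hA : 0 < A)
    (hC : 0 < C)
    (h : ∀ s t, 0 < s → 0 < t → spread (ρ s) (ρ t) ≤ C * spread s t ^ A) :
    IsSV (fun t => b (ρ t)) := by
  refine ⟨fun t ht => hb.pos _ (hρ t ht), fun ε hε => ?_⟩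
  obtain ⟨D, hD, h'⟩ := hb.bound (ε / A) (by positivity)
  refine ⟨D * C ^ (ε / A), by positivity, fun s t hs ht => ?_⟩
  have hp := spread_pos s t
  have h3 := hb.pos _ (hρ s hs)
  calc b (ρ t) ≤ D * spread (ρ s) (ρ t) ^ (ε / A) * b (ρ s) := h' _ _ (hρ s hs) (hρ t ht)
    _ ≤ D * (C * spread s t ^ A) ^ (ε / A) * b (ρ s) := by
        gcongr
        · exact (spread_pos _ _).le
        · exact h s t hs ht
    _ = _ := by
        rw [Real.mul_rpow hC.le (by positivity), ← Real.rpow_mul hp.le, mul_div_cancel₀ _ hA.ne']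
        ring

/-- Increasing powers times slowly varying functions distort `spread` at most polynomially. -/
theorem IsSV.spread_le {σ : ℝ → ℝ} (hσ : IsSV σ) (κ : ℝ) :
    ∃ C : ℝ, 0 < C ∧ ∀ s t, 0 < s → 0 < t →
      spread (s ^ κ * σ s) (t ^ κ * σ t) ≤ C * spread s t ^ (|κ| + 1) := by
  obtain ⟨C, hC, h⟩ := hσ.bound 1 one_pos
  refine ⟨C, hC, fun s t hs ht => ?_⟩
  have hpos : ∀ t, 0 < t → 0 < t ^ κ * σ t := fun t ht =>
    mul_pos (Real.rpow_pos_of_pos ht _) (hσ.pos t ht)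
  have key : ∀ s t, 0 < s → 0 < t →
      t ^ κ * σ t ≤ C * spread s t ^ (|κ| + 1) * (s ^ κ * σ s) := by
    intro s t hs ht
    have h1 := rpow_le_spread_rpow_mul hs ht κ
    have h2 := h s t hs ht
    have h3 := hσ.pos s hs
    have := spread_pos s t
    calc t ^ κ * σ t ≤ (spread s t ^ |κ| * s ^ κ) * (C * spread s t ^ (1 : ℝ) * σ s) :=
          mul_le_mul h1 h2 (hσ.pos t ht).le (by positivity)
      _ = _ := by rw [Real.rpow_add this]; ring
  refine spread_le_of_le (hpos s hs) (hpos t ht) ?_ (key s t hs ht)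
  rw [spread_comm s t]; exact key t s ht hs

/-- Half of the exponent κ absorbs the slow variation of σ; the other half remains as genuine
growth. This serves as monotonicity up to a constant. -/
theorem IsSV.spread_ge {σ : ℝ → ℝ} (hσ : IsSV σ) {κ : ℝ} (hκ : 0 < κ) :
    ∃ C : ℝ, 0 < C ∧ ∀ s t, 0 < s → s ≤ t →
      (t / s) ^ (κ / 2) * (s ^ κ * σ s) ≤ C * (t ^ κ * σ t) := by
  obtain ⟨C, hC, h⟩ := hσ.bound (κ / 2) (by positivity)
  refine ⟨C, hC, fun s t hs hst => ?_⟩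
  have ht := hs.trans_le hst
  have h1 := h t s ht hs
  rw [spread_comm, spread_of_le hs hst] at h1
  have hd : 0 < t / s := div_pos ht hs
  rw [rpow_eq_div_rpow_mul hs ht κ]
  have e : (t / s) ^ κ = (t / s) ^ (κ / 2) * (t / s) ^ (κ / 2) := by
    rw [← Real.rpow_add hd]; congr 1; ring
  calc (t / s) ^ (κ / 2) * (s ^ κ * σ s)
      ≤ (t / s) ^ (κ / 2) * (s ^ κ * (C * (t / s) ^ (κ / 2) * σ t)) := by gcongr
    _ = _ := by rw [e]; ring

/-- Coarse injectivity of t ^ κ * σ t: points far apart have images far apart. It supplies the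
integrability condition in the change of variable. -/
theorem IsSV.spread_rpow_le {σ : ℝ → ℝ} (hσ : IsSV σ) {κ : ℝ} (hκ : 0 < κ) :
    ∃ C : ℝ, 0 < C ∧ ∀ s t, 0 < s → 0 < t →
      spread s t ^ (κ / 2) ≤ C * spread (s ^ κ * σ s) (t ^ κ * σ t) := by
  obtain ⟨C, hC, h⟩ := hσ.spread_ge hκ
  refine ⟨C, hC, ?_⟩
  have hpos : ∀ t, 0 < t → 0 < t ^ κ * σ t := fun t ht =>
    mul_pos (Real.rpow_pos_of_pos ht _) (hσ.pos t ht)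
  have key : ∀ s t, 0 < s → s ≤ t →
      spread s t ^ (κ / 2) ≤ C * spread (s ^ κ * σ s) (t ^ κ * σ t) := by
    intro s t hs hst
    have ht := hs.trans_le hst
    rw [spread_of_le hs hst]
    have h1 := h s t hs hst
    rw [← le_div_iff₀ (hpos s hs), mul_div_assoc] at h1
    refine h1.trans ?_
    gcongr
    exact div_le_spread (hpos s hs) _
  intro s t hs ht
  rcases le_total s t with hst | hst
  · exact key s t hs hst
  · rw [spread_comm s t, spread_comm (s ^ κ * σ s)]; exact key t s ht hst

/-- A positive power times a slowly varying function comes close to every positive number. -/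
theorem IsSV.exists_spread_le {σ : ℝ → ℝ} (hσ : IsSV σ) {κ : ℝ} (hκ : 0 < κ) :
    ∃ L : ℝ, 0 < L ∧ ∀ u, 0 < u → ∃ t, 0 < t ∧ spread (t ^ κ * σ t) u ≤ L := by
  obtain ⟨C, hC, h⟩ := hσ.spread_le κ
  obtain ⟨D, hD, h'⟩ := hσ.spread_ge hκ
  have hpos : ∀ t, 0 < t → 0 < t ^ κ * σ t := fun t ht =>
    mul_pos (Real.rpow_pos_of_pos ht _) (hσ.pos t ht)
  set ρ : ℝ → ℝ := fun t => t ^ κ * σ t with hρ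
  refine ⟨C * 2 ^ (|κ| + 1), by positivity, fun u hu => ?_⟩
  have hlim : Tendsto (fun n : ℕ => ((2 : ℝ) ^ (κ / 2)) ^ n) atTop atTop :=
    tendsto_pow_atTop_atTop_of_one_lt (Real.one_lt_rpow one_lt_two (by positivity))
  have e : ∀ n : ℕ, ((2 : ℝ) ^ (n : ℤ)) ^ (κ / 2) = ((2 : ℝ) ^ (κ / 2)) ^ n := by
    intro n
    rw [zpow_natCast, ← Real.rpow_natCast, ← Real.rpow_natCast, ← Real.rpow_mul zero_le_two,
      ← Real.rpow_mul zero_le_two, mul_comm]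
  -- The equation ρ t = u may have no solution, so take the greatest k with ρ (2 ^ k) ≤ u. Growth at
  -- ∞ bounds such k from above, and decay at 0 provides one. The value at the next dyadic point
  -- exceeds u, and neighbouring values differ by a bounded factor.
  have hP : ∃ k : ℤ, ρ (2 ^ k) ≤ u ∧ u < ρ (2 ^ (k + 1)) := by
    have hb : ∃ b : ℤ, ∀ z : ℤ, ρ (2 ^ z) ≤ u → z ≤ b := by
      obtain ⟨n, hn⟩ := (hlim.eventually_gt_atTop (D * u / ρ 1)).exists
      refine ⟨n, fun z hz => ?_⟩
      by_contra! hlt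
      have h2 : (2 : ℝ) ^ (n : ℤ) ≤ 2 ^ z := zpow_le_zpow_right₀ one_le_two hlt.le
      have h1 : (1 : ℝ) ≤ 2 ^ (n : ℤ) := by rw [zpow_natCast]; exact one_le_pow₀ one_le_two
      have h3 := h' 1 (2 ^ z) one_pos (h1.trans h2)
      rw [div_one] at h3
      have h4 : ((2 : ℝ) ^ (n : ℤ)) ^ (κ / 2) ≤ (2 ^ z) ^ (κ / 2) := by gcongr
      rw [e] at h4
      have h5 : D * u / ρ 1 * ρ 1 < ((2 : ℝ) ^ (κ / 2)) ^ n * ρ 1 :=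
        mul_lt_mul_of_pos_right hn (hpos 1 one_pos)
      rw [div_mul_cancel₀ _ (hpos 1 one_pos).ne'] at h5
      have h6 : ((2 : ℝ) ^ (κ / 2)) ^ n * ρ 1 ≤ (2 ^ z) ^ (κ / 2) * ρ 1 :=
        mul_le_mul_of_nonneg_right h4 (hpos 1 one_pos).le
      have h7 : D * ρ (2 ^ z) ≤ D * u := mul_le_mul_of_nonneg_left hz hD.le
      have h8 : (2 ^ z) ^ (κ / 2) * ρ 1 ≤ D * ρ (2 ^ z) := h3
      linarith
    have hne : ∃ z : ℤ, ρ (2 ^ z) ≤ u := by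
      obtain ⟨n, hn⟩ := (hlim.eventually_gt_atTop (D * ρ 1 / u)).exists
      refine ⟨-n, ?_⟩
      have h1 : (1 : ℝ) ≤ 2 ^ (n : ℤ) := by rw [zpow_natCast]; exact one_le_pow₀ one_le_two
      have h3 := h' (2 ^ (-(n : ℤ))) 1 (by positivity) (by rw [zpow_neg]; exact inv_le_one_of_one_le₀ h1)
      rw [one_div, zpow_neg, inv_inv, e] at h3
      rw [zpow_neg]
      have h4 : D * ρ 1 < ((2 : ℝ) ^ (κ / 2)) ^ n * u := (div_lt_iff₀ hu).1 hn
      have h5 : ((2 : ℝ) ^ (κ / 2)) ^ n * ρ ((2 ^ (n : ℤ))⁻¹) ≤ D * ρ 1 := h3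
      exact le_of_mul_le_mul_left (h5.trans h4.le) (by positivity)
    obtain ⟨k, hk, hk'⟩ := Int.exists_greatest_of_bdd hb hne
    refine ⟨k, hk, ?_⟩
    by_contra! hlt
    have := hk' _ hlt
    omega
  obtain ⟨k, hk, hk'⟩ := hP
  have h2 : (0 : ℝ) < 2 ^ k := by positivity
  refine ⟨2 ^ k, h2, spread_le_of_le (hpos _ h2) hu ?_ ?_⟩
  · have : 1 ≤ C * 2 ^ (|κ| + 1) := by
      have h1 := h 1 2 one_pos two_pos
      rw [spread_of_le one_pos one_le_two, div_one] at h1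
      exact (one_le_spread _ _).trans h1
    exact hk.trans (le_mul_of_one_le_left hu.le this)
  · refine hk'.le.trans ?_
    have h1 := h (2 ^ k) (2 ^ (k + 1)) h2 (by positivity)
    have h3 : spread ((2 : ℝ) ^ k) (2 ^ (k + 1)) = 2 := by
      rw [spread_of_le h2 (zpow_le_zpow_right₀ one_le_two (by omega)), zpow_add₀ two_ne_zero,
        zpow_one, mul_comm, mul_div_assoc, div_self h2.ne', mul_one]
    rw [h3] at h1
    exact (le_spread_mul (hpos _ h2) _).trans
      (mul_le_mul_of_nonneg_right h1 (hpos _ h2).le)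

/-! ### The dilation-invariant measure du/u and its quasi-norms -/

/-- The measure `du / u` on `(0, ∞)`. -/
noncomputable def mulMeasure : Measure ℝ :=
  (volume.restrict (Ioi 0)).withDensity (fun u => ENNReal.ofReal u⁻¹)

instance : SFinite mulMeasure := by unfold mulMeasure; infer_instance

theorem measurable_ofReal_inv : Measurable (fun u : ℝ => ENNReal.ofReal u⁻¹) := by fun_prop

theorem mulMeasure_restrict {I : Set ℝ} (hI : MeasurableSet I) (hI' : I ⊆ Ioi 0) :
    mulMeasure.restrict I = (volume.restrict I).withDensity (fun u => ENNReal.ofReal u⁻¹) := by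
  rw [mulMeasure, restrict_withDensity hI, Measure.restrict_restrict hI, inter_eq_left.2 hI']

theorem mulMeasure_absolutelyContinuous : mulMeasure ≪ volume.restrict (Ioi 0) :=
  withDensity_absolutelyContinuous _ _

theorem mulMeasure_restrict_Ioi : mulMeasure.restrict (Ioi 0) = mulMeasure := by
  rw [mulMeasure_restrict measurableSet_Ioi Subset.rfl, mulMeasure]

theorem ae_mulMeasure_pos : ∀ᵐ u ∂mulMeasure, 0 < u :=
  mulMeasure_absolutelyContinuous.ae_le (ae_restrict_mem measurableSet_Ioi)

theorem lintegral_mulMeasure_restrict {I : Set ℝ} (hI : MeasurableSet I) (hI' : I ⊆ Ioi 0)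
    (F : ℝ → ℝ≥0∞) :
    ∫⁻ u in I, F u ∂mulMeasure = ∫⁻ u in I, ENNReal.ofReal u⁻¹ * F u := by
  rw [mulMeasure_restrict hI hI', lintegral_withDensity_eq_lintegral_mul_non_measurable₀ _
    measurable_ofReal_inv.aemeasurable (ae_of_all _ fun x => ENNReal.ofReal_lt_top)]
  rfl

theorem measurable_const_mul_real (c : ℝ) : Measurable (fun u : ℝ => c * u) :=
  measurable_id.const_mul c

theorem measurableEmbedding_const_mul {c : ℝ} (hc : 0 < c) :
    MeasurableEmbedding (fun u : ℝ => c * u) :=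
  (Homeomorph.mulLeft₀ c hc.ne').measurableEmbedding

theorem measurePreserving_mulMeasure {c : ℝ} (hc : 0 < c) :
    MeasurePreserving (fun u : ℝ => c * u) mulMeasure mulMeasure := by
  refine ⟨measurable_const_mul_real c, Measure.ext fun s hs => ?_⟩
  have hpre : MeasurableSet ((fun u : ℝ => c * u) ⁻¹' s) := measurable_const_mul_real c hs
  rw [Measure.map_apply (measurable_const_mul_real c) hs, mulMeasure,
    withDensity_apply _ hs, withDensity_apply _ hpre, Measure.restrict_restrict hs,
    Measure.restrict_restrict hpre]
  have h1 : volume.restrict (s ∩ Ioi 0)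
      = (ENNReal.ofReal c • Measure.map (fun u => c * u) volume).restrict (s ∩ Ioi 0) := by
    have h := Real.smul_map_volume_mul_left hc.ne'
    rw [abs_of_pos hc] at h
    rw [h]
  have h2 : (fun u : ℝ => c * u) ⁻¹' s ∩ Ioi 0 = (fun u : ℝ => c * u) ⁻¹' (s ∩ Ioi 0) := by
    ext u; simp [hc]
  rw [h1, h2, Measure.restrict_smul, lintegral_smul_measure,
    setLIntegral_map (hs.inter measurableSet_Ioi) measurable_ofReal_inv
      (measurable_const_mul_real c), smul_eq_mul, ← lintegral_const_mul']
  · refine lintegral_congr fun u => ?_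
    rw [← ENNReal.ofReal_mul hc.le, mul_inv, mul_inv_cancel_left₀ hc.ne']
  · exact ENNReal.ofReal_ne_top

/-- The `L_q` quasi-norm over `I` with respect to `du / u`. -/
noncomputable def mNorm (q : ℝ≥0∞) (I : Set ℝ) (F : ℝ → ℝ≥0∞) : ℝ≥0∞ :=
  eLpNorm F q (mulMeasure.restrict I)

theorem mNorm_top (I : Set ℝ) (F : ℝ → ℝ≥0∞) :
    mNorm ∞ I F = essSup F (mulMeasure.restrict I) := by
  simp [mNorm, eLpNorm_exponent_top, eLpNormEssSup_eq_essSup_enorm]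

theorem mNorm_eq_lintegral {q : ℝ≥0∞} (hq : 0 < q) (hq' : q ≠ ∞) (I : Set ℝ) (F : ℝ → ℝ≥0∞) :
    mNorm q I F = (∫⁻ u in I, F u ^ q.toReal ∂mulMeasure) ^ (1 / q.toReal) := by
  simp [mNorm, eLpNorm_eq_lintegral_rpow_enorm_toReal hq.ne' hq']

theorem mNorm_rpow {q : ℝ≥0∞} (hq : 0 < q) (hq' : q ≠ ∞) (I : Set ℝ) (F : ℝ → ℝ≥0∞) :
    mNorm q I F ^ q.toReal = ∫⁻ u in I, F u ^ q.toReal ∂mulMeasure := by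
  rw [mNorm_eq_lintegral hq hq', ← ENNReal.rpow_mul, one_div,
    inv_mul_cancel₀ (ENNReal.toReal_pos hq.ne' hq').ne', ENNReal.rpow_one]

/-- For finite q the q-th power of u^(-1/q) is the density 1/u. For q = ∞ that factor is absent, and
the two measures have the same null sets. -/
theorem wNorm_eq_mNorm (α : ℝ) {q : ℝ≥0∞} (hq : 0 < q) (w : ℝ → ℝ) {I : Set ℝ}
    (hI : MeasurableSet I) (hI' : I ⊆ Ioi 0) (F : ℝ → ℝ≥0∞) :
    wNorm α q w I F = mNorm q I (fun u => ENNReal.ofReal (u ^ α * w u) * F u) := by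
  by_cases hq' : q = ∞
  · subst hq'
    rw [mNorm_top, wNorm, eLpNorm_exponent_top, eLpNormEssSup_eq_essSup_enorm]
    have h1 : mulMeasure.restrict I ≪ volume.restrict I := by
      rw [mulMeasure_restrict hI hI']; exact withDensity_absolutelyContinuous _ _
    have h2 : volume.restrict I ≪ mulMeasure.restrict I := by
      rw [mulMeasure_restrict hI hI']
      refine withDensity_absolutelyContinuous' measurable_ofReal_inv.aemeasurable ?_
      filter_upwards [ae_restrict_mem hI] with u hu
      simpa using hI' hu
    simp only [ENNReal.div_top, ENNReal.toReal_zero, sub_zero, enorm_eq_self]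
    exact le_antisymm (essSup_mono_measure h2) (essSup_mono_measure h1)
  · have hp := ENNReal.toReal_pos hq.ne' hq'
    rw [mNorm_eq_lintegral hq hq', wNorm, eLpNorm_eq_lintegral_rpow_enorm_toReal hq.ne' hq',
      lintegral_mulMeasure_restrict hI hI']
    congr 1
    refine setLIntegral_congr_fun hI fun u hu => ?_
    have hu0 : 0 < u := hI' hu
    have e1 : u ^ (α - (1 / q).toReal) = u ^ (-(1 / q).toReal) * u ^ α := by
      rw [← Real.rpow_add hu0]; congr 1; ring
    have e2 : ENNReal.ofReal (u ^ (-(1 / q).toReal)) ^ q.toReal = ENNReal.ofReal u⁻¹ := by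
      rw [ENNReal.ofReal_rpow_of_nonneg (by positivity) hp.le, ← Real.rpow_mul hu0.le,
        one_div, ENNReal.toReal_inv, neg_mul, inv_mul_cancel₀ hp.ne', Real.rpow_neg_one]
    simp only [enorm_eq_self]
    rw [e1, mul_assoc, ENNReal.ofReal_mul (by positivity), mul_assoc,
      ENNReal.mul_rpow_of_nonneg _ _ hp.le, e2]

theorem mNorm_mono {q : ℝ≥0∞} {I : Set ℝ} (hI : MeasurableSet I) {F G : ℝ → ℝ≥0∞}
    (h : ∀ u ∈ I, F u ≤ G u) : mNorm q I F ≤ mNorm q I G :=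
  eLpNorm_mono_enorm_ae ((ae_restrict_mem hI).mono fun u hu => by simpa using h u hu)

theorem mNorm_congr {q : ℝ≥0∞} {I : Set ℝ} (hI : MeasurableSet I) {F G : ℝ → ℝ≥0∞}
    (h : ∀ u ∈ I, F u = G u) : mNorm q I F = mNorm q I G :=
  le_antisymm (mNorm_mono hI fun u hu => (h u hu).le) (mNorm_mono hI fun u hu => (h u hu).ge)

theorem mNorm_mono_set {q : ℝ≥0∞} {I J : Set ℝ} (h : I ⊆ J) (F : ℝ → ℝ≥0∞) :
    mNorm q I F ≤ mNorm q J F :=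
  eLpNorm_mono_measure _ (Measure.restrict_mono h le_rfl)

/-- This direction holds for every c, including ∞, and for F without any measurability. The converse
below asks for c ≠ ∞. -/
theorem mul_mNorm_le {q : ℝ≥0∞} (hq : 0 < q) (I : Set ℝ) (c : ℝ≥0∞) (F : ℝ → ℝ≥0∞) :
    c * mNorm q I F ≤ mNorm q I (fun u => c * F u) := by
  by_cases hq' : q = ∞
  · subst hq'; rw [mNorm_top, mNorm_top, ENNReal.essSup_const_mul]
  · have hp := ENNReal.toReal_pos hq.ne' hq'
    rw [← ENNReal.rpow_le_rpow_iff hp, ENNReal.mul_rpow_of_nonneg _ _ hp.le, mNorm_rpow hq hq',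
      mNorm_rpow hq hq']
    refine (lintegral_const_mul_le _ _).trans_eq (lintegral_congr fun u => ?_)
    rw [ENNReal.mul_rpow_of_nonneg _ _ hp.le]

theorem mNorm_const_mul {q : ℝ≥0∞} (hq : 0 < q) (I : Set ℝ) {c : ℝ≥0∞} (hc : c ≠ ∞)
    (F : ℝ → ℝ≥0∞) : mNorm q I (fun u => c * F u) = c * mNorm q I F := by
  by_cases hq' : q = ∞
  · subst hq'; rw [mNorm_top, mNorm_top, ENNReal.essSup_const_mul]
  · have hp := ENNReal.toReal_pos hq.ne' hq'
    refine (ENNReal.rpow_left_injective hp.ne') ?_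
    simp only
    rw [ENNReal.mul_rpow_of_nonneg _ _ hp.le, mNorm_rpow hq hq', mNorm_rpow hq hq',
      ← lintegral_const_mul' _ _ (ENNReal.rpow_ne_top_of_nonneg hp.le hc)]
    exact lintegral_congr fun u => ENNReal.mul_rpow_of_nonneg _ _ hp.le

theorem mNorm_mul_const {q : ℝ≥0∞} (hq : 0 < q) (I : Set ℝ) {c : ℝ≥0∞} (hc : c ≠ ∞)
    (F : ℝ → ℝ≥0∞) : mNorm q I (fun u => F u * c) = mNorm q I F * c := by
  simp_rw [mul_comm _ c]; exact mNorm_const_mul hq I hc F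

theorem mNorm_le_const_mul {q : ℝ≥0∞} (hq : 0 < q) {I : Set ℝ} (hI : MeasurableSet I) {c : ℝ≥0∞}
    (hc : c ≠ ∞) {F G : ℝ → ℝ≥0∞} (h : ∀ u ∈ I, F u ≤ c * G u) :
    mNorm q I F ≤ c * mNorm q I G :=
  (mNorm_mono hI h).trans_eq (mNorm_const_mul hq I hc G)

theorem le_mNorm_of_mul_le {q : ℝ≥0∞} (hq : 0 < q) {I : Set ℝ} (hI : MeasurableSet I) {c : ℝ≥0∞}
    {F G : ℝ → ℝ≥0∞} (h : ∀ u ∈ I, c * F u ≤ G u) : c * mNorm q I F ≤ mNorm q I G :=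
  (mul_mNorm_le hq I c F).trans (mNorm_mono hI h)

theorem mNorm_dilation (q : ℝ≥0∞) {c : ℝ} (hc : 0 < c) (I : Set ℝ) (F : ℝ → ℝ≥0∞) :
    mNorm q I F = mNorm q ((fun u => c * u) ⁻¹' I) (fun u => F (c * u)) := by
  have h := (measurePreserving_mulMeasure hc).restrict_preimage_emb
    (measurableEmbedding_const_mul hc) I
  rw [mNorm, ← h.map_eq, (measurableEmbedding_const_mul hc).eLpNorm_map_measure]
  rfl

theorem preimage_mul_Ioo {c : ℝ} (hc : 0 < c) (s t : ℝ) :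
    (fun u => c * u) ⁻¹' Ioo (c * s) (c * t) = Ioo s t := by
  ext u; exact and_congr (mul_lt_mul_iff_right₀ hc) (mul_lt_mul_iff_right₀ hc)

theorem mNorm_Ioo_dilation (q : ℝ≥0∞) {c : ℝ} (hc : 0 < c) (s t : ℝ) (F : ℝ → ℝ≥0∞) :
    mNorm q (Ioo (c * s) (c * t)) F = mNorm q (Ioo s t) (fun u => F (c * u)) := by
  rw [mNorm_dilation q hc, preimage_mul_Ioo hc]

theorem mNorm_union_le {q : ℝ≥0∞} (hq : 0 < q) : ∃ C : ℝ≥0, ∀ (I J : Set ℝ) (F : ℝ → ℝ≥0∞),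
    mNorm q (I ∪ J) F ≤ C * (mNorm q I F + mNorm q J F) := by
  by_cases hq' : q = ∞
  · subst hq'
    refine ⟨1, fun I J F => ?_⟩
    rw [ENNReal.coe_one, one_mul, mNorm_top]
    refine essSup_le_of_ae_le _ ?_
    have h1 : ∀ᵐ u ∂mulMeasure.restrict I, F u ≤ mNorm ∞ I F := by
      rw [mNorm_top]; exact ENNReal.ae_le_essSup _
    have h2 : ∀ᵐ u ∂mulMeasure.restrict J, F u ≤ mNorm ∞ J F := by
      rw [mNorm_top]; exact ENNReal.ae_le_essSup _
    rw [EventuallyLE, ae_restrict_union_iff]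
    exact ⟨h1.mono fun u hu => hu.trans le_self_add, h2.mono fun u hu => hu.trans le_add_self⟩
  · have hp := ENNReal.toReal_pos hq.ne' hq'
    refine ⟨2 ^ (1 / q.toReal), fun I J F => ?_⟩
    rw [← ENNReal.rpow_le_rpow_iff hp, ENNReal.mul_rpow_of_nonneg _ _ hp.le, mNorm_rpow hq hq']
    have e : ((2 ^ (1 / q.toReal) : ℝ≥0) : ℝ≥0∞) ^ q.toReal = 2 := by
      rw [← ENNReal.coe_rpow_of_nonneg _ hp.le, ← NNReal.rpow_mul, one_div,
        inv_mul_cancel₀ hp.ne', NNReal.rpow_one]; rfl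
    rw [e, two_mul]
    refine (lintegral_union_le _ _ _).trans ?_
    rw [← mNorm_rpow hq hq', ← mNorm_rpow hq hq']
    exact add_le_add (ENNReal.rpow_le_rpow le_self_add hp.le)
      (ENNReal.rpow_le_rpow le_add_self hp.le)

theorem mNorm_add_le (q : ℝ≥0∞) : ∃ C : ℝ≥0, ∀ (I : Set ℝ) (F G : ℝ → ℝ≥0∞),
    AEMeasurable F mulMeasure → AEMeasurable G mulMeasure →
    mNorm q I (fun u => F u + G u) ≤ C * (mNorm q I F + mNorm q I G) := by
  refine ⟨q.LpAddConst.toNNReal, fun I F G hF hG => ?_⟩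
  rw [ENNReal.coe_toNNReal (ENNReal.LpAddConst_lt_top q).ne]
  exact eLpNorm_add_le' hF.restrict.aestronglyMeasurable hG.restrict.aestronglyMeasurable q

/-! ### Doubling functions, kernels of polynomial decay and Schur's test -/

theorem measurable_spread : Measurable (Function.uncurry spread) := by
  unfold spread Function.uncurry; fun_prop

theorem AEMeasurable.spread {α : Type*} [MeasurableSpace α] {μ : Measure α} {f g : α → ℝ}
    (hf : AEMeasurable f μ) (hg : AEMeasurable g μ) :
    AEMeasurable (fun x => spread (f x) (g x)) μ :=
  measurable_spread.comp_aemeasurable (hf.prodMk hg)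

/-- Functions which are doubling, with explicit constants. -/
structure IsModerate (A C : ℝ) (h : ℝ → ℝ≥0∞) : Prop where
  nonneg : 0 ≤ A
  pos : 0 < C
  bound : ∀ s t : ℝ, 0 < s → 0 < t → h t ≤ ENNReal.ofReal (C * spread s t ^ A) * h s

theorem IsModerate.mul {A C A' C' : ℝ} {h h' : ℝ → ℝ≥0∞} (hh : IsModerate A C h)
    (hh' : IsModerate A' C' h') : IsModerate (A + A') (C * C') (fun u => h u * h' u) := by
  refine ⟨add_nonneg hh.nonneg hh'.nonneg, mul_pos hh.pos hh'.pos, fun s t hs ht => ?_⟩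
  have hC := hh.pos
  have hp := spread_pos s t
  refine (mul_le_mul' (hh.bound s t hs ht) (hh'.bound s t hs ht)).trans_eq ?_
  rw [mul_mul_mul_comm, ← ENNReal.ofReal_mul (by positivity), Real.rpow_add hp]
  congr 2; ring

theorem IsSV.isModerate {b : ℝ → ℝ} (hb : IsSV b) (α : ℝ) :
    ∃ A C : ℝ, IsModerate A C (fun u => ENNReal.ofReal (u ^ α * b u)) := by
  obtain ⟨C, hC, h⟩ := hb.bound 1 one_pos
  refine ⟨|α| + 1, C, by positivity, hC, fun s t hs ht => ?_⟩
  have hp := spread_pos s t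
  rw [← ENNReal.ofReal_mul (by positivity)]
  apply ENNReal.ofReal_le_ofReal
  have h1 := rpow_le_spread_rpow_mul hs ht α
  have h2 := h s t hs ht
  calc t ^ α * b t ≤ (spread s t ^ |α| * s ^ α) * (C * spread s t ^ (1 : ℝ) * b s) :=
        mul_le_mul h1 h2 (hb.pos t ht).le (by positivity)
    _ = _ := by rw [Real.rpow_add hp]; ring

/-- Non-decreasing functions `k` such that `k t / t` is non-increasing. -/
structure IsQuasiConcave (k : ℝ → ℝ≥0∞) : Prop where
  mono : Monotone k
  mul_le : ∀ s t : ℝ, 0 < s → s ≤ t → k t ≤ ENNReal.ofReal (t / s) * k s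

theorem IsQuasiConcave.isModerate {k : ℝ → ℝ≥0∞} (hk : IsQuasiConcave k) : IsModerate 1 1 k := by
  refine ⟨zero_le_one, zero_lt_one, fun s t hs ht => ?_⟩
  rw [Real.rpow_one, one_mul]
  rcases le_total s t with h | h
  · rw [spread_of_le hs h]; exact hk.mul_le s t hs h
  · refine (hk.mono h).trans (le_mul_of_one_le_left zero_le ?_)
    rw [← ENNReal.ofReal_one]; exact ENNReal.ofReal_le_ofReal (one_le_spread _ _)

theorem IsSV.isModerate_mul {b : ℝ → ℝ} (hb : IsSV b) (α : ℝ) :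
    ∃ A C : ℝ, ∀ k : ℝ → ℝ≥0∞, IsQuasiConcave k →
      IsModerate A C (fun u => ENNReal.ofReal (u ^ α * b u) * k u) := by
  obtain ⟨A, C, h⟩ := hb.isModerate α
  exact ⟨A + 1, C * 1, fun k hk => h.mul hk.isModerate⟩

theorem mNorm_one_ne_zero {q : ℝ≥0∞} (hq : 0 < q) {c d : ℝ} (hc : 0 < c) (hcd : c < d) :
    mNorm q (Ioo c d) (fun _ => 1) ≠ 0 := by
  have hI : Ioo c d ⊆ Ioi 0 := fun u hu => hc.trans hu.1
  have h2 : volume.restrict (Ioo c d) ≪ mulMeasure.restrict (Ioo c d) := by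
    rw [mulMeasure_restrict measurableSet_Ioo hI]
    refine withDensity_absolutelyContinuous' measurable_ofReal_inv.aemeasurable ?_
    filter_upwards [ae_restrict_mem measurableSet_Ioo] with u hu
    simpa using hI hu
  have h0 : mulMeasure.restrict (Ioo c d) ≠ 0 := by
    intro h
    rw [h, Measure.absolutelyContinuous_zero_iff, Measure.restrict_eq_zero, Real.volume_Ioo] at h2
    simp only [ENNReal.ofReal_eq_zero] at h2
    linarith
  intro h
  rw [mNorm, eLpNorm_eq_zero_iff (f := fun _ => (1 : ℝ≥0∞)) aestronglyMeasurable_const hq.ne'] at h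
  have := ae_neBot.2 h0
  obtain ⟨u, hu⟩ := h.exists
  exact one_ne_zero hu

theorem mNorm_one_ne_top {q : ℝ≥0∞} (hq : 0 < q) {c d : ℝ} (hc : 0 < c) (hcd : c < d) :
    mNorm q (Ioo c d) (fun _ => 1) ≠ ∞ := by
  have h3 : mulMeasure.restrict (Ioo c d) univ ≠ ∞ := by
    rw [Measure.restrict_apply_univ, ← setLIntegral_one,
      lintegral_mulMeasure_restrict measurableSet_Ioo (fun u hu => hc.trans hu.1)]
    refine ne_top_of_le_ne_top (b := ∫⁻ u in Ioo c d, ENNReal.ofReal c⁻¹) ?_ ?_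
    · rw [setLIntegral_const, Real.volume_Ioo]
      exact ENNReal.mul_ne_top ENNReal.ofReal_ne_top ENNReal.ofReal_ne_top
    · refine setLIntegral_mono measurable_const fun u hu => ?_
      rw [mul_one]
      exact ENNReal.ofReal_le_ofReal (inv_anti₀ hc hu.1.le)
  rw [mNorm, eLpNorm_const (1 : ℝ≥0∞) hq.ne' (fun h => mNorm_one_ne_zero hq hc hcd
    (by rw [mNorm, h, eLpNorm_measure_zero]))]
  rw [enorm_eq_self, one_mul]
  exact (ENNReal.rpow_lt_top_of_nonneg (by positivity) h3).ne

/-- On (c t, d t) the function is at least a fixed multiple of its value at t, so this value is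
dominated by a local norm. The constant depends on A, C, q, c, d only, which keeps later estimates
uniform in f. -/
theorem IsModerate.exists_le_mNorm (A C : ℝ) {q : ℝ≥0∞} (hq : 0 < q) {c d : ℝ} (hc : 0 < c)
    (hcd : c < d) : ∃ D : ℝ≥0, ∀ h : ℝ → ℝ≥0∞, IsModerate A C h → ∀ t : ℝ, 0 < t →
      h t ≤ D * mNorm q (Ioo (c * t) (d * t)) h := by
  set K := max d c⁻¹ with hK
  set E : ℝ≥0∞ := ENNReal.ofReal (C * K ^ A) with hE
  set m := mNorm q (Ioo c d) (fun _ => 1) with hm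
  have hm0 : m ≠ 0 := mNorm_one_ne_zero hq hc hcd
  have hm1 : m ≠ ∞ := mNorm_one_ne_top hq hc hcd
  refine ⟨(m⁻¹ * E).toNNReal, fun h hh t ht => ?_⟩
  rw [ENNReal.coe_toNNReal (ENNReal.mul_ne_top (ENNReal.inv_ne_top.2 hm0) ENNReal.ofReal_ne_top)]
  have hm' : m = mNorm q (Ioo (c * t) (d * t)) (fun _ => 1) := by
    rw [mul_comm c, mul_comm d, mNorm_Ioo_dilation q ht]
  have key : m * h t ≤ E * mNorm q (Ioo (c * t) (d * t)) h := by
    rw [hm', mul_comm]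
    refine (mul_mNorm_le hq _ _ _).trans
      (mNorm_le_const_mul hq measurableSet_Ioo ENNReal.ofReal_ne_top fun u hu => ?_)
    have hu0 : 0 < u := (mul_pos hc ht).trans hu.1
    have hspread : spread u t ≤ K := by
      refine spread_le_of_le hu0 ht (hu.2.le.trans ?_) ?_
      · gcongr; exact le_max_left _ _
      · have : t ≤ c⁻¹ * u := by rw [le_inv_mul_iff₀ hc]; exact hu.1.le
        exact this.trans (by gcongr; exact le_max_right _ _)
    rw [mul_one]
    refine (hh.bound u t hu0 ht).trans ?_
    gcongr
    · exact hh.pos.le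
    · exact (spread_pos _ _).le
    · exact hh.nonneg
  calc h t = m⁻¹ * (m * h t) := by rw [← mul_assoc, ENNReal.inv_mul_cancel hm0 hm1, one_mul]
    _ ≤ m⁻¹ * (E * mNorm q (Ioo (c * t) (d * t)) h) := by gcongr
    _ = _ := by rw [mul_assoc]

/-- Dilation invariance reduces to t = 1, where the integrand is u^(δ-1) on (0, 1) and u^(-δ-1) on
(1, ∞). -/
theorem lintegral_spread_lt_top {δ : ℝ} (hδ : 0 < δ) :
    ∃ D : ℝ≥0, ∀ t, 0 < t → ∫⁻ u, ENNReal.ofReal (spread t u ^ (-δ)) ∂mulMeasure ≤ D := by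
  have h1 : ∫⁻ u, ENNReal.ofReal (spread 1 u ^ (-δ)) ∂mulMeasure < ∞ := by
    rw [← mulMeasure_restrict_Ioi, ← Ioo_union_Ici_eq_Ioi zero_lt_one]
    refine (lintegral_union_le _ _ _).trans_lt (ENNReal.add_lt_top.2 ⟨?_, ?_⟩)
    · rw [lintegral_mulMeasure_restrict measurableSet_Ioo (fun u hu => hu.1)]
      have : IntegrableOn (fun u : ℝ => u ^ (δ - 1)) (Ioo 0 1) volume :=
        (intervalIntegral.integrableOn_Ioo_rpow_iff zero_lt_one).2 (by linarith)
      refine (setLIntegral_congr_fun measurableSet_Ioo fun u hu => ?_).trans_lt this.lintegral_lt_top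
      rw [spread_comm, spread_of_le hu.1 hu.2.le, ← ENNReal.ofReal_mul (inv_pos.2 hu.1).le,
        one_div, Real.inv_rpow hu.1.le, Real.rpow_neg hu.1.le, inv_inv, Real.rpow_sub_one hu.1.ne']
      congr 1; ring
    · rw [lintegral_mulMeasure_restrict measurableSet_Ici 
        (fun u hu => lt_of_lt_of_le (zero_lt_one (α := ℝ)) hu)]
      have : IntegrableOn (fun u : ℝ => u ^ (-δ - 1)) (Ici 1) volume :=
        (integrableOn_Ici_iff_integrableOn_Ioi).2
          (integrableOn_Ioi_rpow_of_lt (by linarith) zero_lt_one)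
      refine (setLIntegral_congr_fun measurableSet_Ici fun u hu => ?_).trans_lt this.lintegral_lt_top
      have hu0 : (0 : ℝ) < u := lt_of_lt_of_le zero_lt_one hu
      rw [spread_of_le one_pos hu, ← ENNReal.ofReal_mul (inv_pos.2 hu0).le, div_one,
        Real.rpow_sub_one hu0.ne']
      congr 1; ring
  refine ⟨(∫⁻ u, ENNReal.ofReal (spread 1 u ^ (-δ)) ∂mulMeasure).toNNReal, fun t ht => ?_⟩
  rw [ENNReal.coe_toNNReal h1.ne]
  conv_lhs => rw [← (measurePreserving_mulMeasure ht).map_eq]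
  rw [(measurableEmbedding_const_mul ht).lintegral_map]
  refine lintegral_mono_ae (ae_mulMeasure_pos.mono fun u hu => ?_)
  have := spread_mul_left ht one_pos hu
  rw [mul_one] at this
  rw [this]

theorem mNorm_spread_le {q : ℝ≥0∞} (hq : 0 < q) {δ : ℝ} (hδ : 0 < δ) :
    ∃ D : ℝ≥0, ∀ t, 0 < t →
      mNorm q (Ioi 0) (fun u => ENNReal.ofReal (spread t u ^ (-δ))) ≤ D := by
  by_cases hq' : q = ∞
  · subst hq'
    refine ⟨1, fun t ht => ?_⟩
    rw [mNorm_top]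
    refine essSup_le_of_ae_le _ (ae_of_all _ fun u => ?_)
    rw [ENNReal.coe_one, ← ENNReal.ofReal_one]
    exact ENNReal.ofReal_le_ofReal (Real.rpow_le_one_of_one_le_of_nonpos (one_le_spread _ _)
      (by linarith))
  · have hp := ENNReal.toReal_pos hq.ne' hq'
    obtain ⟨D, hD⟩ := lintegral_spread_lt_top (δ := δ * q.toReal) (by positivity)
    refine ⟨D ^ (1 / q.toReal), fun t ht => ?_⟩
    rw [mNorm_eq_lintegral hq hq', mulMeasure_restrict_Ioi,
      ENNReal.coe_rpow_of_nonneg _ (by positivity)]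
    refine ENNReal.rpow_le_rpow ((lintegral_congr fun u => ?_).trans_le (hD t ht)) (by positivity)
    rw [ENNReal.ofReal_rpow_of_nonneg (Real.rpow_nonneg (spread_pos _ _).le _) hp.le,
      ← Real.rpow_mul (spread_pos _ _).le, neg_mul]

/-- Half of α pays for the slow variation of σ relative to its value at t. The decay spread^(-α/2)
that is left has a norm bounded uniformly in t. The statement for (t, ∞) is the mirror image. -/
theorem IsSV.mNorm_Ioo_le {σ : ℝ → ℝ} (hσ : IsSV σ) {q : ℝ≥0∞} (hq : 0 < q) {α : ℝ} (hα : 0 < α) :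
    ∃ D : ℝ≥0, ∀ t, 0 < t → mNorm q (Ioo 0 t) (fun u => ENNReal.ofReal (u ^ α * σ u))
      ≤ D * ENNReal.ofReal (t ^ α * σ t) := by
  obtain ⟨C, hC, h⟩ := hσ.bound (α / 2) (by positivity)
  obtain ⟨D, hD⟩ := mNorm_spread_le hq (δ := α / 2) (by positivity)
  refine ⟨D * C.toNNReal, fun t ht => ?_⟩
  have hst := hσ.pos t ht
  refine (mNorm_le_const_mul hq measurableSet_Ioo (c := ENNReal.ofReal (C * (t ^ α * σ t)))
    (G := fun u => ENNReal.ofReal (spread t u ^ (-(α / 2)))) ENNReal.ofReal_ne_top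
    fun u hu => ?_).trans ?_
  · rw [← ENNReal.ofReal_mul (by positivity)]
    apply ENNReal.ofReal_le_ofReal
    have hu0 : 0 < u := hu.1
    have h1 := h t u ht hu0
    have e1 : u ^ α = spread t u ^ (-α) * t ^ α := by
      rw [rpow_eq_div_rpow_mul ht hu0, spread_comm, spread_of_le hu0 hu.2.le,
        Real.rpow_neg (div_pos ht hu0).le, ← Real.inv_rpow (div_pos ht hu0).le, inv_div]
    have hp := spread_pos t u
    have e2 : spread t u ^ (-(α / 2)) = spread t u ^ (-α) * spread t u ^ (α / 2) := by
      rw [← Real.rpow_add hp]; congr 1; ring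
    rw [e1, e2]
    refine (mul_le_mul_of_nonneg_left h1 (by positivity)).trans_eq ?_
    ring
  · rw [ENNReal.ofReal_mul hC.le, ENNReal.coe_mul]
    have := (mNorm_mono_set (q := q) (I := Ioo 0 t) (J := Ioi 0) (fun u hu => hu.1) _).trans (hD t ht)
    calc _ ≤ _ * (D : ℝ≥0∞) := mul_le_mul_right this _
      _ = _ := by rw [ENNReal.ofReal]; ring

theorem IsSV.mNorm_Ioi_le {σ : ℝ → ℝ} (hσ : IsSV σ) {q : ℝ≥0∞} (hq : 0 < q) {α : ℝ} (hα : α < 0) :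
    ∃ D : ℝ≥0, ∀ t, 0 < t → mNorm q (Ioi t) (fun u => ENNReal.ofReal (u ^ α * σ u))
      ≤ D * ENNReal.ofReal (t ^ α * σ t) := by
  obtain ⟨C, hC, h⟩ := hσ.bound (-α / 2) (by linarith)
  obtain ⟨D, hD⟩ := mNorm_spread_le hq (δ := -α / 2) (by linarith)
  refine ⟨D * C.toNNReal, fun t ht => ?_⟩
  have hst := hσ.pos t ht
  refine (mNorm_le_const_mul hq measurableSet_Ioi (c := ENNReal.ofReal (C * (t ^ α * σ t)))
    (G := fun u => ENNReal.ofReal (spread t u ^ (-(-α / 2)))) ENNReal.ofReal_ne_top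
    fun u hu => ?_).trans ?_
  · rw [← ENNReal.ofReal_mul (by positivity)]
    apply ENNReal.ofReal_le_ofReal
    have hu0 : 0 < u := ht.trans hu
    have h1 := h t u ht hu0
    have e1 : u ^ α = spread t u ^ α * t ^ α := by
      rw [rpow_eq_div_rpow_mul ht hu0, spread_of_le ht (le_of_lt hu)]
    have hp := spread_pos t u
    have e2 : spread t u ^ (-(-α / 2)) = spread t u ^ α * spread t u ^ (-α / 2) := by
      rw [← Real.rpow_add hp]; congr 1; ring
    rw [e1, e2]
    refine (mul_le_mul_of_nonneg_left h1 (by positivity)).trans_eq ?_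
    ring
  · rw [ENNReal.ofReal_mul hC.le, ENNReal.coe_mul]
    have := (mNorm_mono_set (q := q) (I := Ioi t) (J := Ioi 0)
      (fun u hu => ht.trans hu) _).trans (hD t ht)
    calc _ ≤ _ * (D : ℝ≥0∞) := mul_le_mul_right this _
      _ = _ := by rw [ENNReal.ofReal]; ring

/-- Schur's test for kernels that are bounded by one. -/
theorem mNorm_kernel_le {r : ℝ≥0∞} (hr : 0 < r) {D : ℝ≥0∞} {κ : ℝ → ℝ → ℝ≥0∞}
    (hκ : AEMeasurable (Function.uncurry κ) (mulMeasure.prod mulMeasure))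
    (hκ' : ∀ v, AEMeasurable (fun t => κ t v) mulMeasure)
    (hκ1 : ∀ t v, κ t v ≤ 1) (hκD : ∀ v, 0 < v → mNorm r (Ioi 0) (fun t => κ t v) ≤ D)
    {h : ℝ → ℝ≥0∞} (hh : AEMeasurable h mulMeasure) :
    mNorm r (Ioi 0) (fun t => mNorm r (Ioi 0) (fun v => κ t v * h v))
      ≤ (1 + D) * mNorm r (Ioi 0) h := by
  -- For r = ∞ the bound κ ≤ 1 suffices, which accounts for the summand 1 in the constant.
  by_cases hr' : r = ∞
  · subst hr'
    refine le_trans ?_ (le_mul_of_one_le_left zero_le le_self_add)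
    rw [mNorm_top]
    refine essSup_le_of_ae_le _ (ae_of_all _ fun t => ?_)
    refine mNorm_mono measurableSet_Ioi fun u _ => ?_
    exact mul_le_of_le_one_left zero_le (hκ1 t u)
  · have hp := ENNReal.toReal_pos hr.ne' hr'
    refine le_trans ?_ (mul_le_mul_left (le_add_self (a := D)) _)
    rw [← ENNReal.rpow_le_rpow_iff hp, mNorm_rpow hr hr', ENNReal.mul_rpow_of_nonneg _ _ hp.le,
      mNorm_rpow hr hr']
    simp_rw [mNorm_rpow hr hr', mulMeasure_restrict_Ioi, ENNReal.mul_rpow_of_nonneg _ _ hp.le]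
    -- Inner and outer norms have the same exponent, so the r-th power is a double integral and
    -- Tonelli applies for every finite r, including r < 1.
    rw [lintegral_lintegral_swap]
    · have hfin : ∀ᵐ v ∂mulMeasure, ∫⁻ t, κ t v ^ r.toReal * h v ^ r.toReal ∂mulMeasure
          ≤ h v ^ r.toReal * D ^ r.toReal := by
        filter_upwards [ae_mulMeasure_pos] with v hv
        rw [lintegral_mul_const'' _ ((hκ' v).pow_const _), mul_comm]
        gcongr
        have := hκD v hv
        rw [← ENNReal.rpow_le_rpow_iff hp, mNorm_rpow hr hr', mulMeasure_restrict_Ioi] at this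
        exact this
      refine (lintegral_mono_ae hfin).trans_eq ?_
      rw [lintegral_mul_const'' _ (hh.pow_const _), mul_comm]
    · exact (hκ.pow_const _).mul ((hh.comp_snd).pow_const _)

/-- A maximal operator with polynomially decaying tails. -/
noncomputable def tailSup (δ : ℝ) (h : ℝ → ℝ≥0∞) (t : ℝ) : ℝ≥0∞ :=
  ⨆ u ∈ Ioi (0 : ℝ), ENNReal.ofReal (spread u t ^ (-δ)) * h u

theorem le_tailSup (δ : ℝ) (h : ℝ → ℝ≥0∞) {u t : ℝ} (hu : 0 < u) :
    h u ≤ ENNReal.ofReal (spread u t ^ δ) * tailSup δ h t := by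
  have hp := spread_pos u t
  have h1 : ENNReal.ofReal (spread u t ^ (-δ)) * h u ≤ tailSup δ h t :=
    le_iSup₂ (f := fun u (_ : u ∈ Ioi (0 : ℝ)) => ENNReal.ofReal (spread u t ^ (-δ)) * h u) u hu
  calc h u = ENNReal.ofReal (spread u t ^ δ) * (ENNReal.ofReal (spread u t ^ (-δ)) * h u) := by
        rw [← mul_assoc, ← ENNReal.ofReal_mul (by positivity), ← Real.rpow_add hp]
        simp
    _ ≤ _ := by gcongr

theorem ofReal_spread_rpow_neg_le_one (s t : ℝ) {δ : ℝ} (hδ : 0 ≤ δ) :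
    ENNReal.ofReal (spread s t ^ (-δ)) ≤ 1 := by
  rw [← ENNReal.ofReal_one]
  exact ENNReal.ofReal_le_ofReal (Real.rpow_le_one_of_one_le_of_nonpos (one_le_spread _ _)
    (by linarith))

theorem spread_rpow_neg_le {s t u v K δ : ℝ} (hδ : 0 ≤ δ)
    (h : spread s t ≤ K * spread u v) : spread u v ^ (-δ) ≤ K ^ δ * spread s t ^ (-δ) := by
  have h1 := spread_pos s t
  have h2 := spread_pos u v
  have hK : 0 < K := by
    by_contra! hK
    nlinarith
  rw [Real.rpow_neg h2.le, Real.rpow_neg h1.le, ← div_eq_mul_inv, le_div_iff₀ (by positivity),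
    inv_mul_le_iff₀ (by positivity), ← Real.mul_rpow h2.le hK.le]
  exact Real.rpow_le_rpow h1.le (by linarith) hδ

theorem spread_le_two {u v : ℝ} (hu : 0 < u) (hv : v ∈ Ioo (1 * u) (2 * u)) : spread u v ≤ 2 := by
  rw [one_mul] at hv
  rw [spread_of_le hu hv.1.le, div_le_iff₀ hu]
  exact hv.2.le

/-- Each h u is dominated by a norm over (u, 2u), on which the factor spread^(-δ) changes by at most
2^δ. The supremum is thus bounded by a norm with kernel spread(v, t)^(-δ), to which Schur's test
applies. All Hardy inequalities below come from this bound. -/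
theorem mNorm_tailSup_le {r : ℝ≥0∞} (hr : 0 < r) {δ : ℝ} (hδ : 0 < δ) (A C : ℝ) :
    ∃ D : ℝ≥0, ∀ h : ℝ → ℝ≥0∞, IsModerate A C h → AEMeasurable h mulMeasure →
      mNorm r (Ioi 0) (tailSup δ h) ≤ D * mNorm r (Ioi 0) h := by
  obtain ⟨D₁, hD₁⟩ := IsModerate.exists_le_mNorm A C hr one_pos one_lt_two
  obtain ⟨D₂, hD₂⟩ := mNorm_spread_le hr hδ
  refine ⟨D₁ * (Real.toNNReal (2 ^ δ)) * (1 + D₂), fun h hh hm => ?_⟩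
  set c : ℝ≥0∞ := D₁ * ENNReal.ofReal (2 ^ δ) with hc
  have hct : c ≠ ∞ := ENNReal.mul_ne_top ENNReal.coe_ne_top ENNReal.ofReal_ne_top
  have key : ∀ t ∈ Ioi (0 : ℝ), tailSup δ h t ≤
      c * mNorm r (Ioi 0) (fun v => ENNReal.ofReal (spread v t ^ (-δ)) * h v) := by
    intro t ht
    refine iSup₂_le fun u hu => ?_
    have hu' : 0 < u := hu
    have hsub : Ioo (1 * u) (2 * u) ⊆ Ioi 0 := fun v hv => by
      rw [one_mul] at hv; exact hu'.trans hv.1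
    refine (mul_le_mul_right (hD₁ h hh u hu) _).trans ?_
    rw [hc, mul_left_comm, mul_assoc]
    refine mul_le_mul_right ?_ _
    rw [← mNorm_const_mul hr _ ENNReal.ofReal_ne_top]
    refine le_trans ?_ (mul_le_mul_right (mNorm_mono_set hsub _) _)
    refine mNorm_le_const_mul hr measurableSet_Ioo ENNReal.ofReal_ne_top fun v hv => ?_
    rw [← mul_assoc, ← ENNReal.ofReal_mul (by positivity)]
    refine mul_le_mul_left (ENNReal.ofReal_le_ofReal (spread_rpow_neg_le hδ.le ?_)) _
    have h1 := spread_triangle v u t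
    rw [spread_comm v u] at h1
    exact h1.trans (mul_le_mul_of_nonneg_right (spread_le_two hu hv) (spread_pos _ _).le)
  refine (mNorm_le_const_mul hr measurableSet_Ioi hct key).trans ?_
  rw [ENNReal.coe_mul, ENNReal.coe_mul, ENNReal.coe_add, ENNReal.coe_one, mul_assoc _ (1 + _)]
  refine mul_le_mul_right (mNorm_kernel_le hr (D := D₂)
    (κ := fun t v => ENNReal.ofReal (spread v t ^ (-δ))) ?_ ?_ ?_ ?_ hm) c
  · exact ((AEMeasurable.spread measurable_snd.aemeasurable
      measurable_fst.aemeasurable).pow_const _).ennreal_ofReal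
  · intro v
    exact ((AEMeasurable.spread aemeasurable_const aemeasurable_id).pow_const _).ennreal_ofReal
  · intro t v; exact ofReal_spread_rpow_neg_le_one _ _ hδ.le
  · intro v hv; exact hD₂ v hv

section ChangeOfVariable

variable {σ : ℝ → ℝ} {κ : ℝ}

/-- The value G (ρ t) is replaced by a norm of G over (ρ t, 2 ρ t), and the indicator of this block
by the kernel spread(v, ρ t)^(-1). No derivative of ρ enters; Schur's test needs only coarse
injectivity and coarse surjectivity of ρ. -/
theorem mNorm_comp_le (hσ : IsSV σ) (hκ : 0 < κ) {ρ : ℝ → ℝ} (hρ : ∀ t, 0 < t → ρ t = t ^ κ * σ t)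
    (hρm : AEMeasurable ρ mulMeasure) {r : ℝ≥0∞} (hr : 0 < r) (A C : ℝ) :
    ∃ D : ℝ≥0, ∀ G : ℝ → ℝ≥0∞, IsModerate A C G → Measurable G →
      mNorm r (Ioi 0) (fun t => G (ρ t)) ≤ D * mNorm r (Ioi 0) G := by
  have hpos : ∀ t, 0 < t → 0 < ρ t := fun t ht => by
    rw [hρ t ht]; exact mul_pos (Real.rpow_pos_of_pos ht _) (hσ.pos t ht)
  obtain ⟨D₁, hD₁⟩ := IsModerate.exists_le_mNorm A C hr one_pos one_lt_two
  obtain ⟨D₂, hD₂⟩ := mNorm_spread_le hr (half_pos hκ)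
  obtain ⟨L, hL, hLu⟩ := hσ.exists_spread_le hκ
  obtain ⟨M, hM, hMs⟩ := hσ.spread_rpow_le hκ
  refine ⟨D₁ * 2 * (1 + (M * L).toNNReal * D₂), fun G hG hm => ?_⟩
  have hct : (D₁ * 2 : ℝ≥0∞) ≠ ∞ := ENNReal.mul_ne_top ENNReal.coe_ne_top (by simp)
  have key : ∀ t ∈ Ioi (0 : ℝ), G (ρ t) ≤
      (D₁ * 2 : ℝ≥0∞) * mNorm r (Ioi 0) (fun v => ENNReal.ofReal (spread v (ρ t) ^ (-1 : ℝ)) * G v) := by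
    intro t ht
    have hu' := hpos t ht
    have hsub : Ioo (1 * ρ t) (2 * ρ t) ⊆ Ioi 0 := fun v hv => by
      rw [one_mul] at hv; exact hu'.trans hv.1
    refine (hD₁ G hG _ hu').trans ?_
    rw [mul_assoc]
    refine mul_le_mul_right ?_ _
    refine le_trans ?_ (mul_le_mul_right (mNorm_mono_set hsub _) _)
    refine mNorm_le_const_mul hr measurableSet_Ioo (by simp) fun v hv => ?_
    rw [← mul_assoc]
    refine le_mul_of_one_le_left zero_le ?_
    have h2 : spread v (ρ t) ≤ 2 := by rw [spread_comm]; exact spread_le_two hu' hv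
    have h3 : (2 : ℝ≥0∞) = ENNReal.ofReal 2 := by simp
    rw [h3, ← ENNReal.ofReal_mul zero_le_two, ← ENNReal.ofReal_one]
    apply ENNReal.ofReal_le_ofReal
    rw [Real.rpow_neg_one, ← div_eq_mul_inv, one_le_div (spread_pos _ _)]
    exact h2
  refine (mNorm_le_const_mul hr measurableSet_Ioi hct key).trans ?_
  rw [ENNReal.coe_mul, ENNReal.coe_mul, ENNReal.coe_add, ENNReal.coe_one, mul_assoc _ (1 + _)]
  refine mul_le_mul_right (mNorm_kernel_le hr (D := ((M * L).toNNReal * D₂ : ℝ≥0))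
    (κ := fun t v => ENNReal.ofReal (spread v (ρ t) ^ (-1 : ℝ))) ?_ ?_ ?_ ?_ hm.aemeasurable) _
  · exact ((AEMeasurable.spread measurable_snd.aemeasurable
      hρm.comp_fst).pow_const _).ennreal_ofReal
  · intro v
    exact ((AEMeasurable.spread aemeasurable_const hρm).pow_const _).ennreal_ofReal
  · intro t v; exact ofReal_spread_rpow_neg_le_one _ _ zero_le_one
  · intro v hv
    -- With ρ t₀ close to v, a large distance from t to t₀ forces ρ t far from v, so the kernel
    -- decays in t like spread(t₀, t)^(-κ/2), uniformly in v.
    obtain ⟨t₀, ht₀, hL₀⟩ := hLu v hv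
    rw [ENNReal.coe_mul]
    refine (mNorm_le_const_mul hr measurableSet_Ioi (c := ENNReal.ofReal (M * L))
      ENNReal.ofReal_ne_top fun t ht => ?_).trans (mul_le_mul_right (hD₂ t₀ ht₀) _)
    rw [← ENNReal.ofReal_mul (by positivity)]
    apply ENNReal.ofReal_le_ofReal
    have h1 := hMs t₀ t ht₀ ht
    rw [← hρ t ht] at h1
    have h2 := spread_triangle (t₀ ^ κ * σ t₀) v (ρ t)
    have hp := spread_pos v (ρ t)
    have hp' := spread_pos t₀ t
    have h3 : spread t₀ t ^ (κ / 2) ≤ M * L * spread v (ρ t) := by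
      refine h1.trans ?_
      rw [mul_assoc]
      gcongr
      exact h2.trans (by gcongr)
    rw [Real.rpow_neg_one, Real.rpow_neg hp'.le, ← div_eq_mul_inv, le_div_iff₀ (by positivity),
      inv_mul_le_iff₀ hp]
    linarith

/-- The value G u is compared with G ∘ ρ on a block (t₀, 2t₀), where ρ t₀ is close to u. Here
Schur's condition concerns the integral in u alone and is immediate. -/
theorem mNorm_le_comp (hσ : IsSV σ) (hκ : 0 < κ) {ρ : ℝ → ℝ} (hρ : ∀ t, 0 < t → ρ t = t ^ κ * σ t)
    (hρm : AEMeasurable ρ mulMeasure) {r : ℝ≥0∞} (hr : 0 < r) (A C : ℝ) :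
    ∃ D : ℝ≥0, ∀ G : ℝ → ℝ≥0∞, IsModerate A C G → Measurable G →
      mNorm r (Ioi 0) G ≤ D * mNorm r (Ioi 0) (fun t => G (ρ t)) := by
  have hpos : ∀ t, 0 < t → 0 < ρ t := fun t ht => by
    rw [hρ t ht]; exact mul_pos (Real.rpow_pos_of_pos ht _) (hσ.pos t ht)
  -- For other parameters no function is moderate. The signs are needed now because the constant is
  -- chosen before G.
  by_cases hAC : 0 ≤ A ∧ 0 < C
  swap
  · exact ⟨0, fun G hG _ => absurd ⟨hG.nonneg, hG.pos⟩ hAC⟩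
  obtain ⟨hA, hC⟩ := hAC
  obtain ⟨D₂, hD₂⟩ := mNorm_spread_le hr (one_pos (α := ℝ))
  obtain ⟨L, hL, hLu⟩ := hσ.exists_spread_le hκ
  obtain ⟨M, hM, hMs⟩ := hσ.spread_le κ
  -- on the dyadic block next to a near-preimage of `u`, `ρ` stays comparable to `u`
  set K : ℝ := L * (M * 2 ^ (|κ| + 1)) with hK
  have hK0 : 0 < K := by positivity
  set m := mNorm r (Ioo 1 2) (fun _ => 1) with hm
  have hm0 : m ≠ 0 := mNorm_one_ne_zero hr one_pos one_lt_two
  have hm1 : m ≠ ∞ := mNorm_one_ne_top hr one_pos one_lt_two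
  set E : ℝ≥0∞ := ENNReal.ofReal (C * K ^ A * K) with hE
  have hct : m⁻¹ * E ≠ ∞ := ENNReal.mul_ne_top (ENNReal.inv_ne_top.2 hm0) ENNReal.ofReal_ne_top
  refine ⟨(m⁻¹ * E).toNNReal * (1 + D₂), fun G hG hGm => ?_⟩
  have key : ∀ u ∈ Ioi (0 : ℝ), G u ≤ (m⁻¹ * E) *
      mNorm r (Ioi 0) (fun t => ENNReal.ofReal (spread u (ρ t) ^ (-1 : ℝ)) * G (ρ t)) := by
    intro u hu
    obtain ⟨t₀, ht₀, hL₀⟩ := hLu u hu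
    have hsub : Ioo (1 * t₀) (2 * t₀) ⊆ Ioi 0 := fun v hv => by
      rw [one_mul] at hv; exact ht₀.trans hv.1
    have hm' : m = mNorm r (Ioo (1 * t₀) (2 * t₀)) (fun _ => 1) := by
      rw [mul_comm 1, mul_comm 2, mNorm_Ioo_dilation r ht₀]
    have key : m * G u ≤ E * mNorm r (Ioo (1 * t₀) (2 * t₀))
        (fun t => ENNReal.ofReal (spread u (ρ t) ^ (-1 : ℝ)) * G (ρ t)) := by
      rw [hm', mul_comm]
      refine (mul_mNorm_le hr _ _ _).trans
        (mNorm_le_const_mul hr measurableSet_Ioo ENNReal.ofReal_ne_top fun t ht => ?_)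
      have ht0 : 0 < t := hsub ht
      have hp := spread_pos (ρ t) u
      have hsp : spread (ρ t) u ≤ K := by
        have h1 := hMs t₀ t ht₀ ht0
        rw [← hρ t ht0] at h1
        have h2 := spread_triangle u (t₀ ^ κ * σ t₀) (ρ t)
        rw [spread_comm u (ρ t), spread_comm u] at h2
        refine h2.trans ?_
        rw [hK]
        have h3 := spread_le_two ht₀ ht
        have h4 := spread_pos t₀ t
        refine mul_le_mul hL₀ (h1.trans ?_) (spread_pos _ _).le hL.le
        gcongr
      rw [mul_one, ← mul_assoc, ← ENNReal.ofReal_mul (by positivity), spread_comm u]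
      refine (hG.bound (ρ t) u (hpos t ht0) hu).trans ?_
      rw [Real.rpow_neg_one]
      refine mul_le_mul_left (ENNReal.ofReal_le_ofReal ?_) _
      rw [← div_eq_mul_inv, le_div_iff₀ hp]
      gcongr
    calc G u = m⁻¹ * (m * G u) := by rw [← mul_assoc, ENNReal.inv_mul_cancel hm0 hm1, one_mul]
      _ ≤ m⁻¹ * (E * mNorm r (Ioi 0)
        (fun t => ENNReal.ofReal (spread u (ρ t) ^ (-1 : ℝ)) * G (ρ t))) := by
          exact mul_le_mul_right (key.trans (mul_le_mul_right (mNorm_mono_set hsub _) _)) _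
      _ = _ := by rw [mul_assoc]
  refine (mNorm_le_const_mul hr measurableSet_Ioi hct key).trans ?_
  rw [ENNReal.coe_mul, ENNReal.coe_toNNReal hct, ENNReal.coe_add, ENNReal.coe_one,
    mul_assoc _ (1 + _)]
  refine mul_le_mul_right ?_ (m⁻¹ * E)
  have hGρ : AEMeasurable (fun t => G (ρ t)) mulMeasure := hGm.comp_aemeasurable hρm
  refine mNorm_kernel_le hr (κ := fun u t => ENNReal.ofReal (spread u (ρ t) ^ (-1 : ℝ)))
    ?_ ?_ ?_ ?_ hGρ
  · exact ((AEMeasurable.spread measurable_fst.aemeasurable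
      hρm.comp_snd).pow_const _).ennreal_ofReal
  · intro v
    exact ((AEMeasurable.spread aemeasurable_id aemeasurable_const).pow_const _).ennreal_ofReal
  · intro t v; exact ofReal_spread_rpow_neg_le_one _ _ zero_le_one
  · intro v hv
    simp_rw [spread_comm _ (ρ v)]
    exact hD₂ _ (hpos v hv)

end ChangeOfVariable

/-! ### Iterated norms over (0, t) and (t, ∞) -/

instance : NullSingletonClass mulMeasure := by
  refine ⟨fun x => mulMeasure_absolutelyContinuous ?_⟩
  exact le_antisymm ((Measure.restrict_apply_le _ _).trans (measure_singleton x).le) zero_le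

theorem mNorm_Ici (q : ℝ≥0∞) (t : ℝ) (F : ℝ → ℝ≥0∞) : mNorm q (Ici t) F = mNorm q (Ioi t) F := by
  rw [mNorm, mNorm, Measure.restrict_congr_set Ioi_ae_eq_Ici]

/-- The iterated norm `‖b(s) ‖F‖_{q,(s,t)}‖_{r,(0,t)}`. -/
noncomputable def leftNorm (r : ℝ≥0∞) (b : ℝ → ℝ) (q : ℝ≥0∞) (F : ℝ → ℝ≥0∞) (t : ℝ) : ℝ≥0∞ :=
  mNorm r (Ioo 0 t) (fun s => ENNReal.ofReal (b s) * mNorm q (Ioo s t) F)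

/-- The iterated norm `‖b(s) ‖F‖_{q,(s,∞)}‖_{r,(t,∞)}`. -/
noncomputable def rightNorm (r : ℝ≥0∞) (b : ℝ → ℝ) (q : ℝ≥0∞) (F : ℝ → ℝ≥0∞) (t : ℝ) : ℝ≥0∞ :=
  mNorm r (Ioi t) (fun s => ENNReal.ofReal (b s) * mNorm q (Ioi s) F)

section Nested

variable {r q : ℝ≥0∞} {b : ℝ → ℝ}

theorem leftNorm_mono_const (hr : 0 < r) (hq : 0 < q) {c : ℝ≥0∞} (hc : c ≠ ∞) {F G : ℝ → ℝ≥0∞}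
    {t : ℝ} (h : ∀ u, 0 < u → u < t → F u ≤ c * G u) :
    leftNorm r b q F t ≤ c * leftNorm r b q G t := by
  refine mNorm_le_const_mul hr measurableSet_Ioo hc fun s hs => ?_
  rw [mul_left_comm]
  exact mul_le_mul_right (mNorm_le_const_mul hq measurableSet_Ioo hc
    fun u hu => h u (hs.1.trans hu.1) hu.2) _

theorem rightNorm_mono_const (hr : 0 < r) (hq : 0 < q) {c : ℝ≥0∞} (hc : c ≠ ∞) {F G : ℝ → ℝ≥0∞}
    {t : ℝ} (h : ∀ u, t < u → F u ≤ c * G u) :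
    rightNorm r b q F t ≤ c * rightNorm r b q G t := by
  refine mNorm_le_const_mul hr measurableSet_Ioi hc fun s hs => ?_
  rw [mul_left_comm]
  exact mul_le_mul_right (mNorm_le_const_mul hq measurableSet_Ioi hc
    fun u hu => h u ((mem_Ioi.1 hs).trans hu)) _

theorem leftNorm_le_rightNorm_zero (F : ℝ → ℝ≥0∞) (t : ℝ) :
    leftNorm r b q F t ≤ rightNorm r b q F 0 :=
  (mNorm_mono measurableSet_Ioo fun _ _ =>
    mul_le_mul_right (mNorm_mono_set Ioo_subset_Ioi_self _) _).trans
    (mNorm_mono_set Ioo_subset_Ioi_self _)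

theorem rightNorm_antitone (F : ℝ → ℝ≥0∞) : Antitone (rightNorm r b q F) :=
  fun _ _ h => mNorm_mono_set (Ioi_subset_Ioi h) _

theorem leftNorm_monotone (F : ℝ → ℝ≥0∞) : Monotone (leftNorm r b q F) :=
  fun _ _ h => (mNorm_mono measurableSet_Ioo fun _ _ =>
    mul_le_mul_right (mNorm_mono_set (Ioo_subset_Ioo_right h) _) _).trans
    (mNorm_mono_set (Ioo_subset_Ioo_right h) _)

theorem measurable_mNorm_Ioi (F : ℝ → ℝ≥0∞) : Measurable (fun s => mNorm q (Ioi s) F) :=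
  Antitone.measurable fun _ _ h => mNorm_mono_set (Ioi_subset_Ioi h) _

theorem measurable_mNorm_Ioo (F : ℝ → ℝ≥0∞) (t : ℝ) : Measurable (fun s => mNorm q (Ioo s t) F) :=
  Antitone.measurable fun _ _ h => mNorm_mono_set (Ioo_subset_Ioo_left h) _

theorem mul_mNorm_le_rightNorm_zero (hr : 0 < r) (F : ℝ → ℝ≥0∞) (t : ℝ) :
    mNorm r (Ioo 0 t) (fun s => ENNReal.ofReal (b s)) * mNorm q (Ioi t) F
      ≤ rightNorm r b q F 0 := by
  rw [mul_comm]
  refine (mul_mNorm_le hr _ _ _).trans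
    ((mNorm_mono measurableSet_Ioo fun s hs => ?_).trans (mNorm_mono_set Ioo_subset_Ioi_self _))
  rw [mul_comm]
  exact mul_le_mul_right (mNorm_mono_set (Ioi_subset_Ioi hs.2.le) _) _

/-- The outer norm is cut at t, and for s < t the inner interval (s, ∞) is cut at t as well. The
piece with s < t and inner interval (t, ∞) decouples into the product in the middle. -/
theorem rightNorm_zero_le (hr : 0 < r) (hq : 0 < q)
    (hb : AEMeasurable (fun s => ENNReal.ofReal (b s)) mulMeasure) :
    ∃ D : ℝ≥0, ∀ (F : ℝ → ℝ≥0∞) (t : ℝ), 0 < t → mNorm r (Ioo 0 t) (fun s => ENNReal.ofReal (b s)) ≠ ∞ →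
      rightNorm r b q F 0 ≤ D * (leftNorm r b q F t +
      (mNorm r (Ioo 0 t) (fun s => ENNReal.ofReal (b s)) * mNorm q (Ioi t) F
        + rightNorm r b q F t)) := by
  obtain ⟨D₁, hD₁⟩ := mNorm_union_le hr
  obtain ⟨D₂, hD₂⟩ := mNorm_union_le hq
  obtain ⟨D₃, hD₃⟩ := mNorm_add_le r
  refine ⟨D₁ * (D₂ * D₃ + 1), fun F t ht hfin => ?_⟩
  have h1 := hD₁ (Ioo 0 t) (Ici t) (fun s => ENNReal.ofReal (b s) * mNorm q (Ioi s) F)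
  rw [Ioo_union_Ici_eq_Ioi ht, mNorm_Ici] at h1
  refine h1.trans ?_
  have h2 : mNorm r (Ioo 0 t) (fun s => ENNReal.ofReal (b s) * mNorm q (Ioi s) F) ≤
      D₂ * (D₃ * (leftNorm r b q F t +
        mNorm r (Ioo 0 t) (fun s => ENNReal.ofReal (b s)) * mNorm q (Ioi t) F)) := by
    refine (mNorm_le_const_mul hr measurableSet_Ioo (c := D₂)
      (G := fun s => ENNReal.ofReal (b s) * mNorm q (Ioo s t) F +
        ENNReal.ofReal (b s) * mNorm q (Ioi t) F) ENNReal.coe_ne_top fun s hs => ?_).trans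
      (mul_le_mul_right ((hD₃ _ _ _ ?_ ?_).trans (mul_le_mul_right (add_le_add le_rfl ?_) _)) _)
    · rw [← mul_add, mul_left_comm]
      refine mul_le_mul_right ?_ _
      rw [← Ioo_union_Ici_eq_Ioi hs.2, ← mNorm_Ici q t]
      exact hD₂ _ _ _
    · exact hb.mul (measurable_mNorm_Ioo F t).aemeasurable
    · exact hb.mul aemeasurable_const
    -- An infinite inner norm cannot be pulled out as a constant. Then either the product is already
    -- ∞, or the weight vanishes almost everywhere on (0, t).
    · by_cases hF : mNorm q (Ioi t) F = ∞
      · by_cases h0 : mNorm r (Ioo 0 t) (fun s => ENNReal.ofReal (b s)) = 0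
        · refine (le_of_eq ?_).trans zero_le
          rw [mNorm, eLpNorm_eq_zero_iff (by
            exact (hb.mul aemeasurable_const).restrict.aestronglyMeasurable) hr.ne']
          rw [mNorm, eLpNorm_eq_zero_iff hb.restrict.aestronglyMeasurable hr.ne'] at h0
          filter_upwards [h0] with s hs
          simp only [Pi.zero_apply] at hs ⊢
          rw [hs, zero_mul]
        · rw [hF, ENNReal.mul_top h0]; exact le_top
      · rw [mNorm_mul_const hr _ hF]
  rw [ENNReal.coe_mul, ENNReal.coe_add, ENNReal.coe_mul, ENNReal.coe_one, mul_assoc]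
  refine mul_le_mul_right ((add_le_add_left h2 _).trans ?_) _
  rw [add_mul, one_mul, mul_assoc]
  refine add_le_add ?_ (le_add_left le_add_self)
  gcongr
  exact le_self_add

theorem leftNorm_add_le (hr : 0 < r)
    (hb : AEMeasurable (fun s => ENNReal.ofReal (b s)) mulMeasure) :
    ∃ D : ℝ≥0, ∀ (F G : ℝ → ℝ≥0∞) (t : ℝ), AEMeasurable F mulMeasure → AEMeasurable G mulMeasure →
      leftNorm r b q (fun u => F u + G u) t ≤ D * (leftNorm r b q F t + leftNorm r b q G t) := by
  obtain ⟨D₂, hD₂⟩ := mNorm_add_le q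
  obtain ⟨D₃, hD₃⟩ := mNorm_add_le r
  refine ⟨D₂ * D₃, fun F G t hF hG => ?_⟩
  rw [ENNReal.coe_mul, mul_assoc]
  refine (mNorm_le_const_mul hr measurableSet_Ioo (c := D₂)
      (G := fun s => ENNReal.ofReal (b s) * mNorm q (Ioo s t) F +
        ENNReal.ofReal (b s) * mNorm q (Ioo s t) G) ENNReal.coe_ne_top fun s hs => ?_).trans
      (mul_le_mul_right (hD₃ _ _ _ ?_ ?_) _)
  · rw [← mul_add, mul_left_comm]
    exact mul_le_mul_right (hD₂ _ _ _ hF hG) _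
  · exact hb.mul (measurable_mNorm_Ioo F t).aemeasurable
  · exact hb.mul (measurable_mNorm_Ioo G t).aemeasurable

theorem rightNorm_add_le (hr : 0 < r)
    (hb : AEMeasurable (fun s => ENNReal.ofReal (b s)) mulMeasure) :
    ∃ D : ℝ≥0, ∀ (F G : ℝ → ℝ≥0∞) (t : ℝ), AEMeasurable F mulMeasure → AEMeasurable G mulMeasure →
      rightNorm r b q (fun u => F u + G u) t ≤ D * (rightNorm r b q F t + rightNorm r b q G t) := by
  obtain ⟨D₂, hD₂⟩ := mNorm_add_le q
  obtain ⟨D₃, hD₃⟩ := mNorm_add_le r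
  refine ⟨D₂ * D₃, fun F G t hF hG => ?_⟩
  rw [ENNReal.coe_mul, mul_assoc]
  refine (mNorm_le_const_mul hr measurableSet_Ioi (c := D₂)
      (G := fun s => ENNReal.ofReal (b s) * mNorm q (Ioi s) F +
        ENNReal.ofReal (b s) * mNorm q (Ioi s) G) ENNReal.coe_ne_top fun s hs => ?_).trans
      (mul_le_mul_right (hD₃ _ _ _ ?_ ?_) _)
  · rw [← mul_add, mul_left_comm]
    exact mul_le_mul_right (hD₂ _ _ _ hF hG) _
  · exact hb.mul (measurable_mNorm_Ioi F).aemeasurable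
  · exact hb.mul (measurable_mNorm_Ioi G).aemeasurable

theorem IsSV.dilation_le (hb : IsSV b) {ε : ℝ} (hε : 0 < ε) :
    ∃ C : ℝ, 0 < C ∧ ∀ s t u : ℝ, 0 < s → 0 < t → 0 < u →
      ENNReal.ofReal (b (t / s * u)) ≤ ENNReal.ofReal (C * spread s t ^ ε) * ENNReal.ofReal (b u) := by
  obtain ⟨C, hC, h⟩ := hb.bound ε hε
  refine ⟨C, hC, fun s t u hs ht hu => ?_⟩
  have hp := spread_pos s t
  rw [← ENNReal.ofReal_mul (by positivity)]
  apply ENNReal.ofReal_le_ofReal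
  refine (h u (t / s * u) hu (by positivity)).trans_eq ?_
  have e : spread u (t / s * u) = spread s t := by
    have h1 := spread_mul_left (c := u / s) (div_pos hu hs) hs ht
    rw [← h1]; congr 1 <;> field_simp
  rw [e]

/-- Comparison with the point 1 spreads finiteness from there to all t > 0, so the function has a
real-valued version. -/
theorem IsSV.of_ennreal {T : ℝ → ℝ≥0∞} (h : ∀ ε : ℝ, 0 < ε → ∃ C : ℝ, 0 < C ∧ ∀ s t, 0 < s → 0 < t →
      T t ≤ ENNReal.ofReal (C * spread s t ^ ε) * T s) (h0 : ∀ t, 0 < t → T t ≠ 0) (h1 : T 1 ≠ ∞) :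
    IsSV (fun t => (T t).toReal) ∧ ∀ t, 0 < t → T t = ENNReal.ofReal (T t).toReal := by
  have hfin : ∀ t, 0 < t → T t ≠ ∞ := by
    intro t ht
    obtain ⟨C, _, h⟩ := h 1 one_pos
    exact ne_top_of_le_ne_top (ENNReal.mul_ne_top ENNReal.ofReal_ne_top h1) (h 1 t one_pos ht)
  refine ⟨⟨fun t ht => ENNReal.toReal_pos (h0 t ht) (hfin t ht), fun ε hε => ?_⟩,
    fun t ht => (ENNReal.ofReal_toReal (hfin t ht)).symm⟩
  obtain ⟨C, hC, h⟩ := h ε hε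
  refine ⟨C, hC, fun s t hs ht => ?_⟩
  have hp := spread_pos s t
  have := ENNReal.toReal_mono (ENNReal.mul_ne_top ENNReal.ofReal_ne_top (hfin s hs)) (h s t hs ht)
  rwa [ENNReal.toReal_mul, ENNReal.toReal_ofReal (by positivity)] at this

/-- Dilation by t/s carries (0, s) onto (0, t), preserves du/u, and changes b by at most C ·
spread^ε. -/
theorem IsSV.mNorm_Ioo_zero_dilation (hb : IsSV b) (hr : 0 < r) {ε : ℝ} (hε : 0 < ε) :
    ∃ C : ℝ, 0 < C ∧ ∀ s t, 0 < s → 0 < t →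
      mNorm r (Ioo 0 t) (fun u => ENNReal.ofReal (b u)) ≤
      ENNReal.ofReal (C * spread s t ^ ε) * mNorm r (Ioo 0 s) (fun u => ENNReal.ofReal (b u)) := by
  obtain ⟨C, hC, h⟩ := hb.dilation_le hε
  refine ⟨C, hC, fun s t hs ht => ?_⟩
  have e := mNorm_Ioo_dilation r (div_pos ht hs) 0 s (fun u => ENNReal.ofReal (b u))
  rw [mul_zero, div_mul_cancel₀ _ hs.ne'] at e
  rw [e]
  exact mNorm_le_const_mul hr measurableSet_Ioo ENNReal.ofReal_ne_top
    fun u hu => h s t u hs ht hu.1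

theorem IsSV.exists_le_mNorm_Ioo (hb : IsSV b) (hr : 0 < r) :
    ∃ D : ℝ≥0, ∀ t, 0 < t → ENNReal.ofReal (b t) ≤
      D * mNorm r (Ioo 0 t) (fun u => ENNReal.ofReal (b u)) := by
  obtain ⟨A, C, hAC⟩ := hb.isModerate 0
  simp only [Real.rpow_zero, one_mul] at hAC
  obtain ⟨D, hD⟩ := IsModerate.exists_le_mNorm A C hr (c := 1 / 2) (d := 1) (by norm_num) (by norm_num)
  refine ⟨D, fun t ht => (hD _ hAC t ht).trans (mul_le_mul_right (mNorm_mono_set ?_ _) _)⟩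
  intro u hu
  exact ⟨(by positivity : (0 : ℝ) < 1 / 2 * t).trans hu.1, by simpa using hu.2⟩

theorem IsSV.mNorm_Ioo_zero (hb : IsSV b) (hr : 0 < r)
    (h1 : mNorm r (Ioo 0 1) (fun u => ENNReal.ofReal (b u)) ≠ ∞) :
    IsSV (fun t => (mNorm r (Ioo 0 t) (fun u => ENNReal.ofReal (b u))).toReal) ∧
      ∀ t, 0 < t → mNorm r (Ioo 0 t) (fun u => ENNReal.ofReal (b u))
        = ENNReal.ofReal (mNorm r (Ioo 0 t) (fun u => ENNReal.ofReal (b u))).toReal := by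
  refine IsSV.of_ennreal (fun ε hε => hb.mNorm_Ioo_zero_dilation hr hε) (fun t ht h0 => ?_) h1
  obtain ⟨D, hD⟩ := hb.exists_le_mNorm_Ioo hr
  have := hD t ht
  rw [h0, mul_zero, nonpos_iff_eq_zero, ENNReal.ofReal_eq_zero] at this
  exact absurd (hb.pos t ht) this.not_gt

/-- For s < t/2 the inner interval (s, t) contains (t/2, t), where F is comparable to F t.
Restricting the outer norm to (0, t/2) costs only a factor, by slow variation. -/
theorem exists_mul_le_leftNorm (hb : IsSV b) (hr : 0 < r) (hq : 0 < q) (A C : ℝ) :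
    ∃ D : ℝ≥0, ∀ F : ℝ → ℝ≥0∞, IsModerate A C F → ∀ t, 0 < t →
      F t * mNorm r (Ioo 0 t) (fun u => ENNReal.ofReal (b u)) ≤ D * leftNorm r b q F t := by
  obtain ⟨D₁, hD₁⟩ := IsModerate.exists_le_mNorm A C hq (c := 1 / 2) (d := 1) (by norm_num) (by norm_num)
  obtain ⟨M, hM, h⟩ := hb.mNorm_Ioo_zero_dilation hr one_pos
  refine ⟨(M * 2 ^ (1 : ℝ)).toNNReal * D₁, fun F hF t ht => ?_⟩
  have ht2 : 0 < t / 2 := half_pos ht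
  have h1 := h (t / 2) t ht2 ht
  have e : spread (t / 2) t = 2 := by
    rw [spread_of_le ht2 (half_le_self ht.le)]; field_simp
  rw [e] at h1
  rw [ENNReal.coe_mul, mul_assoc]
  refine (mul_le_mul_right h1 _).trans ?_
  rw [mul_left_comm]
  refine mul_le_mul_right ((mul_mNorm_le hr _ _ _).trans ?_) _
  refine (mNorm_le_const_mul hr measurableSet_Ioo (c := D₁)
    (G := fun s => ENNReal.ofReal (b s) * mNorm q (Ioo s t) F) ENNReal.coe_ne_top
    fun s hs => ?_).trans (mul_le_mul_right (mNorm_mono_set (Ioo_subset_Ioo_right (by linarith)) _) _)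
  rw [mul_left_comm, mul_comm (F t)]
  refine mul_le_mul_right ((hD₁ F hF t ht).trans (mul_le_mul_right (mNorm_mono_set ?_ _) _)) _
  exact Ioo_subset_Ioo (by linarith [hs.2]) (by linarith)

/-- The dilation by t/s transports both nested intervals at once; ε is shared equally between a and
b. Positivity follows from the lower bound by a(t) times the norm of b over (0, t). -/
theorem leftNorm_isSV {a : ℝ → ℝ} (ha : IsSV a) (hb : IsSV b) (hr : 0 < r) (hq : 0 < q)
    (h1 : leftNorm r b q (fun u => ENNReal.ofReal (a u)) 1 ≠ ∞) :
    IsSV (fun t => (leftNorm r b q (fun u => ENNReal.ofReal (a u)) t).toReal) ∧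
      ∀ t, 0 < t → leftNorm r b q (fun u => ENNReal.ofReal (a u)) t
        = ENNReal.ofReal (leftNorm r b q (fun u => ENNReal.ofReal (a u)) t).toReal := by
  refine IsSV.of_ennreal (fun ε hε => ?_) (fun t ht h0 => ?_) h1
  · obtain ⟨C, hC, h⟩ := hb.dilation_le (half_pos hε)
    obtain ⟨C', hC', h'⟩ := ha.dilation_le (half_pos hε)
    refine ⟨C * C', by positivity, fun s t hs ht => ?_⟩
    have hc := div_pos ht hs
    have e := mNorm_Ioo_dilation r hc 0 s
      (fun v => ENNReal.ofReal (b v) * mNorm q (Ioo v t) (fun u => ENNReal.ofReal (a u)))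
    rw [mul_zero, div_mul_cancel₀ _ hs.ne'] at e
    rw [leftNorm, e]
    have hp := spread_pos s t
    refine mNorm_le_const_mul hr measurableSet_Ioo ENNReal.ofReal_ne_top fun v hv => ?_
    have e' := mNorm_Ioo_dilation q hc v s (fun u => ENNReal.ofReal (a u))
    rw [div_mul_cancel₀ _ hs.ne'] at e'
    rw [e']
    refine (mul_le_mul' (h s t v hs ht hv.1) (mNorm_le_const_mul hq measurableSet_Ioo
      ENNReal.ofReal_ne_top fun u hu => h' s t u hs ht (hv.1.trans hu.1))).trans_eq ?_
    rw [mul_mul_mul_comm, ← ENNReal.ofReal_mul (by positivity)]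
    congr 2
    have e2 : spread s t ^ ε = spread s t ^ (ε / 2) * spread s t ^ (ε / 2) := by
      rw [← Real.rpow_add hp]; congr 1; ring
    rw [e2]; ring
  · obtain ⟨A, C, hAC⟩ := ha.isModerate 0
    simp only [Real.rpow_zero, one_mul] at hAC
    obtain ⟨D, hD⟩ := exists_mul_le_leftNorm hb hr hq A C
    obtain ⟨D', hD'⟩ := hb.exists_le_mNorm_Ioo hr
    have h2 := hD _ hAC t ht
    rw [h0, mul_zero, nonpos_iff_eq_zero, mul_eq_zero] at h2
    rcases h2 with h2 | h2
    · rw [ENNReal.ofReal_eq_zero] at h2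
      exact absurd (ha.pos t ht) h2.not_gt
    · have := hD' t ht
      rw [h2, mul_zero, nonpos_iff_eq_zero, ENNReal.ofReal_eq_zero] at this
      exact absurd (hb.pos t ht) this.not_gt

variable {B τ : ℝ → ℝ} {γ : ℝ}

/-- With a positive exponent the inner norm over (s, t) concentrates at the endpoint t and is
bounded independently of s, so the outer norm contributes just B t. -/
theorem leftNorm_le_of_le_rpow (hr : 0 < r) (hq : 0 < q) (hB : IsSV B)
    (hBb : ∀ t, 0 < t → mNorm r (Ioo 0 t) (fun u => ENNReal.ofReal (b u)) = ENNReal.ofReal (B t))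
    (hτ : IsSV τ) (hγ : 0 < γ) :
    ∃ D : ℝ≥0, ∀ (F : ℝ → ℝ≥0∞) (H : ℝ≥0∞) (t : ℝ), 0 < t →
      (∀ u, 0 < u → u < t → F u ≤ ENNReal.ofReal (u ^ γ * τ u) * H) →
      leftNorm r b q F t ≤ D * (ENNReal.ofReal (t ^ γ * τ t * B t) * H) := by
  obtain ⟨D, hD⟩ := hτ.mNorm_Ioo_le hq hγ
  -- The summand 1 makes the constant nonzero, so that for H = ∞ the right-hand side is ∞.
  refine ⟨D + 1, fun F H t ht h => ?_⟩
  have hτt := hτ.pos t ht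
  have hBt := hB.pos t ht
  by_cases hH : H = ∞
  · rw [hH, ENNReal.mul_top (by simpa using (by positivity : 0 < t ^ γ * τ t * B t)),
      ENNReal.mul_top (by simp)]
    exact le_top
  · have hc : H * (D * ENNReal.ofReal (t ^ γ * τ t)) ≠ ∞ :=
      ENNReal.mul_ne_top hH (ENNReal.mul_ne_top ENNReal.coe_ne_top ENNReal.ofReal_ne_top)
    refine (mNorm_le_const_mul hr measurableSet_Ioo hc (G := fun s => ENNReal.ofReal (b s))
      fun s hs => ?_).trans ?_
    · rw [mul_comm]
      refine mul_le_mul_left ?_ _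
      refine (mNorm_le_const_mul hq measurableSet_Ioo hH
        (G := fun u => ENNReal.ofReal (u ^ γ * τ u)) fun u hu => ?_).trans
        (mul_le_mul_right ((mNorm_mono_set (Ioo_subset_Ioo_left hs.1.le) _).trans (hD t ht)) _)
      rw [mul_comm]
      exact h u (hs.1.trans hu.1) hu.2
    · rw [hBb t ht, ENNReal.ofReal_mul (by positivity : 0 ≤ t ^ γ * τ t)]
      calc _ = (D : ℝ≥0∞) * (ENNReal.ofReal (t ^ γ * τ t) * ENNReal.ofReal (B t) * H) := by ring
        _ ≤ _ := by gcongr; exact_mod_cast le_self_add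

/-- With a negative exponent the inner norm over (s, ∞) concentrates at s and then the outer one at
t. This produces b t, which is bounded by a multiple of B t. -/
theorem rightNorm_le_of_le_rpow (hr : 0 < r) (hq : 0 < q) (hb : IsSV b) (hB : IsSV B)
    (hBb : ∀ t, 0 < t → mNorm r (Ioo 0 t) (fun u => ENNReal.ofReal (b u)) = ENNReal.ofReal (B t))
    (hτ : IsSV τ) (hγ : γ < 0) :
    ∃ D : ℝ≥0, ∀ (F : ℝ → ℝ≥0∞) (H : ℝ≥0∞) (t : ℝ), 0 < t →
      (∀ u, t < u → F u ≤ ENNReal.ofReal (u ^ γ * τ u) * H) →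
      ENNReal.ofReal (B t) * mNorm q (Ioi t) F + rightNorm r b q F t
        ≤ D * (ENNReal.ofReal (t ^ γ * τ t * B t) * H) := by
  obtain ⟨D, hD⟩ := hτ.mNorm_Ioi_le hq hγ
  obtain ⟨D', hD'⟩ := (hτ.mul hb).mNorm_Ioi_le hr hγ
  obtain ⟨E, hE⟩ := hb.exists_le_mNorm_Ioo hr
  refine ⟨D + D * D' * E + 1, fun F H t ht h => ?_⟩
  have hτt := hτ.pos t ht
  have hBt := hB.pos t ht
  by_cases hH : H = ∞
  · rw [hH, ENNReal.mul_top (by simpa using (by positivity : 0 < t ^ γ * τ t * B t)),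
      ENNReal.mul_top (by simp)]
    exact le_top
  · have key : ∀ s, t ≤ s → mNorm q (Ioi s) F ≤ H * (D * ENNReal.ofReal (s ^ γ * τ s)) := by
      intro s hs
      refine (mNorm_le_const_mul hq measurableSet_Ioi hH
        (G := fun u => ENNReal.ofReal (u ^ γ * τ u)) fun u hu => ?_).trans
        (mul_le_mul_right (hD s (ht.trans_le hs)) _)
      rw [mul_comm]
      exact h u (hs.trans_lt hu)
    have h2 : rightNorm r b q F t ≤ (H * D) * (D' * (ENNReal.ofReal (t ^ γ * τ t) *
        (E * ENNReal.ofReal (B t)))) := by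
      refine (mNorm_le_const_mul hr measurableSet_Ioi (ENNReal.mul_ne_top hH ENNReal.coe_ne_top)
        (G := fun s => ENNReal.ofReal (s ^ γ * (τ s * b s))) fun s hs => ?_).trans
        (mul_le_mul_right ((hD' t ht).trans (mul_le_mul_right ?_ _)) _)
      · have hs0 : 0 < s := ht.trans hs
        have hτs := hτ.pos s hs0
        rw [← mul_assoc (s ^ γ), ENNReal.ofReal_mul (by positivity : 0 ≤ s ^ γ * τ s)]
        calc _ ≤ ENNReal.ofReal (b s) * (H * (D * ENNReal.ofReal (s ^ γ * τ s))) := by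
              gcongr; exact key s (le_of_lt hs)
          _ = _ := by ring
      · rw [← mul_assoc (t ^ γ), ENNReal.ofReal_mul (by positivity : 0 ≤ t ^ γ * τ t), ← hBb t ht]
        gcongr
        exact hE t ht
    refine (add_le_add (mul_le_mul_right (key t le_rfl) _) h2).trans ?_
    rw [ENNReal.ofReal_mul (by positivity : 0 ≤ t ^ γ * τ t)]
    simp only [ENNReal.coe_add, ENNReal.coe_mul, ENNReal.coe_one]
    calc _ = ((D : ℝ≥0∞) + D * D' * E) * (ENNReal.ofReal (t ^ γ * τ t) * ENNReal.ofReal (B t) * H) := by ring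
      _ ≤ _ := mul_le_mul_left le_self_add _

end Nested

/-! ### The K-functional and nearly optimal decompositions -/

section KFunctional

variable {E : Type*} [AddCommGroup E] {A₀ A₁ : E → ℝ≥0∞}

theorem peetreK_le {t : ℝ} {f f₀ f₁ : E} (h : f₀ + f₁ = f) :
    peetreK A₀ A₁ t f ≤ A₀ f₀ + ENNReal.ofReal t * A₁ f₁ :=
  iInf₂_le_of_le f₀ f₁ (iInf_le_of_le h le_rfl)

theorem le_peetreK {t : ℝ} {f : E} {x : ℝ≥0∞}
    (h : ∀ f₀ f₁ : E, f₀ + f₁ = f → x ≤ A₀ f₀ + ENNReal.ofReal t * A₁ f₁) :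
    x ≤ peetreK A₀ A₁ t f :=
  le_iInf₂ fun f₀ f₁ => le_iInf (h f₀ f₁)

theorem exists_of_peetreK_lt {t : ℝ} {f : E} {x : ℝ≥0∞} (h : peetreK A₀ A₁ t f < x) :
    ∃ f₀ f₁ : E, f₀ + f₁ = f ∧ A₀ f₀ + ENNReal.ofReal t * A₁ f₁ < x := by
  simp only [peetreK, iInf_lt_iff] at h
  obtain ⟨f₀, f₁, hf, h⟩ := h
  exact ⟨f₀, f₁, hf, h⟩

theorem isQuasiConcave_peetreK (A₀ A₁ : E → ℝ≥0∞) (f : E) :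
    IsQuasiConcave (fun t => peetreK A₀ A₁ t f) := by
  refine ⟨fun s t h => le_peetreK fun f₀ f₁ hf => (peetreK_le hf).trans ?_,
    fun s t hs h => ?_⟩
  · gcongr
  · have ht := hs.trans_le h
    have key : ENNReal.ofReal (s / t) * peetreK A₀ A₁ t f ≤ peetreK A₀ A₁ s f := by
      refine le_peetreK fun f₀ f₁ hf => (mul_le_mul_right (peetreK_le hf) _).trans ?_
      rw [mul_add, ← mul_assoc, ← ENNReal.ofReal_mul (div_pos hs ht).le, div_mul_cancel₀ _ ht.ne']
      gcongr
      refine mul_le_of_le_one_left zero_le ?_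
      rw [← ENNReal.ofReal_one]
      exact ENNReal.ofReal_le_ofReal ((div_le_one ht).2 h)
    refine le_trans (le_of_eq ?_) (mul_le_mul_right key _)
    rw [← mul_assoc, ← ENNReal.ofReal_mul (div_pos ht hs).le]
    have : t / s * (s / t) = 1 := by field_simp
    rw [this, ENNReal.ofReal_one, one_mul]

variable {𝕜 : Type*} [RCLike 𝕜] [Module 𝕜 E] [TopologicalSpace E]

theorem IsQuasiBanachIn.zero (h : IsQuasiBanachIn 𝕜 A₀) : A₀ 0 = 0 := by
  have := h.map_smul 0 0
  simpa using this

theorem IsQuasiBanachIn.neg (h : IsQuasiBanachIn 𝕜 A₀) (x : E) : A₀ (-x) = A₀ x := by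
  have := h.map_smul (-1) x
  simpa using this

theorem peetreK_neg (h₀ : IsQuasiBanachIn 𝕜 A₀) (h₁ : IsQuasiBanachIn 𝕜 A₁) (t : ℝ) (f : E) :
    peetreK A₀ A₁ t (-f) = peetreK A₀ A₁ t f := by
  have key : ∀ f, peetreK A₀ A₁ t (-f) ≤ peetreK A₀ A₁ t f := by
    intro f
    refine le_peetreK fun f₀ f₁ hf => (peetreK_le (f₀ := -f₀) (f₁ := -f₁) ?_).trans_eq ?_
    · rw [← hf, neg_add]
    · rw [h₀.neg, h₁.neg]
  refine le_antisymm (key f) ?_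
  simpa using key (-f)

/-- Both parts of a decomposition of small cost lie in a prescribed neighbourhood of 0, and E is
Hausdorff. This gives decompositions within a factor 2 of the infimum even when the infimum is 0. -/
theorem eq_zero_of_peetreK_eq_zero [IsTopologicalAddGroup E] [T2Space E]
    (h₀ : IsQuasiBanachIn 𝕜 A₀) (h₁ : IsQuasiBanachIn 𝕜 A₁) {t : ℝ} (ht : 0 < t) {f : E}
    (h : peetreK A₀ A₁ t f = 0) : f = 0 := by
  by_contra hf
  obtain ⟨V, hV, hfV⟩ : ∃ V ∈ 𝓝 (0 : E), f ∉ V :=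
    ⟨{f}ᶜ, isOpen_compl_singleton.mem_nhds (by simpa using Ne.symm hf), by simp⟩
  obtain ⟨W, hW, hWV⟩ := exists_nhds_zero_half hV
  obtain ⟨δ₀, hδ₀, hW₀⟩ := h₀.continuous_embedding W hW
  obtain ⟨δ₁, hδ₁, hW₁⟩ := h₁.continuous_embedding W hW
  have ht' : ENNReal.ofReal t ≠ 0 := by simpa using ht
  have hpos : 0 < min δ₀ (ENNReal.ofReal t * δ₁) :=
    lt_min hδ₀ (ENNReal.mul_pos ht' hδ₁.ne')
  obtain ⟨f₀, f₁, rfl, hlt⟩ := exists_of_peetreK_lt (h ▸ hpos : peetreK A₀ A₁ t f < _)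
  refine hfV (hWV _ (hW₀ _ ?_) _ (hW₁ _ ?_))
  · exact (le_self_add.trans_lt hlt).trans_le (min_le_left _ _)
  · exact (ENNReal.mul_lt_mul_iff_right ht' ENNReal.ofReal_ne_top).1
      ((le_add_self.trans_lt hlt).trans_le (min_le_right _ _))

theorem exists_nearly_optimal [IsTopologicalAddGroup E] [T2Space E]
    (h₀ : IsQuasiBanachIn 𝕜 A₀) (h₁ : IsQuasiBanachIn 𝕜 A₁) {t : ℝ} (ht : 0 < t) (f : E) :
    ∃ f₀ f₁ : E, f₀ + f₁ = f ∧ A₀ f₀ + ENNReal.ofReal t * A₁ f₁ ≤ 2 * peetreK A₀ A₁ t f := by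
  rcases eq_or_ne (peetreK A₀ A₁ t f) 0 with h | h
  · refine ⟨0, 0, ?_, ?_⟩
    · rw [eq_zero_of_peetreK_eq_zero h₀ h₁ ht h, add_zero]
    · rw [h₀.zero, h₁.zero]; simp
  · rcases eq_or_ne (peetreK A₀ A₁ t f) ∞ with h' | h'
    · refine ⟨f, 0, add_zero f, ?_⟩
      rw [h', ENNReal.mul_top two_ne_zero]; exact le_top
    · obtain ⟨f₀, f₁, hf, hlt⟩ := exists_of_peetreK_lt (x := 2 * peetreK A₀ A₁ t f)
        (A₀ := A₀) (A₁ := A₁) (t := t) (f := f) (by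
          rw [two_mul]; exact ENNReal.lt_add_right h' h)
      exact ⟨f₀, f₁, hf, hlt.le⟩

theorem exists_peetreK_add_le [IsTopologicalAddGroup E] [T2Space E]
    (h₀ : IsQuasiBanachIn 𝕜 A₀) (h₁ : IsQuasiBanachIn 𝕜 A₁) :
    ∃ D : ℝ≥0, ∀ (f g : E) (t : ℝ), 0 < t →
      peetreK A₀ A₁ t (f + g) ≤ D * (peetreK A₀ A₁ t f + peetreK A₀ A₁ t g) := by
  obtain ⟨C₀, hC₀⟩ := h₀.quasi_triangle
  obtain ⟨C₁, hC₁⟩ := h₁.quasi_triangle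
  refine ⟨(C₀ + C₁) * 2, fun f g t ht => ?_⟩
  obtain ⟨f₀, f₁, hf, hf'⟩ := exists_nearly_optimal h₀ h₁ ht f
  obtain ⟨g₀, g₁, hg, hg'⟩ := exists_nearly_optimal h₀ h₁ ht g
  refine (peetreK_le (f₀ := f₀ + g₀) (f₁ := f₁ + g₁) (by rw [← hf, ← hg]; abel)).trans ?_
  calc A₀ (f₀ + g₀) + ENNReal.ofReal t * A₁ (f₁ + g₁)
      ≤ C₀ * (A₀ f₀ + A₀ g₀) + ENNReal.ofReal t * (C₁ * (A₁ f₁ + A₁ g₁)) := by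
        gcongr
        · exact hC₀ _ _
        · exact hC₁ _ _
    _ ≤ (C₀ + C₁) * (A₀ f₀ + A₀ g₀) + ENNReal.ofReal t * ((C₀ + C₁) * (A₁ f₁ + A₁ g₁)) := by
        gcongr
        · exact le_self_add
        · exact le_add_self
    _ = (C₀ + C₁) * ((A₀ f₀ + ENNReal.ofReal t * A₁ f₁) + (A₀ g₀ + ENNReal.ofReal t * A₁ g₁)) := by
        ring
    _ ≤ (C₀ + C₁) * (2 * peetreK A₀ A₁ t f + 2 * peetreK A₀ A₁ t g) := by gcongr
    _ = _ := by push_cast; ring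

/-- A nearly optimal decomposition at the point `t`, in terms of the `K`-functionals. -/
theorem exists_decomposition [IsTopologicalAddGroup E] [T2Space E]
    (h₀ : IsQuasiBanachIn 𝕜 A₀) (h₁ : IsQuasiBanachIn 𝕜 A₁) :
    ∃ D : ℝ≥0, ∀ (f : E) (t : ℝ), 0 < t → ∃ f₀ f₁ : E, f₀ + f₁ = f ∧
      (∀ u, 0 < u → u < t → peetreK A₀ A₁ u f₀ ≤ D * peetreK A₀ A₁ u f) ∧
      (∀ u, t < u → peetreK A₀ A₁ u f₀ ≤ D * peetreK A₀ A₁ t f) ∧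
      (∀ u, 0 < u → u < t → peetreK A₀ A₁ u f₁ ≤ D * (ENNReal.ofReal (u / t) * peetreK A₀ A₁ t f)) ∧
      (∀ u, t < u → peetreK A₀ A₁ u f₁ ≤ D * peetreK A₀ A₁ u f) := by
  obtain ⟨C, hC⟩ := exists_peetreK_add_le h₀ h₁
  refine ⟨C * 3 + 2, fun f t ht => ?_⟩
  obtain ⟨f₀, f₁, hf, hle⟩ := exists_nearly_optimal h₀ h₁ ht f
  -- The decompositions f₀ + 0 and 0 + f₁ yield the bound that is constant in u and the bound that
  -- is linear in u. The two remaining ranges use f₀ = f - f₁ below t and f₁ = f - f₀ above t, where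
  -- these bounds are at most 2 K(u, f) by quasi-concavity.
  have k₀ : ∀ u, peetreK A₀ A₁ u f₀ ≤ 2 * peetreK A₀ A₁ t f := fun u =>
    (peetreK_le (add_zero f₀)).trans (by
      rw [h₁.zero, mul_zero, add_zero]; exact le_self_add.trans hle)
  have k₁ : ∀ u, 0 < u → peetreK A₀ A₁ u f₁ ≤
      2 * (ENNReal.ofReal (u / t) * peetreK A₀ A₁ t f) := fun u hu =>
    (peetreK_le (zero_add f₁)).trans (by
      rw [h₀.zero, zero_add]
      have e : ENNReal.ofReal u = ENNReal.ofReal (u / t) * ENNReal.ofReal t := by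
        rw [← ENNReal.ofReal_mul (div_pos hu ht).le, div_mul_cancel₀ _ ht.ne']
      rw [e, mul_assoc, mul_left_comm 2]
      exact mul_le_mul_right (le_add_self.trans hle) _)
  have hk := isQuasiConcave_peetreK A₀ A₁ f
  have h2 : (2 : ℝ≥0∞) ≤ ((C * 3 + 2 : ℝ≥0) : ℝ≥0∞) := by push_cast; exact le_add_self
  have h3 : (C * 3 : ℝ≥0∞) ≤ ((C * 3 + 2 : ℝ≥0) : ℝ≥0∞) := by push_cast; exact le_self_add
  refine ⟨f₀, f₁, hf, fun u hu hut => ?_, fun u _ => (k₀ u).trans (mul_le_mul_left h2 _),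
    fun u hu _ => (k₁ u hu).trans (mul_le_mul_left h2 _), fun u htu => ?_⟩
  · have h := hC f (-f₁) u hu
    rw [peetreK_neg h₀ h₁, ← hf, add_neg_cancel_right, hf] at h
    refine (h.trans (mul_le_mul_right (add_le_add_right (k₁ u hu) _) _)).trans ?_
    refine le_trans ?_ (mul_le_mul_left h3 _)
    rw [mul_assoc]
    refine mul_le_mul_right ?_ _
    have h4 : ENNReal.ofReal (u / t) * peetreK A₀ A₁ t f ≤ peetreK A₀ A₁ u f := by
      refine (mul_le_mul_right (hk.mul_le u t hu hut.le) _).trans_eq ?_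
      rw [← mul_assoc, ← ENNReal.ofReal_mul (div_pos hu ht).le]
      have : u / t * (t / u) = 1 := by field_simp
      rw [this, ENNReal.ofReal_one, one_mul]
    calc _ ≤ peetreK A₀ A₁ u f + 2 * peetreK A₀ A₁ u f := by gcongr
      _ = _ := by ring
  · have hu := ht.trans htu
    have h := hC f (-f₀) u hu
    have e : f + -f₀ = f₁ := by rw [← hf]; abel
    rw [peetreK_neg h₀ h₁, e] at h
    refine (h.trans (mul_le_mul_right (add_le_add_right (k₀ u) _) _)).trans ?_
    refine le_trans ?_ (mul_le_mul_left h3 _)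
    rw [mul_assoc]
    refine mul_le_mul_right ?_ _
    calc _ ≤ peetreK A₀ A₁ u f + 2 * peetreK A₀ A₁ u f := by gcongr; exact hk.mono htu.le
      _ = _ := by ring

end KFunctional

/-! ### Holmstedt's formula in terms of quasi-concave functions -/

/-- A function multiplied by the weight `u ^ α * a u`. -/
noncomputable def weighted (α : ℝ) (a : ℝ → ℝ) (k : ℝ → ℝ≥0∞) : ℝ → ℝ≥0∞ :=
  fun u => ENNReal.ofReal (u ^ α * a u) * k u

theorem aemeasurable_weighted {α : ℝ} {a : ℝ → ℝ} (ha : AEMeasurable a mulMeasure) {k : ℝ → ℝ≥0∞}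
    (hk : AEMeasurable k mulMeasure) : AEMeasurable (weighted α a k) mulMeasure := by
  unfold weighted; fun_prop

theorem IsQuasiConcave.aemeasurable {k : ℝ → ℝ≥0∞} (hk : IsQuasiConcave k) :
    AEMeasurable k mulMeasure := hk.mono.measurable.aemeasurable

/-- The two terms over `(t, ∞)` in Holmstedt's formula for a couple of limiting spaces. -/
noncomputable def tailNorm (r : ℝ≥0∞) (b : ℝ → ℝ) (q : ℝ≥0∞) (B : ℝ → ℝ) (F : ℝ → ℝ≥0∞) (t : ℝ) :
    ℝ≥0∞ :=
  ENNReal.ofReal (B t) * mNorm q (Ioi t) F + rightNorm r b q F t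

theorem tailNorm_mono_const {r q : ℝ≥0∞} {b B : ℝ → ℝ} (hr : 0 < r) (hq : 0 < q) {c : ℝ≥0∞}
    (hc : c ≠ ∞) {F G : ℝ → ℝ≥0∞} {t : ℝ} (h : ∀ u, t < u → F u ≤ c * G u) :
    tailNorm r b q B F t ≤ c * tailNorm r b q B G t := by
  rw [tailNorm, tailNorm, mul_add, mul_left_comm]
  exact add_le_add (mul_le_mul_right (mNorm_le_const_mul hq measurableSet_Ioi hc fun u hu => h u hu) _)
    (rightNorm_mono_const hr hq hc h)

/-- The parameters of a couple of limiting spaces, with the slowly varying functions `B₀`, `B₁`, `X`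
that are attached to them. -/
structure LimitingCouple (θ₀ : ℝ) (r₀ q₀ r₁ q₁ : ℝ≥0∞) (a₀ b₀ a₁ b₁ B₀ B₁ X : ℝ → ℝ) : Prop where
  θ_pos : 0 < θ₀
  θ_lt : θ₀ < 1
  r₀_pos : 0 < r₀
  q₀_pos : 0 < q₀
  r₁_pos : 0 < r₁
  q₁_pos : 0 < q₁
  sv_a₀ : IsSV a₀
  sv_b₀ : IsSV b₀
  sv_a₁ : IsSV a₁
  sv_b₁ : IsSV b₁
  ma₀ : AEMeasurable a₀ mulMeasure
  mb₀ : AEMeasurable b₀ mulMeasure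
  ma₁ : AEMeasurable a₁ mulMeasure
  mb₁ : AEMeasurable b₁ mulMeasure
  sv_B₀ : IsSV B₀
  sv_B₁ : IsSV B₁
  sv_X : IsSV X
  eq_B₀ : ∀ t, 0 < t → mNorm r₀ (Ioo 0 t) (fun u => ENNReal.ofReal (b₀ u)) = ENNReal.ofReal (B₀ t)
  eq_B₁ : ∀ t, 0 < t → mNorm r₁ (Ioo 0 t) (fun u => ENNReal.ofReal (b₁ u)) = ENNReal.ofReal (B₁ t)
  eq_X : ∀ t, 0 < t → leftNorm r₁ b₁ q₁ (fun u => ENNReal.ofReal (a₁ u)) t = ENNReal.ofReal (X t)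

theorem le_ofReal_div_mul {x y : ℝ} (hx : 0 < x) {z w : ℝ≥0∞}
    (h : ENNReal.ofReal x * z ≤ ENNReal.ofReal y * w) : z ≤ ENNReal.ofReal (y / x) * w := by
  have h1 := mul_le_mul_right h (ENNReal.ofReal (1 / x))
  rw [← mul_assoc, ← mul_assoc, ← ENNReal.ofReal_mul (by positivity),
    ← ENNReal.ofReal_mul (by positivity), one_div_mul_cancel hx.ne', ENNReal.ofReal_one, one_mul,
    one_div_mul_eq_div] at h1
  exact h1

namespace LimitingCouple

variable {θ₀ : ℝ} {r₀ q₀ r₁ q₁ : ℝ≥0∞} {a₀ b₀ a₁ b₁ B₀ B₁ X : ℝ → ℝ}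

theorem mofb₀ (H : LimitingCouple θ₀ r₀ q₀ r₁ q₁ a₀ b₀ a₁ b₁ B₀ B₁ X) :
    AEMeasurable (fun u => ENNReal.ofReal (b₀ u)) mulMeasure := H.mb₀.ennreal_ofReal

theorem mofb₁ (H : LimitingCouple θ₀ r₀ q₀ r₁ q₁ a₀ b₀ a₁ b₁ B₀ B₁ X) :
    AEMeasurable (fun u => ENNReal.ofReal (b₁ u)) mulMeasure := H.mb₁.ennreal_ofReal

/-- This leading term is the pivot of the argument: Holmstedt's formula reduces its cross terms to
it, and in the theorem the other terms are compared with it. -/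
theorem leading_le_leftNorm (H : LimitingCouple θ₀ r₀ q₀ r₁ q₁ a₀ b₀ a₁ b₁ B₀ B₁ X) :
    ∃ D : ℝ≥0, ∀ k, IsQuasiConcave k → ∀ t, 0 < t →
      ENNReal.ofReal (t ^ (-θ₀) * (a₀ t * B₀ t)) * k t ≤
        D * leftNorm r₀ b₀ q₀ (weighted (-θ₀) a₀ k) t := by
  obtain ⟨A, C, hAC⟩ := H.sv_a₀.isModerate_mul (-θ₀)
  obtain ⟨D, hD⟩ := exists_mul_le_leftNorm H.sv_b₀ H.r₀_pos H.q₀_pos A C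
  refine ⟨D, fun k hk t ht => (le_of_eq ?_).trans (hD _ (hAC k hk) t ht)⟩
  have := H.sv_a₀.pos t ht
  rw [H.eq_B₀ t ht, ← mul_assoc (t ^ _), ENNReal.ofReal_mul (by positivity), mul_right_comm]

/-- Since k u / u ≥ k t / t for u < t, the restriction of the norm to (0, t) is at least X t · k t /
t. -/
theorem le_rightNorm₁ (H : LimitingCouple θ₀ r₀ q₀ r₁ q₁ a₀ b₀ a₁ b₁ B₀ B₁ X) {k : ℝ → ℝ≥0∞}
    (hk : IsQuasiConcave k) {t : ℝ} (ht : 0 < t) :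
    k t ≤ ENNReal.ofReal (t / X t) * rightNorm r₁ b₁ q₁ (weighted (-1) a₁ k) 0 := by
  refine le_ofReal_div_mul (H.sv_X.pos t ht) ?_
  have h : ENNReal.ofReal (1 / t) * (ENNReal.ofReal (X t) * k t) ≤
      rightNorm r₁ b₁ q₁ (weighted (-1) a₁ k) 0 := by
    rw [← H.eq_X t ht, mul_left_comm, mul_comm]
    refine le_trans ?_ (leftNorm_le_rightNorm_zero _ t)
    refine le_mNorm_of_mul_le H.r₁_pos measurableSet_Ioo fun s hs => ?_
    rw [mul_left_comm]
    refine mul_le_mul_right (le_mNorm_of_mul_le H.q₁_pos measurableSet_Ioo fun u hu => ?_) _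
    have hu0 : 0 < u := hs.1.trans hu.1
    have h1 : k t ≤ ENNReal.ofReal (t / u) * k u := hk.mul_le u t hu0 hu.2.le
    have e : ENNReal.ofReal (1 / t) * ENNReal.ofReal (t / u) = ENNReal.ofReal u⁻¹ := by
      rw [← ENNReal.ofReal_mul (by positivity)]
      congr 1; field_simp
    rw [weighted, Real.rpow_neg_one, ENNReal.ofReal_mul (by positivity), ← e]
    calc _ ≤ ENNReal.ofReal (1 / t) * (ENNReal.ofReal (t / u) * k u) * ENNReal.ofReal (a₁ u) := by
          gcongr
      _ = _ := by ring
  refine le_trans (le_of_eq ?_) (mul_le_mul_right h _)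
  rw [← mul_assoc, ← ENNReal.ofReal_mul ht.le, mul_one_div_cancel ht.ne', ENNReal.ofReal_one,
    one_mul]

theorem le_rightNorm₀ (H : LimitingCouple θ₀ r₀ q₀ r₁ q₁ a₀ b₀ a₁ b₁ B₀ B₁ X) :
    ∃ D : ℝ≥0, ∀ k, IsQuasiConcave k → ∀ t, 0 < t →
      k t ≤ D * (ENNReal.ofReal (t ^ θ₀ / (a₀ t * B₀ t)) *
        rightNorm r₀ b₀ q₀ (weighted (-θ₀) a₀ k) 0) := by
  obtain ⟨D, hD⟩ := H.leading_le_leftNorm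
  refine ⟨D, fun k hk t ht => ?_⟩
  have h1 := H.sv_a₀.pos t ht
  have h2 := H.sv_B₀.pos t ht
  have h := (hD k hk t ht).trans (mul_le_mul_right (leftNorm_le_rightNorm_zero _ t) _)
  rw [← one_mul (D * _ : ℝ≥0∞), ← ENNReal.ofReal_one] at h
  refine (le_ofReal_div_mul (by positivity) h).trans_eq ?_
  rw [mul_left_comm]
  congr 3
  rw [Real.rpow_neg ht.le]
  field_simp

/-- Inserting k u ≤ (u / X u) N₁ leaves the weight u^(1-θ₀) a₀/X, whose exponent is positive, so the
truncated norm concentrates at t. -/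
theorem leftNorm_le_rightNorm₁ (H : LimitingCouple θ₀ r₀ q₀ r₁ q₁ a₀ b₀ a₁ b₁ B₀ B₁ X) :
    ∃ D : ℝ≥0, ∀ k, IsQuasiConcave k → ∀ t, 0 < t →
      leftNorm r₀ b₀ q₀ (weighted (-θ₀) a₀ k) t ≤
        D * (ENNReal.ofReal (t ^ (1 - θ₀) * (a₀ t * B₀ t / X t)) *
          rightNorm r₁ b₁ q₁ (weighted (-1) a₁ k) 0) := by
  have h1 := H.θ_lt
  obtain ⟨D, hD⟩ := leftNorm_le_of_le_rpow H.r₀_pos H.q₀_pos H.sv_B₀ H.eq_B₀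
    (H.sv_a₀.mul H.sv_X.inv) (γ := 1 - θ₀) (by linarith)
  refine ⟨D, fun k hk t ht => (hD _ (rightNorm r₁ b₁ q₁ (weighted (-1) a₁ k) 0) t ht
    fun u hu _ => ?_).trans_eq ?_⟩
  · refine (mul_le_mul_right (H.le_rightNorm₁ hk hu) _).trans_eq ?_
    have h2 := H.sv_a₀.pos u hu
    have h3 := H.sv_X.pos u hu
    rw [← mul_assoc, ← ENNReal.ofReal_mul (by positivity)]
    congr 2
    rw [sub_eq_add_neg, Real.rpow_add hu, Real.rpow_one]
    field_simp
  · congr 3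
    field_simp

/-- Inserting k u ≲ u^θ₀/(a₀ B₀) N₀ leaves an exponent θ₀ - 1 < 0, so the tail concentrates at t.
After multiplication by ρ t only a₁ B₁ / X remains, which is bounded. -/
theorem tailNorm_le_rightNorm₀ (H : LimitingCouple θ₀ r₀ q₀ r₁ q₁ a₀ b₀ a₁ b₁ B₀ B₁ X) :
    ∃ D : ℝ≥0, ∀ k, IsQuasiConcave k → ∀ t, 0 < t →
      ENNReal.ofReal (t ^ (1 - θ₀) * (a₀ t * B₀ t / X t)) *
        tailNorm r₁ b₁ q₁ B₁ (weighted (-1) a₁ k) t ≤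
        D * rightNorm r₀ b₀ q₀ (weighted (-θ₀) a₀ k) 0 := by
  have h1 := H.θ_lt
  obtain ⟨D₁, hD₁⟩ := H.le_rightNorm₀
  obtain ⟨D, hD⟩ := rightNorm_le_of_le_rpow H.r₁_pos H.q₁_pos H.sv_b₁ H.sv_B₁ H.eq_B₁
    (H.sv_a₁.mul (H.sv_a₀.mul H.sv_B₀).inv) (γ := θ₀ - 1) (by linarith)
  obtain ⟨A, C, hAC⟩ := H.sv_a₁.isModerate 0
  simp only [Real.rpow_zero, one_mul] at hAC
  obtain ⟨D₂, hD₂⟩ := exists_mul_le_leftNorm H.sv_b₁ H.r₁_pos H.q₁_pos A C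
  refine ⟨D * D₁ * D₂, fun k hk t ht => ?_⟩
  have p1 := H.sv_a₀.pos t ht
  have p2 := H.sv_B₀.pos t ht
  have p3 := H.sv_X.pos t ht
  have p4 := H.sv_a₁.pos t ht
  have p5 := H.sv_B₁.pos t ht
  set R := rightNorm r₀ b₀ q₀ (weighted (-θ₀) a₀ k) 0 with hR
  have h2 : tailNorm r₁ b₁ q₁ B₁ (weighted (-1) a₁ k) t ≤ D * (ENNReal.ofReal
      (t ^ (θ₀ - 1) * (a₁ t * (a₀ t * B₀ t)⁻¹) * B₁ t) * (D₁ * R)) := by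
    refine hD _ _ t ht fun u hu => ?_
    have hu0 := ht.trans hu
    refine (mul_le_mul_right (hD₁ k hk u hu0) _).trans_eq ?_
    have h2 := H.sv_a₀.pos u hu0
    have h3 := H.sv_B₀.pos u hu0
    have h4 := H.sv_a₁.pos u hu0
    rw [mul_left_comm, ← mul_assoc, ← mul_assoc, mul_assoc (D₁ : ℝ≥0∞),
      ← ENNReal.ofReal_mul (by positivity), ← hR, mul_comm (D₁ : ℝ≥0∞), mul_assoc]
    congr 2
    rw [sub_eq_add_neg, Real.rpow_add hu0]
    field_simp
  have h3 : ENNReal.ofReal (a₁ t * B₁ t / X t) ≤ D₂ := by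
    have h4 := hD₂ _ hAC t ht
    rw [H.eq_B₁ t ht, H.eq_X t ht, ← ENNReal.ofReal_mul p4.le, mul_comm (D₂ : ℝ≥0∞)] at h4
    rw [div_eq_inv_mul, ENNReal.ofReal_mul (by positivity)]
    have h5 := mul_le_mul_right h4 (ENNReal.ofReal (X t)⁻¹)
    rwa [← mul_assoc, ← ENNReal.ofReal_mul (by positivity) (p := (X t)⁻¹) (q := X t),
      inv_mul_cancel₀ p3.ne', ENNReal.ofReal_one, one_mul] at h5
  refine (mul_le_mul_right h2 _).trans ?_
  rw [mul_left_comm, ← mul_assoc (ENNReal.ofReal _), ← ENNReal.ofReal_mul (by positivity)]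
  have e : t ^ (1 - θ₀) * (a₀ t * B₀ t / X t) * (t ^ (θ₀ - 1) * (a₁ t * (a₀ t * B₀ t)⁻¹) * B₁ t)
      = a₁ t * B₁ t / X t := by
    have e1 : t ^ (1 - θ₀) * t ^ (θ₀ - 1) = 1 := by
      rw [← Real.rpow_add ht]; simp
    calc _ = (t ^ (1 - θ₀) * t ^ (θ₀ - 1)) * (a₁ t * B₁ t / X t) := by field_simp
      _ = _ := by rw [e1, one_mul]
  rw [e]
  calc _ ≤ (D : ℝ≥0∞) * (D₂ * (D₁ * R)) := by gcongr
    _ = _ := by push_cast; ring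

theorem tailNorm_le_rightNorm₁ (H : LimitingCouple θ₀ r₀ q₀ r₁ q₁ a₀ b₀ a₁ b₁ B₀ B₁ X)
    (F : ℝ → ℝ≥0∞) {t : ℝ} (ht : 0 < t) :
    tailNorm r₁ b₁ q₁ B₁ F t ≤ 2 * rightNorm r₁ b₁ q₁ F 0 := by
  rw [tailNorm, ← H.eq_B₁ t ht, two_mul]
  exact add_le_add (mul_mNorm_le_rightNorm_zero H.r₁_pos F t) (rightNorm_antitone F ht.le)

/-- The lower estimate for the `K`-functional of the couple of limiting spaces at
`ρ t = t ^ (1 - θ₀) * (a₀ t * B₀ t / X t)`, in terms of the `K`-functionals of the summands. -/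
theorem le_left_add_tail (H : LimitingCouple θ₀ r₀ q₀ r₁ q₁ a₀ b₀ a₁ b₁ B₀ B₁ X) :
    ∃ D : ℝ≥0, ∀ k₀ k₁, IsQuasiConcave k₀ → IsQuasiConcave k₁ → ∀ (D' : ℝ≥0) (k : ℝ → ℝ≥0∞),
      (∀ u, 0 < u → k u ≤ D' * (k₀ u + k₁ u)) → ∀ t, 0 < t →
      leftNorm r₀ b₀ q₀ (weighted (-θ₀) a₀ k) t +
        ENNReal.ofReal (t ^ (1 - θ₀) * (a₀ t * B₀ t / X t)) *
          tailNorm r₁ b₁ q₁ B₁ (weighted (-1) a₁ k) t ≤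
      D * D' * (rightNorm r₀ b₀ q₀ (weighted (-θ₀) a₀ k₀) 0 +
        ENNReal.ofReal (t ^ (1 - θ₀) * (a₀ t * B₀ t / X t)) *
          rightNorm r₁ b₁ q₁ (weighted (-1) a₁ k₁) 0) := by
  obtain ⟨E₁, hE₁⟩ := H.leftNorm_le_rightNorm₁
  obtain ⟨E₂, hE₂⟩ := H.tailNorm_le_rightNorm₀
  obtain ⟨E₃, hE₃⟩ := leftNorm_add_le (q := q₀) H.r₀_pos H.mofb₀
  obtain ⟨E₄, hE₄⟩ := rightNorm_add_le (q := q₁) H.r₁_pos H.mofb₁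
  obtain ⟨E₅, hE₅⟩ := mNorm_add_le q₁
  refine ⟨E₃ * (1 + E₁) + (E₄ + E₅) * (E₂ + 2), fun k₀ k₁ hk₀ hk₁ D' k hk t ht => ?_⟩
  set ρ := ENNReal.ofReal (t ^ (1 - θ₀) * (a₀ t * B₀ t / X t)) with hρ
  set N₀ := rightNorm r₀ b₀ q₀ (weighted (-θ₀) a₀ k₀) 0
  set N₁ := rightNorm r₁ b₁ q₁ (weighted (-1) a₁ k₁) 0
  have hle : ∀ (α : ℝ) (a : ℝ → ℝ) (u : ℝ), 0 < u → weighted α a k u ≤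
      D' * (weighted α a k₀ u + weighted α a k₁ u) := by
    intro α a u hu
    rw [weighted, weighted, weighted, ← mul_add, mul_left_comm]
    exact mul_le_mul_right (hk u hu) _
  have m₀ : ∀ {k : ℝ → ℝ≥0∞}, IsQuasiConcave k → AEMeasurable (weighted (-θ₀) a₀ k) mulMeasure :=
    fun hk => aemeasurable_weighted H.ma₀ hk.aemeasurable
  have m₁ : ∀ {k : ℝ → ℝ≥0∞}, IsQuasiConcave k → AEMeasurable (weighted (-1) a₁ k) mulMeasure :=
    fun hk => aemeasurable_weighted H.ma₁ hk.aemeasurable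
  have hL : leftNorm r₀ b₀ q₀ (weighted (-θ₀) a₀ k) t ≤ D' * (E₃ * ((1 + E₁) * (N₀ + ρ * N₁))) := by
    refine (leftNorm_mono_const H.r₀_pos H.q₀_pos (c := D') ENNReal.coe_ne_top
      (fun u hu _ => hle _ _ u hu)).trans (mul_le_mul_right ?_ _)
    refine (hE₃ _ _ t (m₀ hk₀) (m₀ hk₁)).trans (mul_le_mul_right ?_ _)
    refine (add_le_add (leftNorm_le_rightNorm_zero _ t) (hE₁ k₁ hk₁ t ht)).trans ?_
    -- The missing cross terms are added so that the bound factors as a constant times N₀ + ρ N₁.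
    calc N₀ + E₁ * (ρ * N₁) ≤ (N₀ + E₁ * (ρ * N₁)) + (E₁ * N₀ + ρ * N₁) := le_self_add
      _ = _ := by ring
  have hT : ρ * tailNorm r₁ b₁ q₁ B₁ (weighted (-1) a₁ k) t ≤
      D' * ((E₄ + E₅) * ((E₂ + 2) * (N₀ + ρ * N₁))) := by
    refine (mul_le_mul_right (tailNorm_mono_const H.r₁_pos H.q₁_pos (c := D') ENNReal.coe_ne_top
      (fun u hu => hle _ _ u (ht.trans hu))) _).trans ?_
    rw [mul_left_comm]
    refine mul_le_mul_right ?_ _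
    have h1 : tailNorm r₁ b₁ q₁ B₁ (fun u => weighted (-1) a₁ k₀ u + weighted (-1) a₁ k₁ u) t ≤
        (E₄ + E₅) * (tailNorm r₁ b₁ q₁ B₁ (weighted (-1) a₁ k₀) t +
          tailNorm r₁ b₁ q₁ B₁ (weighted (-1) a₁ k₁) t) := by
      refine (add_le_add (mul_le_mul_right (hE₅ _ _ _ (m₁ hk₀) (m₁ hk₁)) _)
        (hE₄ _ _ t (m₁ hk₀) (m₁ hk₁))).trans ?_
      rw [tailNorm, tailNorm]
      generalize ENNReal.ofReal (B₁ t) = x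
      generalize mNorm q₁ (Ioi t) (weighted (-1) a₁ k₀) = y₀
      generalize mNorm q₁ (Ioi t) (weighted (-1) a₁ k₁) = y₁
      generalize rightNorm r₁ b₁ q₁ (weighted (-1) a₁ k₀) t = z₀
      generalize rightNorm r₁ b₁ q₁ (weighted (-1) a₁ k₁) t = z₁
      calc x * (E₅ * (y₀ + y₁)) + E₄ * (z₀ + z₁)
          ≤ (x * (E₅ * (y₀ + y₁)) + E₄ * (z₀ + z₁)) +
            (x * (E₄ * (y₀ + y₁)) + E₅ * (z₀ + z₁)) := le_self_add
        _ = _ := by ring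
    refine (mul_le_mul_right h1 _).trans ?_
    rw [mul_left_comm]
    refine mul_le_mul_right ?_ _
    rw [mul_add]
    refine (add_le_add (hE₂ k₀ hk₀ t ht)
      (mul_le_mul_right (H.tailNorm_le_rightNorm₁ _ ht) _)).trans ?_
    calc E₂ * N₀ + ρ * (2 * N₁) ≤ (E₂ * N₀ + ρ * (2 * N₁)) + (2 * N₀ + E₂ * (ρ * N₁)) := le_self_add
      _ = _ := by ring
  refine (add_le_add hL hT).trans_eq ?_
  push_cast
  ring

/-- The upper estimate for the `K`-functional of the couple of limiting spaces at
`ρ t = t ^ (1 - θ₀) * (a₀ t * B₀ t / X t)`, for a decomposition that is nearly optimal at `t`. -/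
theorem rightNorm_le_left_add_tail (H : LimitingCouple θ₀ r₀ q₀ r₁ q₁ a₀ b₀ a₁ b₁ B₀ B₁ X)
    (D' : ℝ≥0) :
    ∃ D : ℝ≥0, ∀ k k₀ k₁ : ℝ → ℝ≥0∞, IsQuasiConcave k → ∀ t, 0 < t →
      (∀ u, 0 < u → u < t → k₀ u ≤ D' * k u) →
      (∀ u, t < u → k₀ u ≤ D' * k t) →
      (∀ u, 0 < u → u < t → k₁ u ≤ D' * (ENNReal.ofReal (u / t) * k t)) →
      (∀ u, t < u → k₁ u ≤ D' * k u) →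
      rightNorm r₀ b₀ q₀ (weighted (-θ₀) a₀ k₀) 0 +
        ENNReal.ofReal (t ^ (1 - θ₀) * (a₀ t * B₀ t / X t)) *
          rightNorm r₁ b₁ q₁ (weighted (-1) a₁ k₁) 0 ≤
      D * (leftNorm r₀ b₀ q₀ (weighted (-θ₀) a₀ k) t +
        ENNReal.ofReal (t ^ (1 - θ₀) * (a₀ t * B₀ t / X t)) *
          tailNorm r₁ b₁ q₁ B₁ (weighted (-1) a₁ k) t) := by
  obtain ⟨E₀, hE₀⟩ := H.leading_le_leftNorm
  obtain ⟨E₁, hE₁⟩ := rightNorm_zero_le H.r₀_pos H.q₀_pos H.mofb₀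
  obtain ⟨E₂, hE₂⟩ := rightNorm_zero_le H.r₁_pos H.q₁_pos H.mofb₁
  obtain ⟨E₃, hE₃⟩ := rightNorm_le_of_le_rpow H.r₀_pos H.q₀_pos H.sv_b₀ H.sv_B₀ H.eq_B₀
    H.sv_a₀ (γ := -θ₀) (by linarith [H.θ_pos])
  refine ⟨E₁ * D' * (1 + E₃ * E₀) + E₂ * D' * (1 + E₀),
    fun k k₀ k₁ hk t ht h₀ h₀' h₁ h₁' => ?_⟩
  set ρ := ENNReal.ofReal (t ^ (1 - θ₀) * (a₀ t * B₀ t / X t)) with hρ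
  set L := leftNorm r₀ b₀ q₀ (weighted (-θ₀) a₀ k) t
  set T := tailNorm r₁ b₁ q₁ B₁ (weighted (-1) a₁ k) t
  have p1 := H.sv_a₀.pos t ht
  have p2 := H.sv_B₀.pos t ht
  have p3 := H.sv_X.pos t ht
  have hV := hE₀ k hk t ht
  -- Beyond t the function k₀ is at most a multiple of k t, and the negative exponent -θ₀ turns this
  -- into the leading term, hence into L.
  have hN₀ : rightNorm r₀ b₀ q₀ (weighted (-θ₀) a₀ k₀) 0 ≤
      E₁ * (D' * L + E₃ * (D' * (E₀ * L))) := by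
    refine (hE₁ _ t ht (by rw [H.eq_B₀ t ht]; exact ENNReal.ofReal_ne_top)).trans
      (mul_le_mul_right (add_le_add ?_ ?_) _)
    · refine leftNorm_mono_const H.r₀_pos H.q₀_pos ENNReal.coe_ne_top fun u hu hut => ?_
      rw [weighted, weighted, mul_left_comm]
      exact mul_le_mul_right (h₀ u hu hut) _
    · rw [H.eq_B₀ t ht]
      refine (hE₃ _ (D' * k t) t ht fun u hu => mul_le_mul_right (h₀' u hu) _).trans
        (mul_le_mul_right ?_ _)
      rw [mul_left_comm, mul_assoc]
      exact mul_le_mul_right hV _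
  -- Below t the function k₁ is at most a multiple of u k(t)/t, which gives X t · k t / t. The
  -- identity ρ X / t = t^(-θ₀) a₀ B₀ makes this the same leading term.
  have hN₁ : ρ * rightNorm r₁ b₁ q₁ (weighted (-1) a₁ k₁) 0 ≤
      E₂ * (D' * (E₀ * L) + D' * (ρ * T)) := by
    refine (mul_le_mul_right (hE₂ _ t ht (by rw [H.eq_B₁ t ht]; exact ENNReal.ofReal_ne_top)) _).trans ?_
    rw [mul_left_comm, mul_add]
    refine mul_le_mul_right (add_le_add ?_ ?_) _
    -- Only finite constants may be pulled out of the norms. If k t = ∞ then E₀ * L = ∞, and the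
    -- bound is trivial unless D' = 0, in which case k₁ vanishes below t.
    · by_cases hkt : k t = ∞
      · have : (E₀ : ℝ≥0∞) * L = ∞ := by
          rw [hkt, ENNReal.mul_top (by simpa using (by positivity : 0 < t ^ (-θ₀) * (a₀ t * B₀ t))),
            top_le_iff] at hV
          exact hV
        by_cases hD : D' = 0
        · refine (mul_le_mul_right (leftNorm_mono_const (G := fun _ => 0) H.r₁_pos H.q₁_pos
            (c := 0) (by simp) fun u hu hut => ?_) _).trans ?_
          · have := h₁ u hu hut
            rw [hD, ENNReal.coe_zero, zero_mul] at this
            rw [weighted, nonpos_iff_eq_zero.1 this]; simp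
          · simp
        · rw [this, ENNReal.mul_top (by simpa using hD)]; exact le_top
      · have h2 : leftNorm r₁ b₁ q₁ (weighted (-1) a₁ k₁) t ≤
            (D' * (ENNReal.ofReal (1 / t) * k t)) * ENNReal.ofReal (X t) := by
          rw [← H.eq_X t ht]
          refine leftNorm_mono_const H.r₁_pos H.q₁_pos (ENNReal.mul_ne_top ENNReal.coe_ne_top
            (ENNReal.mul_ne_top ENNReal.ofReal_ne_top hkt)) fun u hu hut => ?_
          have p4 := H.sv_a₁.pos u hu
          refine (mul_le_mul_right (h₁ u hu hut) _).trans_eq ?_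
          rw [mul_left_comm, ← mul_assoc (ENNReal.ofReal _), ← ENNReal.ofReal_mul (by positivity)]
          have e : u ^ (-1 : ℝ) * a₁ u * (u / t) = 1 / t * a₁ u := by
            rw [Real.rpow_neg_one]; field_simp
          rw [e, ENNReal.ofReal_mul (by positivity)]
          ring
        refine (mul_le_mul_right h2 _).trans ?_
        refine le_trans (le_of_eq ?_) (mul_le_mul_right hV _)
        have e : t ^ (1 - θ₀) * (a₀ t * B₀ t / X t) * (1 / t) * X t = t ^ (-θ₀) * (a₀ t * B₀ t) := by
          rw [sub_eq_add_neg, Real.rpow_add ht, Real.rpow_one]; field_simp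
        rw [← e, ENNReal.ofReal_mul (by positivity), ENNReal.ofReal_mul (by positivity), ← hρ]
        ring
    · rw [H.eq_B₁ t ht, mul_left_comm (D' : ℝ≥0∞)]
      refine mul_le_mul_right (tailNorm_mono_const H.r₁_pos H.q₁_pos ENNReal.coe_ne_top
        fun u hu => ?_) _
      rw [weighted, weighted, mul_left_comm]
      exact mul_le_mul_right (h₁' u hu) _
  refine (add_le_add hN₀ hN₁).trans ?_
  calc _ = (E₁ * D' * (1 + E₃ * E₀) + E₂ * D' * E₀) * L + E₂ * D' * (ρ * T) := by ring
    _ ≤ ((E₁ * D' * (1 + E₃ * E₀) + E₂ * D' * E₀) * L + E₂ * D' * (ρ * T)) +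
        (E₂ * D' * L + (E₁ * D' * (1 + E₃ * E₀) + E₂ * D' * E₀) * (ρ * T)) := le_self_add
    _ = _ := by push_cast; ring

end LimitingCouple

/-! ### Measurable representatives, change of variable and Hardy inequalities -/

theorem IsSV.of_equiv {a a' : ℝ → ℝ} (ha : IsSV a) {C : ℝ} (hC : 0 < C)
    (h : ∀ t, 0 < t → a t ≤ C * a' t ∧ a' t ≤ C * a t) : IsSV a' := by
  refine ⟨fun t ht => ?_, fun ε hε => ?_⟩
  · exact pos_of_mul_pos_right ((ha.pos t ht).trans_le (h t ht).1) hC.le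
  · obtain ⟨D, hD, hb⟩ := ha.bound ε hε
    refine ⟨C * D * C, by positivity, fun s t hs ht => ?_⟩
    have hp := spread_pos s t
    calc a' t ≤ C * a t := (h t ht).2
      _ ≤ C * (D * spread s t ^ ε * (C * a' s)) := by
        gcongr
        exact (hb s t hs ht).trans (mul_le_mul_of_nonneg_left (h s hs).1 (by positivity))
      _ = _ := by ring

/-- The running supremum of s * a s is monotone, hence Borel, and comparable to t * a t. A Borel
representative is needed because nothing guarantees that a ∘ ρ is measurable. -/
theorem IsSV.exists_measurable {a : ℝ → ℝ} (ha : IsSV a) :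
    ∃ a' : ℝ → ℝ, Measurable a' ∧ IsSV a' ∧
      ∃ C : ℝ, 0 < C ∧ ∀ t, 0 < t → a t ≤ C * a' t ∧ a' t ≤ C * a t := by
  obtain ⟨C, hC, h⟩ := ha.bound 1 one_pos
  set G : ℝ → ℝ≥0∞ := fun t => ⨆ s ∈ Ioc 0 t, ENNReal.ofReal (s * a s) with hG
  have hmono : Monotone G := fun s t hst =>
    iSup₂_le fun u hu => le_iSup₂ (f := fun u (_ : u ∈ Ioc 0 t) => ENNReal.ofReal (u * a u)) u
      ⟨hu.1, hu.2.trans hst⟩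
  have hle : ∀ t, 0 < t → ENNReal.ofReal (t * a t) ≤ G t := fun t ht =>
    le_iSup₂ (f := fun u (_ : u ∈ Ioc 0 t) => ENNReal.ofReal (u * a u)) t ⟨ht, le_rfl⟩
  have hge : ∀ t, 0 < t → G t ≤ ENNReal.ofReal (C * (t * a t)) := by
    refine fun t ht => iSup₂_le fun u hu => ENNReal.ofReal_le_ofReal ?_
    have h1 := h t u ht hu.1
    rw [spread_comm, spread_of_le hu.1 hu.2, Real.rpow_one] at h1
    have hu0 := hu.1
    calc u * a u ≤ u * (C * (t / u) * a t) := by gcongr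
      _ = _ := by field_simp
  have hfin : ∀ t, 0 < t → G t ≠ ∞ := fun t ht => ne_top_of_le_ne_top ENNReal.ofReal_ne_top (hge t ht)
  have key : ∀ t, 0 < t → a t ≤ (C + 1) * (t⁻¹ * (G t).toReal) ∧ t⁻¹ * (G t).toReal ≤ (C + 1) * a t := by
    intro t ht
    have hat := ha.pos t ht
    have h1 : t * a t ≤ (G t).toReal := (ENNReal.ofReal_le_iff_le_toReal (hfin t ht)).1 (hle t ht)
    have h2 : (G t).toReal ≤ C * (t * a t) := ENNReal.toReal_le_of_le_ofReal (by positivity) (hge t ht)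
    have h3 : a t ≤ t⁻¹ * (G t).toReal := by rwa [le_inv_mul_iff₀ ht]
    have h4 : t⁻¹ * (G t).toReal ≤ C * a t := by rw [inv_mul_le_iff₀ ht]; linarith
    constructor <;> nlinarith
  exact ⟨fun t => t⁻¹ * (G t).toReal, measurable_inv.mul hmono.measurable.ennreal_toReal,
    ha.of_equiv (by positivity) key, C + 1, by positivity, key⟩

theorem ofReal_mul_le_of_le {x y C : ℝ} (hC : 0 < C) (α t : ℝ) (ht : 0 < t) (h : x ≤ C * y) (z : ℝ≥0∞) :
    ENNReal.ofReal (t ^ α * x) * z ≤ ENNReal.ofReal C * (ENNReal.ofReal (t ^ α * y) * z) := by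
  rw [← mul_assoc, ← ENNReal.ofReal_mul hC.le]
  refine mul_le_mul_left (ENNReal.ofReal_le_ofReal ?_) _
  calc t ^ α * x ≤ t ^ α * (C * y) := by gcongr
    _ = _ := by ring

theorem ofReal_mul_mul_mul {x y z : ℝ} (hx : 0 ≤ x) (hy : 0 ≤ y) (D S : ℝ≥0∞) :
    ENNReal.ofReal x * (D * (ENNReal.ofReal y * (ENNReal.ofReal z * S))) =
      D * (ENNReal.ofReal (x * y * z) * S) := by
  rw [ENNReal.ofReal_mul (mul_nonneg hx hy), ENNReal.ofReal_mul hx]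
  ring

/-- Quasi-additivity of the norm is available for measurable functions only, so the weight is
exchanged for an equivalent measurable one and then restored. -/
theorem mNorm_weighted_add_le {r : ℝ≥0∞} (hr : 0 < r) {w ψ : ℝ → ℝ} (hψ : IsSV ψ) {α : ℝ}
    (hw : ∀ t, 0 < t → w t = t ^ α * ψ t) :
    ∃ D : ℝ≥0, ∀ F G : ℝ → ℝ≥0∞, AEMeasurable F mulMeasure → AEMeasurable G mulMeasure →
      mNorm r (Ioi 0) (fun t => ENNReal.ofReal (w t) * (F t + G t)) ≤
        D * (mNorm r (Ioi 0) (fun t => ENNReal.ofReal (w t) * F t) +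
          mNorm r (Ioi 0) (fun t => ENNReal.ofReal (w t) * G t)) := by
  obtain ⟨ψ', hm, hψ', C, hC, h⟩ := hψ.exists_measurable
  obtain ⟨D, hD⟩ := mNorm_add_le r
  refine ⟨C.toNNReal * D * C.toNNReal, fun F G hF hG => ?_⟩
  have h1 : ∀ F : ℝ → ℝ≥0∞, mNorm r (Ioi 0) (weighted α ψ' F) ≤
      ENNReal.ofReal C * mNorm r (Ioi 0) (fun t => ENNReal.ofReal (w t) * F t) := fun F =>
    mNorm_le_const_mul hr measurableSet_Ioi ENNReal.ofReal_ne_top fun t ht => by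
      rw [hw t ht]; exact ofReal_mul_le_of_le hC α t ht (h t ht).2 _
  have h2 : mNorm r (Ioi 0) (fun t => ENNReal.ofReal (w t) * (F t + G t)) ≤
      ENNReal.ofReal C * mNorm r (Ioi 0) (fun t => weighted α ψ' F t + weighted α ψ' G t) :=
    mNorm_le_const_mul hr measurableSet_Ioi ENNReal.ofReal_ne_top fun t ht => by
      rw [hw t ht, weighted, weighted, ← mul_add]
      exact ofReal_mul_le_of_le hC α t ht (h t ht).1 _
  refine (h2.trans (mul_le_mul_right ((hD _ _ _ (aemeasurable_weighted hm.aemeasurable hF)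
    (aemeasurable_weighted hm.aemeasurable hG)).trans (mul_le_mul_right
      (add_le_add (h1 F) (h1 G)) _)) _)).trans_eq ?_
  rw [ENNReal.coe_mul, ENNReal.coe_mul, ENNReal.ofReal]
  ring

/-- Change of variable `u = ρ t` in the quasi-norm of a standard space, when an expression
equivalent to the `K`-functional at `ρ t` is known. -/
theorem mNorm_weighted_equiv {r : ℝ≥0∞} (hr : 0 < r) {a σ ρ : ℝ → ℝ} (ha : IsSV a) (hσ : IsSV σ)
    {κ : ℝ} (hκ : 0 < κ) (hρ : ∀ t, 0 < t → ρ t = t ^ κ * σ t) (hρm : AEMeasurable ρ mulMeasure)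
    (θ : ℝ) (D : ℝ≥0) :
    ∃ D' : ℝ≥0, ∀ k L T : ℝ → ℝ≥0∞, IsQuasiConcave k → AEMeasurable L mulMeasure →
      AEMeasurable T mulMeasure →
      (∀ t, 0 < t → k (ρ t) ≤ D * (L t + ENNReal.ofReal (ρ t) * T t)) →
      (∀ t, 0 < t → L t + ENNReal.ofReal (ρ t) * T t ≤ D * k (ρ t)) →
      mNorm r (Ioi 0) (weighted (-θ) a k) ≤ D' *
        (mNorm r (Ioi 0) (fun t => ENNReal.ofReal (ρ t ^ (-θ) * a (ρ t)) * L t) +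
          mNorm r (Ioi 0) (fun t => ENNReal.ofReal (ρ t ^ (1 - θ) * a (ρ t)) * T t)) ∧
      mNorm r (Ioi 0) (fun t => ENNReal.ofReal (ρ t ^ (-θ) * a (ρ t)) * L t) ≤
        D' * mNorm r (Ioi 0) (weighted (-θ) a k) ∧
      mNorm r (Ioi 0) (fun t => ENNReal.ofReal (ρ t ^ (1 - θ) * a (ρ t)) * T t) ≤
        D' * mNorm r (Ioi 0) (weighted (-θ) a k) := by
  have hpos : ∀ t, 0 < t → 0 < ρ t := fun t ht => by
    rw [hρ t ht]; exact mul_pos (Real.rpow_pos_of_pos ht _) (hσ.pos t ht)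
  have hcomp : IsSV (fun t => a (ρ t)) := by
    obtain ⟨C, hC, h⟩ := hσ.spread_le κ
    refine ha.comp hpos (A := |κ| + 1) (by positivity) hC fun s t hs ht => ?_
    rw [hρ s hs, hρ t ht]; exact h s t hs ht
  obtain ⟨a', hm, ha', C, hC, h⟩ := ha.exists_measurable
  obtain ⟨A, M, hAM⟩ := ha'.isModerate_mul (-θ)
  obtain ⟨E₁, hE₁⟩ := mNorm_comp_le hσ hκ hρ hρm hr A M
  obtain ⟨E₂, hE₂⟩ := mNorm_le_comp hσ hκ hρ hρm hr A M
  obtain ⟨E₃, hE₃⟩ := mNorm_weighted_add_le hr (w := fun t => ρ t ^ (-θ) * a (ρ t))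
    (ψ := fun t => σ t ^ (-θ) * a (ρ t)) ((hσ.rpow (-θ)).mul hcomp) (α := κ * -θ) (by
      intro t ht
      have := hσ.pos t ht
      rw [hρ t ht, Real.mul_rpow (by positivity) this.le, ← Real.rpow_mul ht.le]
      ring)
  refine ⟨C.toNNReal * E₂ * (C.toNNReal * D) * E₃ + D * C.toNNReal * E₁ * C.toNNReal,
    fun k L T hk hL hT h₁ h₂ => ?_⟩
  set Z := mNorm r (Ioi 0) (weighted (-θ) a k)
  have hmeas : Measurable (weighted (-θ) a' k) := by
    have := hk.mono.measurable
    unfold weighted; fun_prop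
  have eT : ∀ t, 0 < t → ENNReal.ofReal (ρ t ^ (-θ) * a (ρ t)) * (ENNReal.ofReal (ρ t) * T t) =
      ENNReal.ofReal (ρ t ^ (1 - θ) * a (ρ t)) * T t := by
    intro t ht
    have p := hpos t ht
    have p' := ha.pos _ p
    rw [← mul_assoc, ← ENNReal.ofReal_mul (by positivity), sub_eq_add_neg, Real.rpow_add p,
      Real.rpow_one]
    congr 2; ring
  -- Both L and ρ T are bounded by a multiple of k ∘ ρ, so this one estimate yields both reverse
  -- inequalities.
  have back : ∀ G : ℝ → ℝ≥0∞, (∀ t, 0 < t → G t ≤ D * k (ρ t)) →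
      mNorm r (Ioi 0) (fun t => ENNReal.ofReal (ρ t ^ (-θ) * a (ρ t)) * G t) ≤
        D * C.toNNReal * E₁ * C.toNNReal * Z := by
    intro G hG
    have s1 : mNorm r (Ioi 0) (fun t => ENNReal.ofReal (ρ t ^ (-θ) * a (ρ t)) * G t) ≤
        (D * ENNReal.ofReal C) * mNorm r (Ioi 0) (fun t => weighted (-θ) a' k (ρ t)) := by
      refine mNorm_le_const_mul hr measurableSet_Ioi
        (ENNReal.mul_ne_top ENNReal.coe_ne_top ENNReal.ofReal_ne_top) fun t ht => ?_
      refine (mul_le_mul_right (hG t ht) _).trans ?_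
      rw [mul_left_comm, mul_assoc]
      exact mul_le_mul_right (ofReal_mul_le_of_le hC _ _ (hpos t ht) (h _ (hpos t ht)).1 _) _
    have s2 : mNorm r (Ioi 0) (weighted (-θ) a' k) ≤ ENNReal.ofReal C * Z :=
      mNorm_le_const_mul hr measurableSet_Ioi ENNReal.ofReal_ne_top fun t ht =>
        ofReal_mul_le_of_le hC _ _ ht (h _ ht).2 _
    refine (s1.trans (mul_le_mul_right ((hE₁ _ (hAM k hk) hmeas).trans
      (mul_le_mul_right s2 _)) _)).trans_eq ?_
    rw [ENNReal.ofReal]; ring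
  have backle : ∀ x : ℝ≥0∞, x ≤ D * C.toNNReal * E₁ * C.toNNReal * Z →
      x ≤ ((C.toNNReal * E₂ * (C.toNNReal * D) * E₃ + D * C.toNNReal * E₁ * C.toNNReal : ℝ≥0) : ℝ≥0∞) * Z := by
    intro x hx
    refine hx.trans (mul_le_mul_left ?_ _)
    push_cast
    exact le_add_self
  refine ⟨?_, backle _ (back L fun t ht => le_self_add.trans (h₂ t ht)), backle _ ?_⟩
  · have s1 : Z ≤ ENNReal.ofReal C * mNorm r (Ioi 0) (weighted (-θ) a' k) :=
      mNorm_le_const_mul hr measurableSet_Ioi ENNReal.ofReal_ne_top fun t ht =>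
        ofReal_mul_le_of_le hC _ _ ht (h _ ht).1 _
    have s2 : mNorm r (Ioi 0) (fun t => weighted (-θ) a' k (ρ t)) ≤ (ENNReal.ofReal C * D) *
        mNorm r (Ioi 0) (fun t => ENNReal.ofReal (ρ t ^ (-θ) * a (ρ t)) *
          (L t + ENNReal.ofReal (ρ t) * T t)) := by
      refine mNorm_le_const_mul hr measurableSet_Ioi
        (ENNReal.mul_ne_top ENNReal.ofReal_ne_top ENNReal.coe_ne_top) fun t ht => ?_
      refine (ofReal_mul_le_of_le hC _ _ (hpos t ht) (h _ (hpos t ht)).2 _).trans ?_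
      rw [mul_assoc, mul_left_comm (D : ℝ≥0∞)]
      exact mul_le_mul_right (mul_le_mul_right (h₁ t ht) _) _
    have s3 := hE₃ L (fun t => ENNReal.ofReal (ρ t) * T t) hL (hρm.ennreal_ofReal.mul hT)
    rw [mNorm_congr (F := fun t => ENNReal.ofReal (ρ t ^ (-θ) * a (ρ t)) *
      (ENNReal.ofReal (ρ t) * T t)) measurableSet_Ioi eT] at s3
    refine (s1.trans (mul_le_mul_right ((hE₂ _ (hAM k hk) hmeas).trans
      (mul_le_mul_right (s2.trans (mul_le_mul_right s3 _)) _)) _)).trans ?_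
    have hc : ((C.toNNReal * E₂ * (C.toNNReal * D) * E₃ : ℝ≥0) : ℝ≥0∞) ≤
        ((C.toNNReal * E₂ * (C.toNNReal * D) * E₃ + D * C.toNNReal * E₁ * C.toNNReal : ℝ≥0) : ℝ≥0∞) := by
      exact_mod_cast le_self_add
    refine le_trans (le_of_eq ?_) (mul_le_mul_left hc _)
    rw [ENNReal.ofReal]; push_cast; ring
  · rw [← mNorm_congr measurableSet_Ioi eT]
    exact back _ fun t ht => le_add_self.trans (h₂ t ht)

/-- A common form of the Hardy inequalities: functionals of `k` that only see the values of `k`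
close to `t` up to power decay are controlled in norm. -/
theorem mNorm_le_of_tailSup {r : ℝ≥0∞} (hr : 0 < r) {η δ : ℝ} (hδ : 0 < δ)
    {ψ : ℝ → ℝ} (hψ : IsSV ψ) (D : ℝ≥0) :
    ∃ D' : ℝ≥0, ∀ k, IsQuasiConcave k → ∀ N : ℝ → ℝ≥0∞,
      (∀ t S, 0 < t → (∀ u, 0 < u → k u ≤ ENNReal.ofReal (spread u t ^ δ) *
        (ENNReal.ofReal (u ^ η / ψ u) * S)) → N t ≤ D * S) →
      mNorm r (Ioi 0) N ≤ D' * mNorm r (Ioi 0) (weighted (-η) ψ k) := by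
  obtain ⟨ψ', hm, hψ', C, hC, h⟩ := hψ.exists_measurable
  obtain ⟨A, M, hAM⟩ := hψ'.isModerate_mul (-η)
  obtain ⟨E, hE⟩ := mNorm_tailSup_le hr hδ A M
  refine ⟨D * C.toNNReal * E * C.toNNReal, fun k hk N hN => ?_⟩
  have s1 : mNorm r (Ioi 0) N ≤ D * ENNReal.ofReal C * mNorm r (Ioi 0)
      (tailSup δ (weighted (-η) ψ' k)) := by
    refine mNorm_le_const_mul hr measurableSet_Ioi
      (ENNReal.mul_ne_top ENNReal.coe_ne_top ENNReal.ofReal_ne_top) fun t ht => ?_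
    rw [mul_assoc]
    -- S is C times the maximal function of u^(-η) ψ' k at t; the factor C pays for passing from ψ'
    -- to ψ in the bound for k.
    refine hN t _ ht fun u hu => ?_
    have p := hψ.pos u hu
    have p' := hψ'.pos u hu
    have h1 := le_tailSup δ (weighted (-η) ψ' k) (t := t) hu
    rw [weighted] at h1
    have h2 : ENNReal.ofReal (u ^ (-η) * ψ' u) * k u ≤ ENNReal.ofReal 1 *
        (ENNReal.ofReal (spread u t ^ δ) * tailSup δ (weighted (-η) ψ' k) t) := by
      rw [ENNReal.ofReal_one, one_mul]; exact h1
    refine (le_ofReal_div_mul (by positivity) h2).trans ?_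
    rw [mul_left_comm]
    refine mul_le_mul_right ?_ _
    rw [← mul_assoc, ← ENNReal.ofReal_mul (by positivity)]
    refine mul_le_mul_left (ENNReal.ofReal_le_ofReal ?_) _
    rw [Real.rpow_neg hu.le, div_mul_eq_mul_div, div_le_div_iff₀ (by positivity) p]
    have := (h u hu).1
    have hup : 0 < u ^ η := Real.rpow_pos_of_pos hu _
    field_simp
    linarith
  have s2 : mNorm r (Ioi 0) (weighted (-η) ψ' k) ≤
      ENNReal.ofReal C * mNorm r (Ioi 0) (weighted (-η) ψ k) :=
    mNorm_le_const_mul hr measurableSet_Ioi ENNReal.ofReal_ne_top fun t ht =>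
      ofReal_mul_le_of_le hC _ _ ht (h _ ht).2 _
  refine (s1.trans (mul_le_mul_right ((hE _ (hAM k hk) (aemeasurable_weighted hm.aemeasurable
    hk.aemeasurable)).trans (mul_le_mul_right s2 _)) _)).trans_eq ?_
  rw [ENNReal.ofReal]; push_cast; ring

/-! ### The left and tail terms compared with the leading term -/

namespace LimitingCouple

variable {θ₀ : ℝ} {r₀ q₀ r₁ q₁ : ℝ≥0∞} {a₀ b₀ a₁ b₁ B₀ B₁ X : ℝ → ℝ}

theorem mNorm_weighted_le_leftNorm (H : LimitingCouple θ₀ r₀ q₀ r₁ q₁ a₀ b₀ a₁ b₁ B₀ B₁ X)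
    {r : ℝ≥0∞} (hr : 0 < r) {η : ℝ} {ψ w : ℝ → ℝ} (hw0 : ∀ t, 0 < t → 0 < w t)
    (hw : ∀ t, 0 < t → w t * (t ^ (-θ₀) * (a₀ t * B₀ t)) = t ^ (-η) * ψ t) :
    ∃ D : ℝ≥0, ∀ k, IsQuasiConcave k → mNorm r (Ioi 0) (weighted (-η) ψ k) ≤
      D * mNorm r (Ioi 0) (fun t => ENNReal.ofReal (w t) *
        leftNorm r₀ b₀ q₀ (weighted (-θ₀) a₀ k) t) := by
  obtain ⟨D, hD⟩ := H.leading_le_leftNorm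
  refine ⟨D, fun k hk => mNorm_le_const_mul hr measurableSet_Ioi ENNReal.coe_ne_top fun t ht => ?_⟩
  rw [weighted, ← hw t ht, ENNReal.ofReal_mul (hw0 t ht).le, mul_left_comm (D : ℝ≥0∞), mul_assoc]
  exact mul_le_mul_right (hD k hk t ht) _

/-- The test bound on k gives a weight with exponent η - θ₀ - δ on (0, t). It stays positive if δ is
half the gap η - θ₀, so the truncated norm concentrates at t and all factors cancel. -/
theorem leftNorm_le_mNorm_weighted (H : LimitingCouple θ₀ r₀ q₀ r₁ q₁ a₀ b₀ a₁ b₁ B₀ B₁ X)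
    {r : ℝ≥0∞} (hr : 0 < r) {η : ℝ} (hη : θ₀ < η) {ψ w : ℝ → ℝ} (hψ : IsSV ψ)
    (hw0 : ∀ t, 0 < t → 0 < w t)
    (hw : ∀ t, 0 < t → w t * (t ^ (-θ₀) * (a₀ t * B₀ t)) = t ^ (-η) * ψ t) :
    ∃ D : ℝ≥0, ∀ k, IsQuasiConcave k → mNorm r (Ioi 0) (fun t => ENNReal.ofReal (w t) *
        leftNorm r₀ b₀ q₀ (weighted (-θ₀) a₀ k) t) ≤ D * mNorm r (Ioi 0) (weighted (-η) ψ k) := by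
  obtain ⟨δ, hδ, hδη⟩ : ∃ δ : ℝ, 0 < δ ∧ 0 < η - θ₀ - δ := ⟨(η - θ₀) / 2, by linarith, by linarith⟩
  obtain ⟨D, hD⟩ := leftNorm_le_of_le_rpow H.r₀_pos H.q₀_pos H.sv_B₀ H.eq_B₀
    (H.sv_a₀.mul hψ.inv) hδη
  obtain ⟨D', hD'⟩ := mNorm_le_of_tailSup hr (η := η) hδ hψ D
  refine ⟨D', fun k hk => hD' k hk _ fun t S ht hS => ?_⟩
  have h1 := hD (weighted (-θ₀) a₀ k) (ENNReal.ofReal (t ^ δ) * S) t ht fun u hu hut => ?_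
  · refine (mul_le_mul_right h1 _).trans_eq ?_
    have p1 := H.sv_a₀.pos t ht
    have p2 := H.sv_B₀.pos t ht
    have p3 := hψ.pos t ht
    have p4 := hw0 t ht
    rw [ofReal_mul_mul_mul (by positivity) (by positivity)]
    have e : w t * (t ^ (η - θ₀ - δ) * (a₀ t * (ψ t)⁻¹) * B₀ t) * t ^ δ = 1 := by
      have e1 : t ^ (η - θ₀ - δ) * t ^ δ = t ^ η * t ^ (-θ₀) := by
        rw [← Real.rpow_add ht, ← Real.rpow_add ht]; congr 1; ring
      have e2 : t ^ η * t ^ (-η) = 1 := by rw [← Real.rpow_add ht]; simp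
      calc _ = w t * ((t ^ (η - θ₀ - δ) * t ^ δ) * (a₀ t * (ψ t)⁻¹) * B₀ t) := by ring
        _ = t ^ η * (w t * (t ^ (-θ₀) * (a₀ t * B₀ t))) * (ψ t)⁻¹ := by rw [e1]; ring
        _ = (t ^ η * t ^ (-η)) * (ψ t * (ψ t)⁻¹) := by rw [hw t ht]; ring
        _ = 1 := by rw [e2, mul_inv_cancel₀ p3.ne', one_mul]
    rw [e, ENNReal.ofReal_one, one_mul]
  · have p1 := H.sv_a₀.pos u hu
    have p3 := hψ.pos u hu
    have p5 := spread_pos u t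
    refine (mul_le_mul_right (hS u hu) _).trans_eq ?_
    rw [← mul_assoc, ← mul_assoc, ← mul_assoc, ← ENNReal.ofReal_mul (by positivity),
      ← ENNReal.ofReal_mul (by positivity), ← ENNReal.ofReal_mul (by positivity)]
    congr 2
    rw [spread_of_le hu hut.le, Real.div_rpow ht.le hu.le, Real.rpow_sub hu, Real.rpow_sub hu,
      Real.rpow_neg hu.le]
    field_simp

/-- The mirror image on (t, ∞), with exponent η - 1 + δ < 0. The factor a₁ B₁ / X left over is
bounded. -/
theorem tailNorm_le_mNorm_weighted (H : LimitingCouple θ₀ r₀ q₀ r₁ q₁ a₀ b₀ a₁ b₁ B₀ B₁ X)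
    {r : ℝ≥0∞} (hr : 0 < r) {η : ℝ} (hη : η < 1) {ψ w : ℝ → ℝ} (hψ : IsSV ψ)
    (hw0 : ∀ t, 0 < t → 0 < w t)
    (hw : ∀ t, 0 < t → w t * (t ^ (-1 : ℝ) * X t) = t ^ (-η) * ψ t) :
    ∃ D : ℝ≥0, ∀ k, IsQuasiConcave k → mNorm r (Ioi 0) (fun t => ENNReal.ofReal (w t) *
        tailNorm r₁ b₁ q₁ B₁ (weighted (-1) a₁ k) t) ≤
        D * mNorm r (Ioi 0) (weighted (-η) ψ k) := by
  obtain ⟨δ, hδ, hδη⟩ : ∃ δ : ℝ, 0 < δ ∧ η - 1 + δ < 0 := ⟨(1 - η) / 2, by linarith, by linarith⟩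
  obtain ⟨D, hD⟩ := rightNorm_le_of_le_rpow H.r₁_pos H.q₁_pos H.sv_b₁ H.sv_B₁ H.eq_B₁
    (H.sv_a₁.mul hψ.inv) hδη
  obtain ⟨A, C, hAC⟩ := H.sv_a₁.isModerate 0
  simp only [Real.rpow_zero, one_mul] at hAC
  obtain ⟨D₂, hD₂⟩ := exists_mul_le_leftNorm H.sv_b₁ H.r₁_pos H.q₁_pos A C
  obtain ⟨D', hD'⟩ := mNorm_le_of_tailSup hr (η := η) hδ hψ (D * D₂)
  refine ⟨D', fun k hk => hD' k hk _ fun t S ht hS => ?_⟩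
  have h1 := hD (weighted (-1) a₁ k) (ENNReal.ofReal (t ^ (-δ)) * S) t ht fun u hut => ?_
  · refine (mul_le_mul_right h1 _).trans ?_
    have p1 := H.sv_a₁.pos t ht
    have p2 := H.sv_B₁.pos t ht
    have p3 := hψ.pos t ht
    have p4 := hw0 t ht
    have p5 := H.sv_X.pos t ht
    have h2 := hD₂ _ hAC t ht
    rw [H.eq_B₁ t ht, H.eq_X t ht, ← ENNReal.ofReal_mul p1.le] at h2
    rw [ofReal_mul_mul_mul (by positivity) (by positivity)]
    have e : w t * (t ^ (η - 1 + δ) * (a₁ t * (ψ t)⁻¹) * B₁ t) * t ^ (-δ)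
        = (X t)⁻¹ * (a₁ t * B₁ t) := by
      have e1 : t ^ (η - 1 + δ) * t ^ (-δ) = t ^ η * t ^ (-1 : ℝ) := by
        rw [← Real.rpow_add ht, ← Real.rpow_add ht]; congr 1; ring
      have e2 : t ^ η * t ^ (-η) = 1 := by rw [← Real.rpow_add ht]; simp
      calc _ = w t * ((t ^ (η - 1 + δ) * t ^ (-δ)) * (a₁ t * (ψ t)⁻¹) * B₁ t) := by ring
        _ = t ^ η * (w t * (t ^ (-1 : ℝ) * X t)) * (ψ t)⁻¹ * ((X t)⁻¹ * (a₁ t * B₁ t)) := by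
          rw [e1]; field_simp
        _ = (t ^ η * t ^ (-η)) * (ψ t * (ψ t)⁻¹) * ((X t)⁻¹ * (a₁ t * B₁ t)) := by
          rw [hw t ht]; ring
        _ = _ := by rw [e2, mul_inv_cancel₀ p3.ne', one_mul, one_mul]
    rw [e, ENNReal.ofReal_mul (by positivity)]
    refine (mul_le_mul_right (mul_le_mul_left (mul_le_mul_right h2 _) _) _).trans_eq ?_
    rw [mul_left_comm (ENNReal.ofReal _), ← ENNReal.ofReal_mul (by positivity),
      inv_mul_cancel₀ p5.ne', ENNReal.ofReal_one, mul_one, ENNReal.coe_mul, mul_assoc]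
  · have hu : 0 < u := ht.trans hut
    have p1 := H.sv_a₁.pos u hu
    have p3 := hψ.pos u hu
    have p5 := spread_pos u t
    refine (mul_le_mul_right (hS u hu) _).trans_eq ?_
    rw [← mul_assoc, ← mul_assoc, ← mul_assoc, ← ENNReal.ofReal_mul (by positivity),
      ← ENNReal.ofReal_mul (by positivity), ← ENNReal.ofReal_mul (by positivity)]
    congr 2
    rw [spread_comm, spread_of_le ht (le_of_lt hut), Real.div_rpow hu.le ht.le, Real.rpow_add hu,
      Real.rpow_sub hu, Real.rpow_neg ht.le, Real.rpow_one, Real.rpow_neg_one]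
    field_simp

end LimitingCouple

/-! ### The spaces written as iterated norms over du/u -/

section Unfold

variable {E : Type*} [AddCommGroup E] (A₀ A₁ : E → ℝ≥0∞) (f : E)

theorem wNorm_zero_eq {q : ℝ≥0∞} (hq : 0 < q) (w : ℝ → ℝ) {I : Set ℝ} (hI : MeasurableSet I)
    (hI' : I ⊆ Ioi 0) (F : ℝ → ℝ≥0∞) :
    wNorm 0 q w I F = mNorm q I (fun u => ENNReal.ofReal (w u) * F u) := by
  rw [wNorm_eq_mNorm 0 hq w hI hI']; simp

theorem wNorm_one_eq {q : ℝ≥0∞} (hq : 0 < q) (w : ℝ → ℝ) {s t : ℝ} (hs : 0 ≤ s) :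
    wNorm 0 q w (Ioo s t) (fun _ => 1) = mNorm q (Ioo s t) (fun u => ENNReal.ofReal (w u)) := by
  rw [wNorm_zero_eq hq w measurableSet_Ioo fun u hu => hs.trans_lt hu.1]; simp

theorem stdSpace_eq (θ : ℝ) {q : ℝ≥0∞} (hq : 0 < q) (b : ℝ → ℝ) :
    stdSpace A₀ A₁ θ q b f = mNorm q (Ioi 0) (weighted (-θ) b fun u => peetreK A₀ A₁ u f) :=
  wNorm_eq_mNorm _ hq _ measurableSet_Ioi Subset.rfl _

theorem wNorm_Ioi_eq (θ : ℝ) {q : ℝ≥0∞} (hq : 0 < q) (a : ℝ → ℝ) {t : ℝ} (ht : 0 ≤ t) :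
    wNorm (-θ) q a (Ioi t) (fun u => peetreK A₀ A₁ u f) =
      mNorm q (Ioi t) (weighted (-θ) a fun u => peetreK A₀ A₁ u f) :=
  wNorm_eq_mNorm _ hq _ measurableSet_Ioi (Ioi_subset_Ioi ht) _

theorem spaceR_eq (θ : ℝ) {r : ℝ≥0∞} (hr : 0 < r) (b : ℝ → ℝ) {q : ℝ≥0∞} (hq : 0 < q)
    (a : ℝ → ℝ) : spaceR A₀ A₁ θ r b q a f =
      rightNorm r b q (weighted (-θ) a fun u => peetreK A₀ A₁ u f) 0 := by
  rw [spaceR, wNorm_zero_eq hr b measurableSet_Ioi Subset.rfl]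
  refine mNorm_congr measurableSet_Ioi fun t ht => ?_
  rw [wNorm_Ioi_eq A₀ A₁ f θ hq a (le_of_lt ht)]

theorem spaceRL_eq (θ : ℝ) {s : ℝ≥0∞} (hs : 0 < s) (c : ℝ → ℝ) {r : ℝ≥0∞} (hr : 0 < r)
    (b : ℝ → ℝ) {q : ℝ≥0∞} (hq : 0 < q) (a : ℝ → ℝ) : spaceRL A₀ A₁ θ s c r b q a f =
      mNorm s (Ioi 0) (fun t => ENNReal.ofReal (c t) *
        leftNorm r b q (weighted (-θ) a fun u => peetreK A₀ A₁ u f) t) := by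
  rw [spaceRL, wNorm_zero_eq hs c measurableSet_Ioi Subset.rfl]
  refine mNorm_congr measurableSet_Ioi fun t ht => ?_
  rw [wNorm_zero_eq hr b measurableSet_Ioo Ioo_subset_Ioi_self]
  congr 1
  refine mNorm_congr measurableSet_Ioo fun u hu => ?_
  rw [wNorm_eq_mNorm _ hq _ measurableSet_Ioo fun v hv => hu.1.trans hv.1]
  rfl

theorem spaceRR_eq (θ : ℝ) {s : ℝ≥0∞} (hs : 0 < s) (c : ℝ → ℝ) {r : ℝ≥0∞} (hr : 0 < r)
    (b : ℝ → ℝ) {q : ℝ≥0∞} (hq : 0 < q) (a : ℝ → ℝ) : spaceRR A₀ A₁ θ s c r b q a f =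
      mNorm s (Ioi 0) (fun t => ENNReal.ofReal (c t) *
        rightNorm r b q (weighted (-θ) a fun u => peetreK A₀ A₁ u f) t) := by
  rw [spaceRR, wNorm_zero_eq hs c measurableSet_Ioi Subset.rfl]
  refine mNorm_congr measurableSet_Ioi fun t ht => ?_
  rw [wNorm_zero_eq hr b measurableSet_Ioi (Ioi_subset_Ioi (le_of_lt ht))]
  congr 1
  refine mNorm_congr measurableSet_Ioi fun u hu => ?_
  rw [wNorm_Ioi_eq A₀ A₁ f θ hq a (le_of_lt ((mem_Ioi.1 ht).trans hu))]

end Unfold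

theorem aemeasurable_of_eq_monotone {T : ℝ → ℝ≥0∞} (hT : Monotone T) {B : ℝ → ℝ}
    (hB : ∀ t, 0 < t → 0 < B t) (h : ∀ t, 0 < t → T t = ENNReal.ofReal (B t)) :
    AEMeasurable B mulMeasure := by
  refine hT.measurable.ennreal_toReal.aemeasurable.congr (ae_mulMeasure_pos.mono fun t ht => ?_)
  simp only
  rw [h t ht, ENNReal.toReal_ofReal (hB t ht).le]

/-! ### Interpolation quasi-norms of the couple of limiting spaces -/

namespace LimitingCouple

variable {θ₀ : ℝ} {r₀ q₀ r₁ q₁ : ℝ≥0∞} {a₀ b₀ a₁ b₁ B₀ B₁ X : ℝ → ℝ}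

theorem aemeasurable_B₀ (H : LimitingCouple θ₀ r₀ q₀ r₁ q₁ a₀ b₀ a₁ b₁ B₀ B₁ X) :
    AEMeasurable B₀ mulMeasure :=
  aemeasurable_of_eq_monotone (fun _ _ h => mNorm_mono_set (Ioo_subset_Ioo_right h) _) H.sv_B₀.pos
    H.eq_B₀

theorem aemeasurable_B₁ (H : LimitingCouple θ₀ r₀ q₀ r₁ q₁ a₀ b₀ a₁ b₁ B₀ B₁ X) :
    AEMeasurable B₁ mulMeasure :=
  aemeasurable_of_eq_monotone (fun _ _ h => mNorm_mono_set (Ioo_subset_Ioo_right h) _) H.sv_B₁.pos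
    H.eq_B₁

theorem aemeasurable_X (H : LimitingCouple θ₀ r₀ q₀ r₁ q₁ a₀ b₀ a₁ b₁ B₀ B₁ X) :
    AEMeasurable X mulMeasure :=
  aemeasurable_of_eq_monotone (leftNorm_monotone _) H.sv_X.pos H.eq_X

theorem isSV_ratio (H : LimitingCouple θ₀ r₀ q₀ r₁ q₁ a₀ b₀ a₁ b₁ B₀ B₁ X) :
    IsSV (fun t => a₀ t * B₀ t / X t) := by
  simp_rw [div_eq_mul_inv]
  exact (H.sv_a₀.mul H.sv_B₀).mul H.sv_X.inv

theorem aemeasurable_rho (H : LimitingCouple θ₀ r₀ q₀ r₁ q₁ a₀ b₀ a₁ b₁ B₀ B₁ X) :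
    AEMeasurable (fun t => t ^ (1 - θ₀) * (a₀ t * B₀ t / X t)) mulMeasure := by
  have := H.ma₀
  have := H.aemeasurable_B₀
  have := H.aemeasurable_X
  fun_prop

theorem aemeasurable_tailNorm (H : LimitingCouple θ₀ r₀ q₀ r₁ q₁ a₀ b₀ a₁ b₁ B₀ B₁ X)
    (F : ℝ → ℝ≥0∞) : AEMeasurable (tailNorm r₁ b₁ q₁ B₁ F) mulMeasure :=
  (H.aemeasurable_B₁.ennreal_ofReal.mul (measurable_mNorm_Ioi F).aemeasurable).add
    (rightNorm_antitone F).measurable.aemeasurable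

variable {E : Type*} [AddCommGroup E] {𝕜 : Type*} [RCLike 𝕜] [Module 𝕜 E] [TopologicalSpace E]
  [IsTopologicalAddGroup E] [T2Space E] {A₀ A₁ : E → ℝ≥0∞}

/-- Holmstedt's formula for the couple of limiting spaces. -/
theorem peetreK_equiv (H : LimitingCouple θ₀ r₀ q₀ r₁ q₁ a₀ b₀ a₁ b₁ B₀ B₁ X)
    (hA₀ : IsQuasiBanachIn 𝕜 A₀) (hA₁ : IsQuasiBanachIn 𝕜 A₁) :
    ∃ D : ℝ≥0, ∀ (f : E) (t : ℝ), 0 < t →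
      peetreK (spaceR A₀ A₁ θ₀ r₀ b₀ q₀ a₀) (spaceR A₀ A₁ 1 r₁ b₁ q₁ a₁)
          (t ^ (1 - θ₀) * (a₀ t * B₀ t / X t)) f ≤
        D * (leftNorm r₀ b₀ q₀ (weighted (-θ₀) a₀ fun u => peetreK A₀ A₁ u f) t +
          ENNReal.ofReal (t ^ (1 - θ₀) * (a₀ t * B₀ t / X t)) *
            tailNorm r₁ b₁ q₁ B₁ (weighted (-1) a₁ fun u => peetreK A₀ A₁ u f) t) ∧
      leftNorm r₀ b₀ q₀ (weighted (-θ₀) a₀ fun u => peetreK A₀ A₁ u f) t +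
          ENNReal.ofReal (t ^ (1 - θ₀) * (a₀ t * B₀ t / X t)) *
            tailNorm r₁ b₁ q₁ B₁ (weighted (-1) a₁ fun u => peetreK A₀ A₁ u f) t ≤
        D * peetreK (spaceR A₀ A₁ θ₀ r₀ b₀ q₀ a₀) (spaceR A₀ A₁ 1 r₁ b₁ q₁ a₁)
          (t ^ (1 - θ₀) * (a₀ t * B₀ t / X t)) f := by
  obtain ⟨C₁, hC₁⟩ := exists_decomposition hA₀ hA₁
  obtain ⟨C₂, hC₂⟩ := exists_peetreK_add_le hA₀ hA₁
  obtain ⟨D₁, hD₁⟩ := H.rightNorm_le_left_add_tail C₁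
  obtain ⟨D₂, hD₂⟩ := H.le_left_add_tail
  -- The summand 1 keeps the constant nonzero, so it can be divided out before passing to the
  -- infimum over decompositions.
  refine ⟨D₁ + D₂ * C₂ + 1, fun f t ht => ⟨?_, ?_⟩⟩
  · obtain ⟨f₀, f₁, hf, h1, h2, h3, h4⟩ := hC₁ f t ht
    refine (peetreK_le hf).trans ?_
    rw [spaceR_eq A₀ A₁ f₀ θ₀ H.r₀_pos b₀ H.q₀_pos a₀, spaceR_eq A₀ A₁ f₁ 1 H.r₁_pos b₁ H.q₁_pos a₁]
    refine (hD₁ _ _ _ (isQuasiConcave_peetreK A₀ A₁ f) t ht h1 h2 h3 h4).trans ?_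
    refine mul_le_mul_left ?_ _
    push_cast
    rw [add_assoc]
    exact le_self_add
  · rw [← ENNReal.div_le_iff' (by simp) ENNReal.coe_ne_top]
    refine le_peetreK fun f₀ f₁ hf => ?_
    rw [ENNReal.div_le_iff' (by simp) ENNReal.coe_ne_top,
      spaceR_eq A₀ A₁ f₀ θ₀ H.r₀_pos b₀ H.q₀_pos a₀, spaceR_eq A₀ A₁ f₁ 1 H.r₁_pos b₁ H.q₁_pos a₁]
    refine (hD₂ _ _ (isQuasiConcave_peetreK A₀ A₁ f₀) (isQuasiConcave_peetreK A₀ A₁ f₁) C₂ _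
        (fun u hu => hf ▸ hC₂ f₀ f₁ u hu) t ht).trans (mul_le_mul_left ?_ _)
    push_cast
    rw [add_right_comm]
    exact le_add_self

/-- The quasi-norm of an interpolation space of the couple of limiting spaces. -/
theorem stdSpace_equiv (H : LimitingCouple θ₀ r₀ q₀ r₁ q₁ a₀ b₀ a₁ b₁ B₀ B₁ X)
    (hA₀ : IsQuasiBanachIn 𝕜 A₀) (hA₁ : IsQuasiBanachIn 𝕜 A₁) {a ρ : ℝ → ℝ} (ha : IsSV a)
    (hρ : ∀ t, ρ t = t ^ (1 - θ₀) * (a₀ t * B₀ t / X t)) {r : ℝ≥0∞} (hr : 0 < r) (θ : ℝ) :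
    ∃ D : ℝ≥0, ∀ f : E,
      stdSpace (spaceR A₀ A₁ θ₀ r₀ b₀ q₀ a₀) (spaceR A₀ A₁ 1 r₁ b₁ q₁ a₁) θ r a f ≤
        D * (mNorm r (Ioi 0) (fun t => ENNReal.ofReal (ρ t ^ (-θ) * a (ρ t)) *
            leftNorm r₀ b₀ q₀ (weighted (-θ₀) a₀ fun u => peetreK A₀ A₁ u f) t) +
          mNorm r (Ioi 0) (fun t => ENNReal.ofReal (ρ t ^ (1 - θ) * a (ρ t)) *
            tailNorm r₁ b₁ q₁ B₁ (weighted (-1) a₁ fun u => peetreK A₀ A₁ u f) t)) ∧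
      mNorm r (Ioi 0) (fun t => ENNReal.ofReal (ρ t ^ (-θ) * a (ρ t)) *
          leftNorm r₀ b₀ q₀ (weighted (-θ₀) a₀ fun u => peetreK A₀ A₁ u f) t) ≤
        D * stdSpace (spaceR A₀ A₁ θ₀ r₀ b₀ q₀ a₀) (spaceR A₀ A₁ 1 r₁ b₁ q₁ a₁) θ r a f ∧
      mNorm r (Ioi 0) (fun t => ENNReal.ofReal (ρ t ^ (1 - θ) * a (ρ t)) *
          tailNorm r₁ b₁ q₁ B₁ (weighted (-1) a₁ fun u => peetreK A₀ A₁ u f) t) ≤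
        D * stdSpace (spaceR A₀ A₁ θ₀ r₀ b₀ q₀ a₀) (spaceR A₀ A₁ 1 r₁ b₁ q₁ a₁) θ r a f := by
  obtain rfl : ρ = fun t => t ^ (1 - θ₀) * (a₀ t * B₀ t / X t) := funext hρ
  obtain ⟨D, hD⟩ := H.peetreK_equiv hA₀ hA₁
  obtain ⟨D', hD'⟩ := mNorm_weighted_equiv hr ha H.isSV_ratio (sub_pos.2 H.θ_lt) (fun _ _ => rfl)
    H.aemeasurable_rho θ D
  refine ⟨D', fun f => ?_⟩
  rw [stdSpace_eq _ _ _ _ hr]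
  exact hD' _ _ _ (isQuasiConcave_peetreK _ _ f) (leftNorm_monotone _).measurable.aemeasurable
    (H.aemeasurable_tailNorm _) (fun t ht => (hD f t ht).1) (fun t ht => (hD f t ht).2)

theorem isSV_comp (H : LimitingCouple θ₀ r₀ q₀ r₁ q₁ a₀ b₀ a₁ b₁ B₀ B₁ X) {a ρ : ℝ → ℝ}
    (ha : IsSV a) (hρ : ∀ t, ρ t = t ^ (1 - θ₀) * (a₀ t * B₀ t / X t)) :
    (∀ t, 0 < t → 0 < ρ t) ∧ IsSV (fun t => a (ρ t)) := by
  obtain ⟨C, hC, h⟩ := H.isSV_ratio.spread_le (1 - θ₀)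
  have hpos : ∀ t, 0 < t → 0 < ρ t := fun t ht => by
    rw [hρ t]; exact mul_pos (Real.rpow_pos_of_pos ht _) (H.isSV_ratio.pos t ht)
  refine ⟨hpos, ha.comp hpos (A := |1 - θ₀| + 1) (by positivity) hC fun s t hs ht => ?_⟩
  rw [hρ s, hρ t]; exact h s t hs ht

section Weights

variable {a ρ ψ : ℝ → ℝ} {θ η : ℝ}

/-- The origin of η and a#: the power of t is -(1 - θ₀)θ - θ₀ = -η, and the factor ρ^(-θ) turns χ₀
into χ₀^(1-θ) χ₁^θ. -/
theorem weight_left (H : LimitingCouple θ₀ r₀ q₀ r₁ q₁ a₀ b₀ a₁ b₁ B₀ B₁ X)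
    (hρ : ∀ t, ρ t = t ^ (1 - θ₀) * (a₀ t * B₀ t / X t)) (hη : η = (1 - θ) * θ₀ + θ)
    (hψ : ∀ t, ψ t = (a₀ t * B₀ t) ^ (1 - θ) * X t ^ θ * a (ρ t)) {t : ℝ} (ht : 0 < t) :
    ρ t ^ (-θ) * a (ρ t) * (t ^ (-θ₀) * (a₀ t * B₀ t)) = t ^ (-η) * ψ t := by
  have p1 := mul_pos (H.sv_a₀.pos t ht) (H.sv_B₀.pos t ht)
  have p2 := H.sv_X.pos t ht
  have e1 : ρ t ^ (-θ) = t ^ ((1 - θ₀) * -θ) * ((a₀ t * B₀ t) ^ (-θ) * X t ^ θ) := by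
    rw [hρ t, Real.mul_rpow (by positivity) (by positivity), ← Real.rpow_mul ht.le,
      Real.div_rpow p1.le p2.le, Real.rpow_neg p2.le, div_inv_eq_mul]
  have e2 : t ^ (-η) = t ^ ((1 - θ₀) * -θ) * t ^ (-θ₀) := by
    rw [← Real.rpow_add ht, hη]; congr 1; ring
  have e3 : (a₀ t * B₀ t) ^ (1 - θ) = (a₀ t * B₀ t) ^ (-θ) * (a₀ t * B₀ t) := by
    rw [sub_eq_neg_add, Real.rpow_add p1, Real.rpow_one]
  rw [e1, e2, hψ t, e3]; ring

/-- Reduces to the left weight, because ρ t · t⁻¹ X t = t^(-θ₀) a₀ B₀. -/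
theorem weight_tail (H : LimitingCouple θ₀ r₀ q₀ r₁ q₁ a₀ b₀ a₁ b₁ B₀ B₁ X)
    (hρ : ∀ t, ρ t = t ^ (1 - θ₀) * (a₀ t * B₀ t / X t)) (hη : η = (1 - θ) * θ₀ + θ)
    (hψ : ∀ t, ψ t = (a₀ t * B₀ t) ^ (1 - θ) * X t ^ θ * a (ρ t)) {t : ℝ} (ht : 0 < t) :
    ρ t ^ (1 - θ) * a (ρ t) * (t ^ (-1 : ℝ) * X t) = t ^ (-η) * ψ t := by
  have p1 := mul_pos (H.sv_a₀.pos t ht) (H.sv_B₀.pos t ht)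
  have p2 := H.sv_X.pos t ht
  have p3 : 0 < ρ t := by rw [hρ t]; positivity
  have p4 : t ^ (1 - θ₀) = t * t ^ (-θ₀) := by
    rw [sub_eq_add_neg, Real.rpow_add ht, Real.rpow_one]
  rw [← H.weight_left hρ hη hψ ht, sub_eq_neg_add, Real.rpow_add p3, Real.rpow_one,
    Real.rpow_neg_one]
  have e : ρ t * (t⁻¹ * X t) = t ^ (-θ₀) * (a₀ t * B₀ t) := by
    rw [hρ t, p4]; field_simp
  rw [← e]; ring

end Weights

end LimitingCouple

theorem SlowlyVarying.aemeasurable_mulMeasure {b : ℝ → ℝ} (hb : SlowlyVarying b) :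
    AEMeasurable b mulMeasure := hb.aemeasurable.mono_ac mulMeasure_absolutelyContinuous

theorem limitingCouple_of_slowlyVarying {θ₀ : ℝ} (hθ₀ : 0 < θ₀) (hθ₀' : θ₀ < 1)
    {r₀ q₀ r₁ q₁ : ℝ≥0∞} (hr₀ : 0 < r₀) (hq₀ : 0 < q₀) (hr₁ : 0 < r₁) (hq₁ : 0 < q₁)
    {a₀ b₀ a₁ b₁ : ℝ → ℝ} (ha₀ : SlowlyVarying a₀) (hb₀ : SlowlyVarying b₀)
    (ha₁ : SlowlyVarying a₁) (hb₁ : SlowlyVarying b₁)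
    (h₀ : mNorm r₀ (Ioo 0 1) (fun u => ENNReal.ofReal (b₀ u)) ≠ ∞)
    (h₁ : leftNorm r₁ b₁ q₁ (fun u => ENNReal.ofReal (a₁ u)) 1 ≠ ∞) :
    LimitingCouple θ₀ r₀ q₀ r₁ q₁ a₀ b₀ a₁ b₁
      (fun t => (mNorm r₀ (Ioo 0 t) (fun u => ENNReal.ofReal (b₀ u))).toReal)
      (fun t => (mNorm r₁ (Ioo 0 t) (fun u => ENNReal.ofReal (b₁ u))).toReal)
      (fun t => (leftNorm r₁ b₁ q₁ (fun u => ENNReal.ofReal (a₁ u)) t).toReal) := by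
  -- Finiteness of the norm of b₁ alone follows from that of the iterated norm, since a₁(1) times
  -- the former is bounded by a multiple of the latter.
  have h₁' : mNorm r₁ (Ioo 0 1) (fun u => ENNReal.ofReal (b₁ u)) ≠ ∞ := by
    intro h
    obtain ⟨A, C, hAC⟩ := ha₁.isSV.isModerate 0
    simp only [Real.rpow_zero, one_mul] at hAC
    obtain ⟨D, hD⟩ := exists_mul_le_leftNorm hb₁.isSV hr₁ hq₁ A C
    have h2 := hD _ hAC 1 one_pos
    rw [h, ENNReal.mul_top (by simpa using ha₁.pos 1 one_pos), top_le_iff] at h2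
    exact ENNReal.mul_ne_top ENNReal.coe_ne_top h₁ h2
  obtain ⟨s₀, e₀⟩ := hb₀.isSV.mNorm_Ioo_zero hr₀ h₀
  obtain ⟨s₁, e₁⟩ := hb₁.isSV.mNorm_Ioo_zero hr₁ h₁'
  obtain ⟨sX, eX⟩ := leftNorm_isSV ha₁.isSV hb₁.isSV hr₁ hq₁ h₁
  exact ⟨hθ₀, hθ₀', hr₀, hq₀, hr₁, hq₁, ha₀.isSV, hb₀.isSV, ha₁.isSV, hb₁.isSV,
    ha₀.aemeasurable_mulMeasure, hb₀.aemeasurable_mulMeasure, ha₁.aemeasurable_mulMeasure,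
    hb₁.aemeasurable_mulMeasure, s₀, s₁, sX, e₀, e₁, eX⟩

theorem wNorm_wNorm_one_eq {r q : ℝ≥0∞} (hr : 0 < r) (hq : 0 < q) (b a : ℝ → ℝ) (t : ℝ) :
    wNorm 0 r b (Ioo 0 t) (fun s => wNorm 0 q a (Ioo s t) (fun _ => 1)) =
      leftNorm r b q (fun u => ENNReal.ofReal (a u)) t := by
  rw [wNorm_zero_eq hr b measurableSet_Ioo Ioo_subset_Ioi_self]
  refine mNorm_congr measurableSet_Ioo fun s hs => ?_
  rw [wNorm_one_eq hq a hs.1.le]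

end RealInterp

/-! ### The three interpolation formulas -/

open RealInterp
theorem theorem50 {𝕜 : Type*} [RCLike 𝕜] {E : Type*} [AddCommGroup E] [Module 𝕜 E]
    [TopologicalSpace E] [IsTopologicalAddGroup E] [ContinuousSMul 𝕜 E] [T2Space E]
    -- the compatible couple of quasi-Banach spaces
    (A₀ A₁ : E → ℝ≥0∞) (hA₀ : IsQuasiBanachIn 𝕜 A₀) (hA₁ : IsQuasiBanachIn 𝕜 A₁)
    (hA : ∃ x : E, x ≠ 0 ∧ A₀ x < ∞ ∧ A₁ x < ∞)
    -- the parameters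
    (θ₀ : ℝ) (hθ₀ : 0 < θ₀) (hθ₀' : θ₀ < 1)
    (r r₀ q₀ r₁ q₁ : ℝ≥0∞) (hr : 0 < r) (hr₀ : 0 < r₀) (hq₀ : 0 < q₀) (hr₁ : 0 < r₁) (hq₁ : 0 < q₁)
    (a a₀ b₀ a₁ b₁ : ℝ → ℝ) (ha : SlowlyVarying a) (ha₀ : SlowlyVarying a₀)
    (hb₀ : SlowlyVarying b₀) (ha₁ : SlowlyVarying a₁) (hb₁ : SlowlyVarying b₁)
    (h₀ : wNorm 0 r₀ b₀ (Set.Ioo 0 1) (fun _ => 1) < ∞)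
    (h₁ : wNorm 0 r₁ b₁ (Set.Ioo 0 1)
      (fun s => wNorm 0 q₁ a₁ (Set.Ioo s 1) (fun _ => 1)) < ∞)
    -- the auxiliary functions
    (χ₀ χ₁ ρ B₁ : ℝ → ℝ) (aSharp : ℝ → ℝ → ℝ)
    (hχ₀ : ∀ t, χ₀ t = a₀ t * (wNorm 0 r₀ b₀ (Set.Ioo 0 t) (fun _ => 1)).toReal)
    (hχ₁ : ∀ t, χ₁ t = (wNorm 0 r₁ b₁ (Set.Ioo 0 t)
      (fun s => wNorm 0 q₁ a₁ (Set.Ioo s t) (fun _ => 1))).toReal)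
    (hρ : ∀ t, ρ t = t ^ (1 - θ₀) * (χ₀ t / χ₁ t))
    (haSharp : ∀ θ t, aSharp θ t = χ₀ t ^ (1 - θ) * χ₁ t ^ θ * a (ρ t))
    (hB₁ : ∀ t, B₁ t = (wNorm 0 r₁ b₁ (Set.Ioo 0 t) (fun _ => 1)).toReal * a (ρ t))
    -- the couple under consideration
    (X₀ X₁ : E → ℝ≥0∞) (hX₀ : X₀ = spaceR A₀ A₁ θ₀ r₀ b₀ q₀ a₀)
    (hX₁ : X₁ = spaceR A₀ A₁ 1 r₁ b₁ q₁ a₁) :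
    (∀ θ : ℝ, 0 < θ → θ < 1 →
      SpaceEq (stdSpace X₀ X₁ θ r a)
        (stdSpace A₀ A₁ ((1 - θ) * θ₀ + θ) r (aSharp θ))) ∧
    (wNorm 0 r a (Set.Ioi 1) (fun _ => 1) < ∞ →
      SpaceEq (stdSpace X₀ X₁ 0 r a)
        (spaceRL A₀ A₁ θ₀ r (fun t => a (ρ t)) r₀ b₀ q₀ a₀)) ∧
    (wNorm 0 r a (Set.Ioo 0 1) (fun _ => 1) < ∞ →
      SpaceEq (stdSpace X₀ X₁ 1 r a)
        (interSpace (interSpace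
          (stdSpace A₀ A₁ 1 r (aSharp 1))
          (spaceR A₀ A₁ 1 r B₁ q₁ a₁))
          (spaceRR A₀ A₁ 1 r (fun t => a (ρ t)) r₁ b₁ q₁ a₁))) := by
  subst hX₀ hX₁
  have hwB : ∀ t, wNorm 0 r₀ b₀ (Set.Ioo 0 t) (fun _ => 1) =
      mNorm r₀ (Set.Ioo 0 t) (fun u => ENNReal.ofReal (b₀ u)) := fun t => wNorm_one_eq hr₀ b₀ le_rfl
  have hwB₁ : ∀ t, wNorm 0 r₁ b₁ (Set.Ioo 0 t) (fun _ => 1) =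
      mNorm r₁ (Set.Ioo 0 t) (fun u => ENNReal.ofReal (b₁ u)) := fun t => wNorm_one_eq hr₁ b₁ le_rfl
  have hwX := wNorm_wNorm_one_eq hr₁ hq₁ b₁ a₁
  rw [hwB] at h₀
  rw [hwX] at h₁
  have H := limitingCouple_of_slowlyVarying hθ₀ hθ₀' hr₀ hq₀ hr₁ hq₁ ha₀ hb₀ ha₁ hb₁ h₀.ne h₁.ne
  set B₀ : ℝ → ℝ := fun t => (mNorm r₀ (Set.Ioo 0 t) (fun u => ENNReal.ofReal (b₀ u))).toReal with hB₀
  set b₁' : ℝ → ℝ := fun t => (mNorm r₁ (Set.Ioo 0 t) (fun u => ENNReal.ofReal (b₁ u))).toReal with hb₁'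
  have hX : (fun t => (leftNorm r₁ b₁ q₁ (fun u => ENNReal.ofReal (a₁ u)) t).toReal) = χ₁ := by
    funext t; rw [hχ₁, hwX]
  rw [hX] at H
  have hχ₀' : ∀ t, χ₀ t = a₀ t * B₀ t := fun t => by rw [hχ₀, hwB]
  have hρ' : ∀ t, ρ t = t ^ (1 - θ₀) * (a₀ t * B₀ t / χ₁ t) := fun t => by rw [hρ, hχ₀']
  -- Here B₁ carries the factor a ∘ ρ; the function playing the role of B₁ in the limiting couple is
  -- b₁'.
  have hB₁' : ∀ t, B₁ t = b₁' t * a (ρ t) := fun t => by rw [hB₁, hwB₁]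
  have hψ : ∀ θ t, aSharp θ t = (a₀ t * B₀ t) ^ (1 - θ) * χ₁ t ^ θ * a (ρ t) := fun θ t => by
    rw [haSharp, hχ₀']
  obtain ⟨hρpos, hcomp⟩ := H.isSV_comp ha.isSV hρ'
  have hψsv : ∀ θ, IsSV (aSharp θ) := fun θ => by
    rw [funext (hψ θ)]
    exact (((H.sv_a₀.mul H.sv_B₀).rpow (1 - θ)).mul (H.sv_X.rpow θ)).mul hcomp
  have hw0 : ∀ (β : ℝ) t, 0 < t → 0 < ρ t ^ β * a (ρ t) := fun β t ht =>
    mul_pos (Real.rpow_pos_of_pos (hρpos t ht) _) (hcomp.pos t ht)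
  have hK := isQuasiConcave_peetreK A₀ A₁
  -- the three comparisons between the leading term and the two others
  have F₁ : ∀ θ, ∃ D : ℝ≥0, ∀ f : E,
      stdSpace A₀ A₁ ((1 - θ) * θ₀ + θ) r (aSharp θ) f ≤ D * mNorm r (Set.Ioi 0)
        (fun t => ENNReal.ofReal (ρ t ^ (-θ) * a (ρ t)) *
          leftNorm r₀ b₀ q₀ (weighted (-θ₀) a₀ fun u => peetreK A₀ A₁ u f) t) := by
    intro θ
    obtain ⟨D, hD⟩ := H.mNorm_weighted_le_leftNorm hr (hw0 (-θ))
      fun t ht => H.weight_left hρ' rfl (hψ θ) ht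
    exact ⟨D, fun f => by rw [stdSpace_eq _ _ _ _ hr]; exact hD _ (hK f)⟩
  have F₂ : ∀ θ, 0 < θ → ∃ D : ℝ≥0, ∀ f : E, mNorm r (Set.Ioi 0)
        (fun t => ENNReal.ofReal (ρ t ^ (-θ) * a (ρ t)) *
          leftNorm r₀ b₀ q₀ (weighted (-θ₀) a₀ fun u => peetreK A₀ A₁ u f) t) ≤
      D * stdSpace A₀ A₁ ((1 - θ) * θ₀ + θ) r (aSharp θ) f := by
    intro θ hθ
    -- The gaps that drive the Hardy inequalities are η - θ₀ = θ(1 - θ₀) here and 1 - η = (1 - θ)(1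
    -- - θ₀) for the tail.
    obtain ⟨D, hD⟩ := H.leftNorm_le_mNorm_weighted hr (η := (1 - θ) * θ₀ + θ) (by nlinarith)
      (hψsv θ) (hw0 (-θ)) fun t ht => H.weight_left hρ' rfl (hψ θ) ht
    exact ⟨D, fun f => by rw [stdSpace_eq _ _ _ _ hr]; exact hD _ (hK f)⟩
  have F₃ : ∀ θ, θ < 1 → ∃ D : ℝ≥0, ∀ f : E, mNorm r (Set.Ioi 0)
        (fun t => ENNReal.ofReal (ρ t ^ (1 - θ) * a (ρ t)) *
          tailNorm r₁ b₁ q₁ b₁' (weighted (-1) a₁ fun u => peetreK A₀ A₁ u f) t) ≤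
      D * stdSpace A₀ A₁ ((1 - θ) * θ₀ + θ) r (aSharp θ) f := by
    intro θ hθ
    obtain ⟨D, hD⟩ := H.tailNorm_le_mNorm_weighted hr (η := (1 - θ) * θ₀ + θ) (by nlinarith)
      (hψsv θ) (hw0 (1 - θ)) fun t ht => H.weight_tail hρ' rfl (hψ θ) ht
    exact ⟨D, fun f => by rw [stdSpace_eq _ _ _ _ hr]; exact hD _ (hK f)⟩
  refine ⟨fun θ hθ hθ' => ?_, fun _ => ?_, fun _ => ?_⟩
  -- Both gaps are open, so the left and the tail terms are absorbed by the leading term.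
  · obtain ⟨D, hD⟩ := H.stdSpace_equiv hA₀ hA₁ ha.isSV hρ' hr θ
    obtain ⟨D₁, hD₁⟩ := F₁ θ
    obtain ⟨D₂, hD₂⟩ := F₂ θ hθ
    obtain ⟨D₃, hD₃⟩ := F₃ θ hθ'
    refine ⟨⟨D₁ * D, fun f => ?_⟩, ⟨D * (D₂ + D₃), fun f => ?_⟩⟩
    · rw [ENNReal.coe_mul, mul_assoc]
      exact (hD₁ f).trans (mul_le_mul_right (hD f).2.1 _)
    · rw [ENNReal.coe_mul, mul_assoc, ENNReal.coe_add, add_mul]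
      exact (hD f).1.trans (mul_le_mul_right (add_le_add (hD₂ f) (hD₃ f)) _)
  -- At θ = 0 the left term cannot be simplified, but it dominates the leading term, which in turn
  -- dominates the tail.
  · obtain ⟨D, hD⟩ := H.stdSpace_equiv hA₀ hA₁ ha.isSV hρ' hr 0
    obtain ⟨D₁, hD₁⟩ := F₁ 0
    obtain ⟨D₃, hD₃⟩ := F₃ 0 zero_lt_one
    have e : ∀ f : E, spaceRL A₀ A₁ θ₀ r (fun t => a (ρ t)) r₀ b₀ q₀ a₀ f = mNorm r (Set.Ioi 0)
        (fun t => ENNReal.ofReal (ρ t ^ (-0 : ℝ) * a (ρ t)) *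
          leftNorm r₀ b₀ q₀ (weighted (-θ₀) a₀ fun u => peetreK A₀ A₁ u f) t) := fun f => by
      rw [spaceRL_eq _ _ _ _ hr _ hr₀ _ hq₀]
      simp only [neg_zero, Real.rpow_zero, one_mul]
    refine ⟨⟨D, fun f => ?_⟩, ⟨D * (1 + D₃ * D₁), fun f => ?_⟩⟩
    · rw [e]; exact (hD f).2.1
    · rw [e, ENNReal.coe_mul, mul_assoc, ENNReal.coe_add, add_mul, ENNReal.coe_one, one_mul,
        ENNReal.coe_mul, mul_assoc]
      exact (hD f).1.trans (mul_le_mul_right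
        (add_le_add le_rfl ((hD₃ f).trans (mul_le_mul_right (hD₁ f) _))) _)
  -- At θ = 1 the left term is equivalent to the leading one, while the tail persists. Its two
  -- summands, weighted by a ∘ ρ, are the quasi-norms of the last two spaces of the intersection.
  · obtain ⟨D, hD⟩ := H.stdSpace_equiv hA₀ hA₁ ha.isSV hρ' hr 1
    obtain ⟨D₁, hD₁⟩ := F₁ 1
    obtain ⟨D₂, hD₂⟩ := F₂ 1 zero_lt_one
    obtain ⟨D₃, hD₃⟩ := mNorm_weighted_add_le hr (w := fun t => a (ρ t)) hcomp (α := 0)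
      (fun t _ => by rw [Real.rpow_zero, one_mul])
    have e1 : (1 - 1) * θ₀ + 1 = 1 := by ring
    rw [e1] at hD₁ hD₂
    simp only [sub_self, Real.rpow_zero, one_mul] at hD
    have eB : ∀ f : E, spaceR A₀ A₁ 1 r B₁ q₁ a₁ f = mNorm r (Set.Ioi 0)
        (fun t => ENNReal.ofReal (a (ρ t)) * (ENNReal.ofReal (b₁' t) *
          mNorm q₁ (Set.Ioi t) (weighted (-1) a₁ fun u => peetreK A₀ A₁ u f))) := fun f => by
      rw [spaceR_eq _ _ _ _ hr _ hq₁]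
      refine mNorm_congr measurableSet_Ioi fun t ht => ?_
      rw [hB₁', ENNReal.ofReal_mul (H.sv_B₁.pos t ht).le, mul_comm (ENNReal.ofReal (b₁' t)),
        mul_assoc]
    have eR : ∀ f : E, spaceRR A₀ A₁ 1 r (fun t => a (ρ t)) r₁ b₁ q₁ a₁ f = mNorm r (Set.Ioi 0)
        (fun t => ENNReal.ofReal (a (ρ t)) *
          rightNorm r₁ b₁ q₁ (weighted (-1) a₁ fun u => peetreK A₀ A₁ u f) t) := fun f =>
      spaceRR_eq _ _ _ _ hr _ hr₁ _ hq₁ _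
    refine ⟨⟨D₁ * D + D, fun f => ?_⟩, ⟨D * (D₂ + D₃ * 2), fun f => ?_⟩⟩
    · rw [interSpace, interSpace]
      have h1 : (D : ℝ≥0∞) ≤ ((D₁ * D + D : ℝ≥0) : ℝ≥0∞) := by exact_mod_cast le_add_self
      have h2 : ((D₁ * D : ℝ≥0) : ℝ≥0∞) ≤ ((D₁ * D + D : ℝ≥0) : ℝ≥0∞) := by
        exact_mod_cast le_self_add
      refine max_le (max_le ?_ ?_) ?_
      · refine le_trans ?_ (mul_le_mul_left h2 _)
        rw [ENNReal.coe_mul, mul_assoc]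
        exact (hD₁ f).trans (mul_le_mul_right (hD f).2.1 _)
      · refine le_trans ?_ ((hD f).2.2.trans (mul_le_mul_left h1 _))
        rw [eB]
        exact mNorm_mono measurableSet_Ioi fun t _ => mul_le_mul_right le_self_add _
      · refine le_trans ?_ ((hD f).2.2.trans (mul_le_mul_left h1 _))
        rw [eR]
        exact mNorm_mono measurableSet_Ioi fun t _ => mul_le_mul_right le_add_self _
    · rw [interSpace, interSpace]
      set M := max (max (stdSpace A₀ A₁ 1 r (aSharp 1) f) (spaceR A₀ A₁ 1 r B₁ q₁ a₁ f))
        (spaceRR A₀ A₁ 1 r (fun t => a (ρ t)) r₁ b₁ q₁ a₁ f)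
      have m1 : stdSpace A₀ A₁ 1 r (aSharp 1) f ≤ M := (le_max_left _ _).trans (le_max_left _ _)
      have m2 : spaceR A₀ A₁ 1 r B₁ q₁ a₁ f ≤ M := (le_max_right _ _).trans (le_max_left _ _)
      have m3 : spaceRR A₀ A₁ 1 r (fun t => a (ρ t)) r₁ b₁ q₁ a₁ f ≤ M := le_max_right _ _
      rw [eB] at m2
      rw [eR] at m3
      have h1 := (hD₂ f).trans (mul_le_mul_right m1 _)
      have h2 := (hD₃ _ _
        (H.aemeasurable_B₁.ennreal_ofReal.mul (measurable_mNorm_Ioi (q := q₁)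
          (weighted (-1) a₁ fun u => peetreK A₀ A₁ u f)).aemeasurable)
        (rightNorm_antitone (r := r₁) (b := b₁) (q := q₁)
          (weighted (-1) a₁ fun u => peetreK A₀ A₁ u f)).measurable.aemeasurable).trans
        (mul_le_mul_right (add_le_add m2 m3) _)
      refine ((hD f).1.trans (mul_le_mul_right (add_le_add h1 h2) _)).trans_eq ?_
      push_cast
      ring
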